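/- Consider $n$ jobs with processing times $p_j\ge 0$ (real numbers), each assigned to one of two identical machines. For a schedule $\sigma$ let $L_1,L_2$ be the machine loads (sums of processing times), $L_{\max}=\max(L_1,L_2)$ the makespan, and $\Delta=L_{\max}-\min(L_1,L_2)$. For a set $S$ of jobs let $v(S)$ be the total processing time of the jobs of $S$ on the critical machine (one of load $L_{\max}$) minus that of the jobs of $S$ on the other machine. Swapping $S$ means changing the machine of every job in $S$. An $(n,k,k^2)$-splitter is a family $H$ of functions $h:\{1,\dots,n\}\to\{1,\dots,k^2\}$ such that for every $S$ with $|S|=k$ some $h\in H$ satisfies $\bigl||h^{-1}(c)\cap S|-|h^{-1}(c')\cap S|\bigr|\le 1$ for all $c,c'$. The $2k^2$ cyclic recolorings $m_1,\dots,m_{2k^2}:\{1,\dots,k^2\}\to\{0,1\}$ are defined as follows, with positions read modulo $k^2$: $m_1$ sends $1,\dots,\lceil k^2/2\rceil$ to $0$ and the rest to $1$; for even $i$, $m_i$ is $m_{i-1}$ with position $\lceil k^2/2\rceil+i/2$ changed to $0$; for odd $i>1$, $m_i$ is $m_{i-1}$ with position $\lfloor i/2\rfloor$ changed to $1$. The derandomized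 $k$-swap search based on $H$ considers, for all $h\in H$ and all $i\le 2k^2$, the division of the jobs into $A=\{j: m_i(h(j))=0\}$ and its complement $B$, and looks for $S_1\subseteq A$, $S_2\subseteq B$ with $|S_1|=\lceil k/2\rceil$, $|S_2|=\lfloor k/2\rfloor$ and $0<v(S_1)+v(S_2)<\Delta$. If such sets exist for some division, it swaps $S_1\cup S_2$ for one such pair and returns True; otherwise it leaves $\sigma$ unchanged and returns False. **Theorem.** There are a deterministic random access machine program and a constant $C$ such that for all $n\ge 2$ and $k\ge 2$ there is an $(n,k,k^2)$-splitter $H$ with $|H|\le C\,k^6\log k\,\log n$ for which the following holds. On input $n$, $k$, any processing times and any schedule $\sigma$, the program halts after at most $$C\cdot k^9\cdot n^{\lceil k/2\rceil}\cdot\log n\cdot\log k$$ steps, all work, including any computation of the splitter, being counted, with an answer of the derandomized $k$-swap search based on $H$. This answer is correct: if it is True, the new schedule arises from $\sigma$ by swapping exactly $k$ jobs and has smaller makespan; if it is False, no swap of exactly $k$ jobs decreases the makespan. The same holds, with the same form of the time bound, for swaps of at most $k$ jobs, where the search is carried out for all $k'\in\{1,\dots,k\}$ with $(n,k',k'^2)$-splitters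 of size at most $C\,k^6\log k\,\log n$. Here a step is one instruction or one test of the machine. Words are natural numbers of $O(k\log n)$ bits, with addition, truncated subtraction, multiplication, integer division, comparison and indirect addressing; processing times are real numbers that can only be copied, added, subtracted and compared. -/

import Mathlib

namespace KSwap

/-! ### Schedules on two identical machines -/

/-- A schedule of the jobs `0, …, n - 1`: it sends each job to the machine that processes it. -/
abbrev Schedule (n : ℕ) := Fin n → Fin 2

/-- The load of machine `i`. -/
noncomputable def load {n : ℕ} (p : Fin n → ℝ) (σ : Schedule n) (i : Fin 2) : ℝ :=
  ∑ j with σ j = i, p j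

/-- The makespan `L_max`. -/
noncomputable def makespan {n : ℕ} (p : Fin n → ℝ) (σ : Schedule n) : ℝ :=
  max (load p σ 0) (load p σ 1)

/-- `Δ = L_max - L_min`. -/
noncomputable def gap {n : ℕ} (p : Fin n → ℝ) (σ : Schedule n) : ℝ :=
  makespan p σ - min (load p σ 0) (load p σ 1)

/-- The critical machine (machine `0` if both loads agree). -/
noncomputable def critical {n : ℕ} (p : Fin n → ℝ) (σ : Schedule n) : Fin 2 :=
  if load p σ 1 ≤ load p σ 0 then 0 else 1

/-- The schedule obtained by changing the machine of exactly the jobs in `S`. -/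
def swap {n : ℕ} (σ : Schedule n) (S : Finset (Fin n)) : Schedule n :=
  fun j => if j ∈ S then 1 - σ j else σ j

/-- The load that leaves the critical machine when the jobs in `S` are swapped. -/
noncomputable def surplus {n : ℕ} (p : Fin n → ℝ) (σ : Schedule n) (S : Finset (Fin n)) : ℝ :=
  ∑ j ∈ S with σ j = critical p σ, p j - ∑ j ∈ S with σ j ≠ critical p σ, p j

/-! ### Splitters, recolorings, and the derandomized search -/

/-- `H` is an `(n, k, l)`-splitter: every `k`-subset is split evenly by some member of `H`. -/
def IsSplitter {n l : ℕ} (k : ℕ) (H : Finset (Fin n → Fin l)) : Prop :=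
  ∀ S : Finset (Fin n), S.card = k → ∃ h ∈ H, ∀ c c' : Fin l,
    (S.filter fun j => h j = c).card ≤ (S.filter fun j => h j = c').card + 1

/-- The cyclic recolorings of the numbers `0, …, K - 1` by `0` and `1`.  The first one colors the
first `⌈K/2⌉` numbers with `0` and the others with `1`; then, in turn, the number after the end of
the block of zeros is recolored with `0`, and the number at the beginning of the block is
recolored with `1`, positions being read cyclically. -/
def recolor (K : ℕ) : ℕ → ℕ → Fin 2
  | 0, c => if c < (K + 1) / 2 then 0 else 1
  | i + 1, c =>
    if i % 2 = 0 then
      if c = ((K + 1) / 2 + i / 2) % K then 0 else recolor K i c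
    else
      if c = (i / 2) % K then 1 else recolor K i c

/-- The set `A` of the division `(A, Aᶜ)` of the jobs given by a hash function and the `i`-th
recoloring of its `k²` values. -/
def part {n k : ℕ} (h : Fin n → Fin (k ^ 2)) (i : ℕ) : Finset (Fin n) :=
  Finset.univ.filter fun j => recolor (k ^ 2) i (h j) = 0

/-- What one pass of the search with division `(A, Aᶜ)` looks for: `⌈k/2⌉` jobs `S₁ ⊆ A` and
`⌊k/2⌋` jobs `S₂ ⊆ Aᶜ` whose values `x`, `y` satisfy `0 < x + y < Δ`. -/
def IsHit {n : ℕ} (p : Fin n → ℝ) (σ : Schedule n) (k : ℕ) (A S₁ S₂ : Finset (Fin n)) : Prop :=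
  S₁ ⊆ A ∧ S₁.card = (k + 1) / 2 ∧ S₂ ⊆ Aᶜ ∧ S₂.card = k / 2 ∧
    0 < surplus p σ S₁ + surplus p σ S₂ ∧ surplus p σ S₁ + surplus p σ S₂ < gap p σ

/-- `(b, σ')` is a possible answer of the derandomized search for swaps of exactly `k` jobs, with
`k ∈ K`, that runs through the divisions given by the members of `H k` and the `2k²` recolorings:
either `b` is true and `σ'` comes from a hit in one of the divisions, or `b` is false, no division
has a hit, and `σ' = σ`. -/
def IsAnswer {n : ℕ} (p : Fin n → ℝ) (σ : Schedule n) (K : Finset ℕ)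
    (H : (k : ℕ) → Finset (Fin n → Fin (k ^ 2))) (b : Bool) (σ' : Schedule n) : Prop :=
  (b = true ∧ ∃ k ∈ K, ∃ h ∈ H k, ∃ i < 2 * k ^ 2, ∃ S₁ S₂ : Finset (Fin n),
      IsHit p σ k (part h i) S₁ S₂ ∧ σ' = swap σ (S₁ ∪ S₂)) ∨
  (b = false ∧ σ' = σ ∧ ∀ k ∈ K, ∀ h ∈ H k, ∀ i < 2 * k ^ 2, ∀ S₁ S₂ : Finset (Fin n),
      ¬ IsHit p σ k (part h i) S₁ S₂)

/-! ### A deterministic random access machine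

Programs are structured.  They use finitely many word variables, finitely many arrays of words,
and finitely many arrays of real numbers.  Words are natural numbers below a bound `B`; an
instruction that would produce a larger word cannot be executed.  Real numbers can only be copied,
added, subtracted and compared.  Every instruction and every evaluation of a test is one step. -/

structure State where
  var : ℕ → ℕ
  arr : ℕ → ℕ → ℕ
  num : ℕ → ℕ → ℝ

/-- Write `v` into cell `i` of array `a`. -/
def write {α : Type} (f : ℕ → ℕ → α) (a i : ℕ) (v : α) : ℕ → ℕ → α :=
  Function.update f a (Function.update (f a) i v)

/-- Word operations; subtraction is truncated, `div` rounds down. -/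
inductive Op
  | add
  | sub
  | mul
  | div

def Op.eval : Op → ℕ → ℕ → ℕ
  | .add, a, b => a + b
  | .sub, a, b => a - b
  | .mul, a, b => a * b
  | .div, a, b => a / b

/-- `lt x y` tests `x < y` for word variables, `numLt u x v y` tests `u[x] < v[y]` for arrays of
real numbers. -/
inductive Test
  | lt (x y : ℕ)
  | numLt (u x v y : ℕ)

def Test.holds : Test → State → Prop
  | .lt x y, s => s.var x < s.var y
  | .numLt u x v y, s => s.num u (s.var x) < s.num v (s.var y)

inductive Prog
  | skip
  | const (x c : ℕ)
  | op (o : Op) (x y z : ℕ)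
  | load (x a y : ℕ)
  | store (a x y : ℕ)
  | numCopy (u x v y : ℕ)
  | numAdd (u x v y : ℕ)
  | numSub (u x v y : ℕ)
  | seq (P Q : Prog)
  | cond (b : Test) (P Q : Prog)
  | loop (b : Test) (P : Prog)

/-- `Exec B P s s' t`: on words below `B`, the program `P` started in `s` halts in `s'` after
exactly `t` steps. -/
inductive Exec (B : ℕ) : Prog → State → State → ℕ → Prop
  | skip (s : State) : Exec B .skip s s 1
  /-- `x := c` -/
  | const (s : State) (x c : ℕ) (h : c < B) :
      Exec B (.const x c) s { s with var := Function.update s.var x c } 1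
  /-- `x := y o z` -/
  | op (s : State) (o : Op) (x y z : ℕ) (h : o.eval (s.var y) (s.var z) < B) :
      Exec B (.op o x y z) s
        { s with var := Function.update s.var x (o.eval (s.var y) (s.var z)) } 1
  /-- `x := a[y]` -/
  | load (s : State) (x a y : ℕ) :
      Exec B (.load x a y) s { s with var := Function.update s.var x (s.arr a (s.var y)) } 1
  /-- `a[x] := y` -/
  | store (s : State) (a x y : ℕ) :
      Exec B (.store a x y) s { s with arr := write s.arr a (s.var x) (s.var y) } 1
  /-- `u[x] := v[y]` -/
  | numCopy (s : State) (u x v y : ℕ) :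
      Exec B (.numCopy u x v y) s
        { s with num := write s.num u (s.var x) (s.num v (s.var y)) } 1
  /-- `u[x] := u[x] + v[y]` -/
  | numAdd (s : State) (u x v y : ℕ) :
      Exec B (.numAdd u x v y) s
        { s with num := write s.num u (s.var x) (s.num u (s.var x) + s.num v (s.var y)) } 1
  /-- `u[x] := u[x] - v[y]` -/
  | numSub (s : State) (u x v y : ℕ) :
      Exec B (.numSub u x v y) s
        { s with num := write s.num u (s.var x) (s.num u (s.var x) - s.num v (s.var y)) } 1
  | seq (P Q : Prog) (s₁ s₂ s₃ : State) (t₁ t₂ : ℕ)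
      (h₁ : Exec B P s₁ s₂ t₁) (h₂ : Exec B Q s₂ s₃ t₂) :
      Exec B (.seq P Q) s₁ s₃ (t₁ + t₂)
  | condTrue (b : Test) (P Q : Prog) (s s' : State) (t : ℕ)
      (hb : b.holds s) (h : Exec B P s s' t) : Exec B (.cond b P Q) s s' (t + 1)
  | condFalse (b : Test) (P Q : Prog) (s s' : State) (t : ℕ)
      (hb : ¬ b.holds s) (h : Exec B Q s s' t) : Exec B (.cond b P Q) s s' (t + 1)
  | loopTrue (b : Test) (P : Prog) (s₁ s₂ s₃ : State) (t₁ t₂ : ℕ)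
      (hb : b.holds s₁) (h₁ : Exec B P s₁ s₂ t₁) (h₂ : Exec B (.loop b P) s₂ s₃ t₂) :
      Exec B (.loop b P) s₁ s₃ (t₁ + t₂ + 1)
  | loopFalse (b : Test) (P : Prog) (s : State) (hb : ¬ b.holds s) : Exec B (.loop b P) s s 1

/-- The machine is deterministic. -/
theorem Exec.deterministic {B : ℕ} {P : Prog} {s s₁ : State} {t₁ : ℕ} (h : Exec B P s s₁ t₁) :
    ∀ {s₂ : State} {t₂ : ℕ}, Exec B P s s₂ t₂ → s₁ = s₂ ∧ t₁ = t₂ := by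
  induction h with
  | seq P Q a b c t₁ t₂ _ _ ih₁ ih₂ =>
    intro s₂ t h'
    cases h' with
    | seq _ _ _ _ _ _ _ g₁ g₂ =>
      obtain ⟨rfl, rfl⟩ := ih₁ g₁
      obtain ⟨rfl, rfl⟩ := ih₂ g₂
      exact ⟨rfl, rfl⟩
  | condTrue b P Q s s' t hb _ ih =>
    intro s₂ t h'
    cases h' with
    | condTrue _ _ _ _ _ _ _ g => obtain ⟨rfl, rfl⟩ := ih g; exact ⟨rfl, rfl⟩
    | condFalse _ _ _ _ _ _ hn _ => exact absurd hb hn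
  | condFalse b P Q s s' t hb _ ih =>
    intro s₂ t h'
    cases h' with
    | condFalse _ _ _ _ _ _ _ g => obtain ⟨rfl, rfl⟩ := ih g; exact ⟨rfl, rfl⟩
    | condTrue _ _ _ _ _ _ hn _ => exact absurd hn hb
  | loopTrue b P a b' c t₁ t₂ hb _ _ ih₁ ih₂ =>
    intro s₂ t h'
    cases h' with
    | loopTrue _ _ _ _ _ _ _ _ g₁ g₂ =>
      obtain ⟨rfl, rfl⟩ := ih₁ g₁
      obtain ⟨rfl, rfl⟩ := ih₂ g₂
      exact ⟨rfl, rfl⟩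
    | loopFalse _ _ _ hn => exact absurd hb hn
  | loopFalse b P s hb =>
    intro s₂ t h'
    cases h' with
    | loopTrue _ _ _ _ _ _ _ hn _ _ => exact absurd hn hb
    | loopFalse => exact ⟨rfl, rfl⟩
  | _ => intro s₂ t h'; cases h'; exact ⟨rfl, rfl⟩

/-- The initial state on input `n`, `k`, the processing times and a schedule: variables `0` and `1`
hold `n` and `k`, the first array of words holds the schedule, the first array of real numbers
holds the processing times, and everything else is `0`. -/
noncomputable def input {n : ℕ} (k : ℕ) (p : Fin n → ℝ) (σ : Schedule n) : State where
  var x := if x = 0 then n else if x = 1 then k else 0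
  arr a j := if a = 0 then (if h : j < n then (σ ⟨j, h⟩ : ℕ) else 0) else 0
  num u j := if u = 0 then (if h : j < n then p ⟨j, h⟩ else 0) else 0

/-- The state `s` holds the answer `(b, σ')`: variable `2` holds the truth value `b`, and the first
array of words holds the schedule `σ'`. -/
def Returns {n : ℕ} (s : State) (b : Bool) (σ' : Schedule n) : Prop :=
  s.var 2 = b.toNat ∧ ∀ j : Fin n, s.arr 0 j = σ' j

end KSwap

/-! Swapping $S$ lowers the critical load and raises the other one by the same amount, the surplus
$v(S)$, so the makespan drops exactly when $0 < v(S) < \Delta$ (`makespan_swap_lt_iff`). The surplus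
is additive over disjoint sets. Once a division separates $S$ into two parts of known sizes, finding
$S$ is therefore a two-sum problem: sort the candidates for each part by value and walk through the
two lists with pointers that move in opposite directions (`pairStep_spec`).

A suitable division exists as soon as some hash function is injective on $S$ (`exists_isHit`). One
recoloring changes one position, so the number of zeros among the $k$ images changes by at most one.
After $2\lceil k^2/2\rceil$ recolorings the zeros have become the complement of the first block, up
to one position if $k$ is odd, and a discrete intermediate value argument yields a moment with
exactly $\lceil k/2\rceil$ zeros (`exists_recolor`).

The hash functions are the rows of a table with one column per job, chosen by the method of
conditional expectations. Let $K=q^2$ and $n\le 2^l$. While a column is built, each earlier column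
has weight $2^d$ for $d$ agreements so far, and the next entry is the color of least weight, so the
total grows by a factor of at most $1+1/K$. After $3Kl$ rows it is at most $2^l\cdot 27^l<2^{6l}$,
so two columns agree in fewer than $6l$ rows (`collisions_lt`). If no row were injective on a
$q$-set, its at most $q^2-q$ ordered pairs would account for $2\cdot 3q^2l$ agreements, which is too
many (`exists_injOn_of_collisions`). The greedy table takes time quadratic in $n$, which is too much
for $k=2$; for $q\le 2$ the binary digits of the jobs serve instead.

For the running time, an $m$-tuple of jobs is a number below $n^m$. All these codes are sorted once
per size $q$, and a pass over a division skips those whose digits are not increasing jobs of the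
right color. With $N=n^{\lceil k/2\rceil}$, a pass costs $O(kN)$ and there are $2q^2\cdot 3q^2l$
passes, hence $O(k^6lN)$ for all sizes up to $k$; sorting and the splitters cost less. Every
specification of a program part bounds its steps, and the words stay below $n^{15k}$
(`wordBound_pow`). The parts are put together in `mainProg_spec`. -/

namespace KSwap

/-! ### A program logic for the machine -/

infixr:60 " ;; " => Prog.seq

/-- Set the word variable `x` to `v`. -/
def setVar (s : State) (x v : ℕ) : State := { s with var := Function.update s.var x v }

/-- Set cell `i` of the array of words `a` to `v`. -/
def setArr (s : State) (a i v : ℕ) : State := { s with arr := write s.arr a i v }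

/-- Set cell `i` of the array of real numbers `u` to `v`. -/
noncomputable def setNum (s : State) (u i : ℕ) (v : ℝ) : State :=
  { s with num := write s.num u i v }

theorem write_apply {α : Type} (f : ℕ → ℕ → α) (a i : ℕ) (v : α) (a' j : ℕ) :
    write f a i v a' j = if a' = a ∧ j = i then v else f a' j := by
  unfold write
  by_cases h : a' = a
  · subst h
    by_cases h' : j = i
    · subst h'; simp
    · simp [h']
  · simp [h]

@[simp] theorem setVar_var (s : State) (x v y : ℕ) :
    (setVar s x v).var y = if y = x then v else s.var y := by
  simp [setVar, Function.update_apply]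

@[simp] theorem setVar_arr (s : State) (x v : ℕ) : (setVar s x v).arr = s.arr := rfl

@[simp] theorem setVar_num (s : State) (x v : ℕ) : (setVar s x v).num = s.num := rfl

@[simp] theorem setArr_var (s : State) (a i v : ℕ) : (setArr s a i v).var = s.var := rfl

@[simp] theorem setArr_num (s : State) (a i v : ℕ) : (setArr s a i v).num = s.num := rfl

@[simp] theorem setArr_arr (s : State) (a i v a' j : ℕ) :
    (setArr s a i v).arr a' j = if a' = a ∧ j = i then v else s.arr a' j :=
  write_apply ..

@[simp] theorem setNum_var (s : State) (u i : ℕ) (v : ℝ) : (setNum s u i v).var = s.var := rfl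

@[simp] theorem setNum_arr (s : State) (u i : ℕ) (v : ℝ) : (setNum s u i v).arr = s.arr := rfl

@[simp] theorem setNum_num (s : State) (u i : ℕ) (v : ℝ) (u' j : ℕ) :
    (setNum s u i v).num u' j = if u' = u ∧ j = i then v else s.num u' j :=
  write_apply ..

@[simp] theorem setNum_num_of_ne (s : State) {u u' : ℕ} (i : ℕ) (v : ℝ) (h : u' ≠ u) :
    (setNum s u i v).num u' = s.num u' := by
  simp [setNum, write, h]

/-- `P` started in `s` halts in a state `s'` after `t` steps with `Q s' t`. -/
def wp (B : ℕ) (P : Prog) (s : State) (Q : State → ℕ → Prop) : Prop :=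
  ∃ s' t, Exec B P s s' t ∧ Q s' t

attribute [simp] Op.eval

@[simp] theorem Test.holds_lt (x y : ℕ) (s : State) :
    (Test.lt x y).holds s ↔ s.var x < s.var y := Iff.rfl

@[simp] theorem Test.holds_numLt (u x v y : ℕ) (s : State) :
    (Test.numLt u x v y).holds s ↔ s.num u (s.var x) < s.num v (s.var y) := Iff.rfl

section rules

variable {B : ℕ} {s : State} {Q : State → ℕ → Prop}

-- The rules are equivalences, obtained by inverting `Exec`, so that simplification runs
-- straight-line code symbolically and leaves only the conditions on the sizes of words.
@[simp] theorem wp_skip : wp B .skip s Q ↔ Q s 1 :=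
  ⟨by rintro ⟨_, _, ⟨⟩, h⟩; exact h, fun h => ⟨_, _, .skip s, h⟩⟩

@[simp] theorem wp_const {x c : ℕ} : wp B (.const x c) s Q ↔ c < B ∧ Q (setVar s x c) 1 :=
  ⟨by rintro ⟨_, _, ⟨⟩, h⟩; exact ⟨‹_›, h⟩, fun h => ⟨_, _, .const s x c h.1, h.2⟩⟩

@[simp] theorem wp_op {o : Op} {x y z : ℕ} : wp B (.op o x y z) s Q ↔
    o.eval (s.var y) (s.var z) < B ∧ Q (setVar s x (o.eval (s.var y) (s.var z))) 1 :=
  ⟨by rintro ⟨_, _, ⟨⟩, h⟩; exact ⟨‹_›, h⟩, fun h => ⟨_, _, .op s o x y z h.1, h.2⟩⟩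

@[simp] theorem wp_load {x a y : ℕ} :
    wp B (.load x a y) s Q ↔ Q (setVar s x (s.arr a (s.var y))) 1 :=
  ⟨by rintro ⟨_, _, ⟨⟩, h⟩; exact h, fun h => ⟨_, _, .load s x a y, h⟩⟩

@[simp] theorem wp_store {a x y : ℕ} :
    wp B (.store a x y) s Q ↔ Q (setArr s a (s.var x) (s.var y)) 1 :=
  ⟨by rintro ⟨_, _, ⟨⟩, h⟩; exact h, fun h => ⟨_, _, .store s a x y, h⟩⟩

@[simp] theorem wp_numCopy {u x v y : ℕ} :
    wp B (.numCopy u x v y) s Q ↔ Q (setNum s u (s.var x) (s.num v (s.var y))) 1 :=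
  ⟨by rintro ⟨_, _, ⟨⟩, h⟩; exact h, fun h => ⟨_, _, .numCopy s u x v y, h⟩⟩

@[simp] theorem wp_numAdd {u x v y : ℕ} : wp B (.numAdd u x v y) s Q ↔
    Q (setNum s u (s.var x) (s.num u (s.var x) + s.num v (s.var y))) 1 :=
  ⟨by rintro ⟨_, _, ⟨⟩, h⟩; exact h, fun h => ⟨_, _, .numAdd s u x v y, h⟩⟩

@[simp] theorem wp_numSub {u x v y : ℕ} : wp B (.numSub u x v y) s Q ↔
    Q (setNum s u (s.var x) (s.num u (s.var x) - s.num v (s.var y))) 1 :=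
  ⟨by rintro ⟨_, _, ⟨⟩, h⟩; exact h, fun h => ⟨_, _, .numSub s u x v y, h⟩⟩

@[simp] theorem wp_seq {P R : Prog} : wp B (P ;; R) s Q ↔
    wp B P s fun s₁ t₁ => wp B R s₁ fun s₂ t₂ => Q s₂ (t₁ + t₂) :=
  ⟨by rintro ⟨_, _, ⟨⟩, h⟩; exact ⟨_, _, ‹_›, _, _, ‹_›, h⟩,
    fun ⟨_, _, h₁, _, _, h₂, h⟩ => ⟨_, _, .seq _ _ _ _ _ _ _ h₁ h₂, h⟩⟩

@[simp] theorem wp_cond {b : Test} {P R : Prog} : wp B (.cond b P R) s Q ↔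
    (b.holds s → wp B P s fun s' t => Q s' (t + 1)) ∧
      (¬ b.holds s → wp B R s fun s' t => Q s' (t + 1)) := by
  constructor
  · rintro ⟨s', t, h, hQ⟩
    cases h with
    | condTrue _ _ _ _ _ t hb h => exact ⟨fun _ => ⟨_, _, h, hQ⟩, fun hn => absurd hb hn⟩
    | condFalse _ _ _ _ _ t hb h => exact ⟨fun hn => absurd hn hb, fun _ => ⟨_, _, h, hQ⟩⟩
  · rintro ⟨h₁, h₂⟩
    by_cases hb : b.holds s
    · obtain ⟨s', t, h, hQ⟩ := h₁ hb
      exact ⟨_, _, .condTrue _ _ _ _ _ _ hb h, hQ⟩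
    · obtain ⟨s', t, h, hQ⟩ := h₂ hb
      exact ⟨_, _, .condFalse _ _ _ _ _ _ hb h, hQ⟩

end rules

/-! ### Frames -/

/-- Whether the program may write the word variable `x`. -/
def Prog.wv : Prog → ℕ → Bool
  | .const y _, x => x == y
  | .op _ y _ _, x => x == y
  | .load y _ _, x => x == y
  | .seq P Q, x => P.wv x || Q.wv x
  | .cond _ P Q, x => P.wv x || Q.wv x
  | .loop _ P, x => P.wv x
  | _, _ => false

/-- Whether the program may write the array of words `a`. -/
def Prog.wa : Prog → ℕ → Bool
  | .store b _ _, a => a == b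
  | .seq P Q, a => P.wa a || Q.wa a
  | .cond _ P Q, a => P.wa a || Q.wa a
  | .loop _ P, a => P.wa a
  | _, _ => false

/-- Whether the program may write the array of real numbers `u`. -/
def Prog.wn : Prog → ℕ → Bool
  | .numCopy v _ _ _, u => u == v
  | .numAdd v _ _ _, u => u == v
  | .numSub v _ _ _, u => u == v
  | .seq P Q, u => P.wn u || Q.wn u
  | .cond _ P Q, u => P.wn u || Q.wn u
  | .loop _ P, u => P.wn u
  | _, _ => false

/-- `s` and `s'` agree on everything that `P` cannot write. -/
structure Frame (P : Prog) (s s' : State) : Prop where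
  var (x : ℕ) (h : P.wv x = false := by rfl) : s'.var x = s.var x
  arr (a : ℕ) (h : P.wa a = false := by rfl) : s'.arr a = s.arr a
  num (u : ℕ) (h : P.wn u = false := by rfl) : s'.num u = s.num u

theorem Frame.refl (P : Prog) (s : State) : Frame P s s :=
  ⟨fun _ _ => rfl, fun _ _ => rfl, fun _ _ => rfl⟩

theorem Frame.trans {P : Prog} {s₁ s₂ s₃ : State} (h₁ : Frame P s₁ s₂) (h₂ : Frame P s₂ s₃) :
    Frame P s₁ s₃ :=
  ⟨fun x h => (h₂.var x h).trans (h₁.var x h), fun x h => (h₂.arr x h).trans (h₁.arr x h),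
    fun x h => (h₂.num x h).trans (h₁.num x h)⟩

theorem Frame.mono {P R : Prog} {s s' : State} (F : Frame P s s')
    (hv : ∀ x, R.wv x = false → P.wv x = false) (ha : ∀ x, R.wa x = false → P.wa x = false)
    (hn : ∀ x, R.wn x = false → P.wn x = false) : Frame R s s' :=
  ⟨fun x h => F.var x (hv x h), fun x h => F.arr x (ha x h), fun x h => F.num x (hn x h)⟩

theorem write_of_ne {α : Type} (f : ℕ → ℕ → α) {a a' : ℕ} (i : ℕ) (v : α) (h : a' ≠ a) :
    write f a i v a' = f a' := by
  simp [write, h]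

/-- Induction on the execution: an elementary instruction writes only its target, and a compound
program may write whatever its parts may write. -/
theorem Exec.frame {B : ℕ} {P : Prog} {s s' : State} {t : ℕ} (h : Exec B P s s' t) :
    Frame P s s' := by
  induction h with
  | skip | loopFalse => exact Frame.refl _ _
  | const s x c | op s o x y z | load s x a y =>
    refine ⟨fun y h => ?_, fun _ _ => rfl, fun _ _ => rfl⟩
    have : y ≠ x := by simpa [Prog.wv] using h
    simp [this]
  | store s a x y =>
    refine ⟨fun _ _ => rfl, fun b h => ?_, fun _ _ => rfl⟩
    exact write_of_ne _ _ _ (by simpa [Prog.wa] using h)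
  | numCopy s u x v y | numAdd s u x v y | numSub s u x v y =>
    refine ⟨fun _ _ => rfl, fun _ _ => rfl, fun b h => ?_⟩
    exact write_of_ne _ _ _ (by simpa [Prog.wn] using h)
  | seq P Q _ _ _ _ _ _ _ ih₁ ih₂ =>
    exact (ih₁.mono (by simp +contextual [Prog.wv]) (by simp +contextual [Prog.wa])
      (by simp +contextual [Prog.wn])).trans
      (ih₂.mono (by simp +contextual [Prog.wv]) (by simp +contextual [Prog.wa])
      (by simp +contextual [Prog.wn]))
  | condTrue _ _ _ _ _ _ _ _ ih | condFalse _ _ _ _ _ _ _ _ ih =>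
    exact ih.mono (by simp +contextual [Prog.wv]) (by simp +contextual [Prog.wa])
      (by simp +contextual [Prog.wn])
  | loopTrue _ _ _ _ _ _ _ _ _ _ ih₁ ih₂ =>
    exact Frame.trans (ih₁.mono (fun _ h => h) (fun _ h => h) (fun _ h => h)) ih₂

/-- Adds to a specification the frame that every execution has, so that specifications mention only
what changes. -/
theorem wp.call {B : ℕ} {P : Prog} {s : State} {Q R : State → ℕ → Prop} (h : wp B P s R)
    (hQ : ∀ s' t, Frame P s s' → R s' t → Q s' t) : wp B P s Q := by
  obtain ⟨s', t, he, hR⟩ := h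
  exact ⟨s', t, he, hQ _ _ he.frame hR⟩

/-- The rule for loops: `I` is an invariant and the measure `μ` decreases. -/
theorem wp_loop {B : ℕ} {b : Test} {P : Prog} {s₀ : State} (I : State → Prop) (μ : State → ℕ)
    (T : ℕ) (h₀ : I s₀)
    (hstep : ∀ s, Frame P s₀ s → I s → b.holds s →
      wp B P s fun s' t => t ≤ T ∧ I s' ∧ μ s' < μ s) :
    wp B (.loop b P) s₀ fun s' t => I s' ∧ ¬ b.holds s' ∧ t ≤ (T + 1) * μ s₀ + 1 := by
  -- Induct on an upper bound of the measure. The frame relative to `s₀` is carried along, so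
  -- invariants need not repeat data that the body cannot write.
  suffices H : ∀ m s, Frame P s₀ s → I s → μ s ≤ m →
      wp B (.loop b P) s fun s' t => I s' ∧ ¬ b.holds s' ∧ t ≤ (T + 1) * m + 1 from
    H _ _ (Frame.refl _ _) h₀ le_rfl
  intro m
  induction m with
  | zero =>
    intro s F hI hm
    by_cases hb : b.holds s
    · obtain ⟨s', t, -, -, -, h⟩ := hstep s F hI hb
      omega
    · exact ⟨s, 1, .loopFalse _ _ _ hb, hI, hb, by omega⟩
  | succ m ih =>
    intro s F hI hm
    by_cases hb : b.holds s
    · obtain ⟨s₁, t₁, he, ht, hI₁, hμ⟩ := hstep s F hI hb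
      obtain ⟨s₂, t₂, he₂, hI₂, hb₂, ht₂⟩ := ih s₁ (F.trans he.frame) hI₁ (by omega)
      refine ⟨s₂, _, .loopTrue _ _ _ _ _ _ _ hb he he₂, hI₂, hb₂, ?_⟩
      rw [mul_add]
      omega
    · exact ⟨s, 1, .loopFalse _ _ _ hb, hI, hb, by omega⟩

/-- `x := x + 1` -/
def inc (x : ℕ) : Prog := .const 99 1 ;; .op .add x x 99

/-- `x := y` -/
def mov (x y : ℕ) : Prog := .const 99 0 ;; .op .add x y 99

@[simp] theorem wp_inc {B x : ℕ} {s : State} {Q : State → ℕ → Prop} (hx : x ≠ 99) :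
    wp B (inc x) s Q ↔ s.var x + 1 < B ∧ Q (setVar (setVar s 99 1) x (s.var x + 1)) 2 := by
  simp only [inc, wp_seq, wp_const, wp_op, setVar_var, Op.eval, hx, if_true, if_false]
  exact ⟨fun h => ⟨h.2.1, h.2.2⟩, fun h => ⟨by omega, h⟩⟩

@[simp] theorem wp_mov {B x y : ℕ} {s : State} {Q : State → ℕ → Prop} (hy : y ≠ 99) :
    wp B (mov x y) s Q ↔ s.var y < B ∧ Q (setVar (setVar s 99 0) x (s.var y)) 2 := by
  simp only [mov, wp_seq, wp_const, wp_op, setVar_var, Op.eval, hy, if_true, if_false, add_zero]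
  exact ⟨fun h => ⟨h.2.1, h.2.2⟩, fun h => ⟨by omega, h⟩⟩

/-- If the test holds, `x := 0`. -/
def clearIf (b : Test) (x : ℕ) : Prog := .cond b (.const x 0) .skip

-- The `skip` makes both branches cost two steps, and one assignment, possibly of the old value,
-- describes both.
open Classical in
@[simp] theorem wp_clearIf {B x : ℕ} {b : Test} {s : State} {Q : State → ℕ → Prop} (hB : 0 < B) :
    wp B (clearIf b x) s Q ↔ Q (setVar s x (if b.holds s then 0 else s.var x)) 2 := by
  by_cases h : b.holds s
  · simp [clearIf, wp_cond, h, hB]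
  · have : setVar s x (s.var x) = s := by simp [setVar]
    simp [clearIf, wp_cond, h, this]

attribute [irreducible] wp


/-! ### Codes of tuples of jobs -/

/-- The digit number `t` of `e` in base `n`. -/
def digit (n e t : ℕ) : ℕ := e / n ^ t % n

/-- The sum of the values of the first `m` digits. -/
noncomputable def codeVal (v : ℕ → ℝ) (n m e : ℕ) : ℝ := ∑ t ∈ Finset.range m, v (digit n e t)

/-- Split the number in variable `30` into its last digit (variable `35`) and the rest
(variable `34`). -/
def digitStep : Prog := .op .div 34 30 0 ;; .op .mul 35 34 0 ;; .op .sub 35 30 35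

@[simp] theorem wp_digitStep {B : ℕ} {s : State} {Q : State → ℕ → Prop} :
    wp B digitStep s Q ↔ s.var 30 / s.var 0 < B ∧ s.var 30 / s.var 0 * s.var 0 < B ∧
      s.var 30 % s.var 0 < B ∧
      Q (setVar (setVar (setVar s 34 (s.var 30 / s.var 0)) 35 (s.var 30 / s.var 0 * s.var 0))
        35 (s.var 30 % s.var 0)) 3 := by
  have h : s.var 30 - s.var 30 / s.var 0 * s.var 0 = s.var 30 % s.var 0 := by
    rw [Nat.mod_eq_sub_div_mul]
  simp [digitStep, h]

theorem digitStep_bounds {x n B : ℕ} (hx : x < B) :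
    x / n < B ∧ x / n * n < B ∧ x % n < B :=
  ⟨(Nat.div_le_self _ _).trans_lt hx, (Nat.div_mul_le_self _ _).trans_lt hx,
    (Nat.mod_le _ _).trans_lt hx⟩

/-- Compute in array `u` the values of the codes below variable `33` of tuples whose length is
variable `31`, and make the array `a` the identity. -/
def valuesProg (u a : ℕ) : Prog :=
  .const 36 0 ;; .loop (.lt 36 33) (
    .store a 36 36 ;; .numSub u 36 u 36 ;; mov 30 36 ;; .const 37 0 ;;
    .loop (.lt 37 31) (digitStep ;; .numAdd u 36 1 35 ;; mov 30 34 ;; inc 37) ;;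
    inc 36)

theorem div_pow_succ (e n t : ℕ) : e / n ^ t / n = e / n ^ (t + 1) := by
  rw [Nat.div_div_eq_div_mul, pow_succ]

/-- There are no real constants, and the array may hold values from an earlier size, so each cell is
cleared by subtracting it from itself. The values of single jobs are in array `1`, which must
survive; hence `u ≠ 1`. -/
theorem valuesProg_spec {B u a : ℕ} {s : State} {n m N : ℕ} (hu : u ≠ 1) (hn : s.var 0 = n)
    (hm : s.var 31 = m) (hN : s.var 33 = N) (hNB : N + 1 < B) (hmB : m + 1 < B) :
    wp B (valuesProg u a) s fun s' t => t ≤ (10 * m + 12) * N + 2 ∧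
      (∀ e < N, s'.num u e = codeVal (s.num 1) n m e) ∧ (∀ e < N, s'.arr a e = e) := by
  unfold valuesProg
  simp only [wp_seq, wp_const]
  refine ⟨by omega, wp.call (wp_loop
    (fun s' => s'.var 36 ≤ N ∧ (∀ e < s'.var 36, s'.num u e = codeVal (s.num 1) n m e) ∧
      (∀ e < s'.var 36, s'.arr a e = e)) (fun s' => N - s'.var 36) (10 * m + 11) ?_ ?_) ?_⟩
  · simp
  · rintro s₁ F ⟨hle, h1, h2⟩ hb
    have hn1 : s₁.var 0 = n := by simpa [hn] using F.var 0
    have hm1 : s₁.var 31 = m := by simpa [hm] using F.var 31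
    have hN1 : s₁.var 33 = N := by simpa [hN] using F.var 33
    have hv1 : s₁.num 1 = s.num 1 := by
      simpa using F.num 1 (by simp [Prog.wn, digitStep, mov, inc, hu.symm])
    simp only [Test.holds, hN1] at hb
    simp
    refine ⟨by omega, by omega, wp.call (wp_loop
      (fun s' => s'.var 37 ≤ m ∧ s'.var 30 = s₁.var 36 / n ^ s'.var 37 ∧ s'.var 36 = s₁.var 36 ∧
        s'.num u (s₁.var 36) = codeVal (s.num 1) n (s'.var 37) (s₁.var 36) ∧
        ∀ e < s₁.var 36, s'.num u e = s₁.num u e)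
      (fun s' => m - s'.var 37) 8 ?_ ?_) ?_⟩
    · simp [codeVal]
      intro e he h
      omega
    · rintro s₂ F2 ⟨g1, g2, g3, g4, g5⟩ hb2
      have hn2 : s₂.var 0 = n := by simpa [hn1] using F2.var 0
      have hm2 : s₂.var 31 = m := by simpa [hm1] using F2.var 31
      have hv2 : s₂.num 1 = s.num 1 := by
        simpa [hu.symm, hv1] using F2.num 1 (by simp [Prog.wn, digitStep, mov, inc, hu.symm])
      simp only [Test.holds, hm2] at hb2
      have hx : s₂.var 30 < B := by
        rw [g2]
        exact (Nat.div_le_self _ _).trans_lt (by omega)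
      obtain ⟨b1, b2, b3⟩ := digitStep_bounds (n := n) hx
      simp [hn2, b1, b2, b3, hv2, g3]
      and_intros
      · omega
      · omega
      · rw [g2, div_pow_succ]
      · rw [g4, codeVal, codeVal, Finset.sum_range_succ, digit, g2]
      · intro e he
        rw [if_neg (by omega), g5 e he]
      · omega
    · rintro s₂ t F2 ⟨⟨g1, g2, g3, g4, g5⟩, hb2, ht⟩
      have hm2 : s₂.var 31 = m := by simpa [hm1] using F2.var 31
      have ha2 : s₂.arr a = (setArr s₁ a (s₁.var 36) (s₁.var 36)).arr a := by
        simpa using F2.arr a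
      simp only [Test.holds, hm2] at hb2
      simp [g3, ha2] at ht ⊢
      and_intros
      · omega
      · omega
      · omega
      · intro e he
        rcases Nat.lt_or_eq_of_le he with he | rfl
        · rw [g5 e he, h1 e he]
        · rw [g4, show s₂.var 37 = m by omega]
      · intro e he
        split_ifs with h
        · exact h.symm
        · exact h2 e (by omega)
      · omega
  · rintro s₁ t F ⟨⟨g1, g2, g3⟩, hb, ht⟩
    have hN1 : s₁.var 33 = N := by simpa [hN] using F.var 33
    simp only [Test.holds, hN1] at hb
    obtain rfl : s₁.var 36 = N := by omega
    refine ⟨?_, g2, g3⟩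
    simp at ht
    linarith

/-- Variable `33` becomes the number of codes of tuples of length variable `31`. -/
def powProg : Prog :=
  .const 33 1 ;; .const 37 0 ;; .loop (.lt 37 31) (.op .mul 33 33 0 ;; inc 37)

theorem powProg_spec {B : ℕ} {s : State} {n m : ℕ} (hn : s.var 0 = n) (hm : s.var 31 = m)
    (h0 : 0 < n) (hB : n ^ m < B) (hmB : m + 1 < B) :
    wp B powProg s fun s' t => t ≤ 4 * m + 3 ∧ s'.var 33 = n ^ m := by
  unfold powProg
  simp only [wp_seq, wp_const]
  refine ⟨by omega, by omega, wp.call (wp_loop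
    (fun s' => s'.var 37 ≤ m ∧ s'.var 33 = n ^ s'.var 37) (fun s' => m - s'.var 37) 3 ?_ ?_) ?_⟩
  · simp
  · rintro s₁ F ⟨h1, h2⟩ hb
    have hn1 : s₁.var 0 = n := by simpa [hn] using F.var 0
    have hm1 : s₁.var 31 = m := by simpa [hm] using F.var 31
    simp [hm1] at hb
    simp [h2, hn1, ← pow_succ]
    have := Nat.pow_le_pow_right h0 (show s₁.var 37 + 1 ≤ m by omega)
    and_intros <;> omega
  · rintro s₁ t F ⟨⟨h1, h2⟩, hb, ht⟩
    have hm1 : s₁.var 31 = m := by simpa [hm] using F.var 31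
    simp [hm1] at hb ht
    rw [h2, show s₁.var 37 = m by omega]
    exact ⟨by omega, rfl⟩

/-- The first `m` digits of `e` increase and satisfy `p`. -/
def ValidCode (n m : ℕ) (p : ℕ → Prop) (e : ℕ) : Prop :=
  (∀ t, t + 1 < m → digit n e t < digit n e (t + 1)) ∧ ∀ t < m, p (digit n e t)

/-- Variable `38` becomes `1` if the digits of the code in variable `30` increase and are jobs
whose color is variable `32`, and `0` otherwise. -/
def validProg : Prog :=
  .const 38 1 ;; .const 39 0 ;; .const 37 0 ;; .loop (.lt 37 31) (
    digitStep ;; clearIf (.lt 35 39) 38 ;; mov 39 35 ;; inc 39 ;;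
    .op .add 98 19 35 ;; .load 98 1 98 ;; .load 98 5 98 ;;
    clearIf (.lt 98 32) 38 ;; clearIf (.lt 32 98) 38 ;;
    mov 30 34 ;; inc 37)

/-- Variable `39` keeps the previous digit plus one, and `0` at the start. One strict comparison
then rejects a digit that does not exceed its predecessor, without a special case for the first
digit. -/
theorem validProg_spec {B : ℕ} {s : State} {n m e z row : ℕ} (hn : s.var 0 = n)
    (hm : s.var 31 = m) (he : s.var 30 = e) (hz : s.var 32 = z) (hr : s.var 19 = row)
    (heB : e < B) (hmB : m + 1 < B) (hrB : row + n < B) (h0 : 0 < n) :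
    wp B validProg s fun s' t => t ≤ 21 * m + 4 ∧
      (0 < s'.var 38 ↔ ValidCode n m (fun g => s.arr 5 (s.arr 1 (row + g)) = z) e) := by
  unfold validProg
  simp only [wp_seq, wp_const]
  refine ⟨by omega, by omega, by omega, wp.call (wp_loop
    (fun s' => s'.var 37 ≤ m ∧ s'.var 30 = e / n ^ s'.var 37 ∧
      s'.var 39 = (if s'.var 37 = 0 then 0 else digit n e (s'.var 37 - 1) + 1) ∧
      (0 < s'.var 38 ↔ ValidCode n (s'.var 37) (fun g => s.arr 5 (s.arr 1 (row + g)) = z) e))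
    (fun s' => m - s'.var 37) 20 ?_ ?_) ?_⟩
  · simp [ValidCode, he]
  · rintro s₁ F ⟨h1, h2, h3, h4⟩ hb
    have hn1 : s₁.var 0 = n := by simpa [hn] using F.var 0
    have hm1 : s₁.var 31 = m := by simpa [hm] using F.var 31
    have hz1 : s₁.var 32 = z := by simpa [hz] using F.var 32
    have hr1 : s₁.var 19 = row := by simpa [hr] using F.var 19
    have ha5 : s₁.arr 5 = s.arr 5 := by simpa using F.arr 5
    have ha1 : s₁.arr 1 = s.arr 1 := by simpa using F.arr 1
    simp only [Test.holds, hm1] at hb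
    have hx : s₁.var 30 < B := by
      rw [h2]
      exact (Nat.div_le_self _ _).trans_lt heB
    obtain ⟨b1, b2, b3⟩ := digitStep_bounds (n := n) hx
    have hd : s₁.var 30 % n = digit n e (s₁.var 37) := by rw [h2, digit]
    have hd' : digit n e (s₁.var 37) < n := Nat.mod_lt _ h0
    have hdiv : s₁.var 30 / n = e / n ^ (s₁.var 37 + 1) := by rw [h2, div_pow_succ]
    have hV : ValidCode n (s₁.var 37 + 1) (fun g => s.arr 5 (s.arr 1 (row + g)) = z) e ↔
        ValidCode n (s₁.var 37) (fun g => s.arr 5 (s.arr 1 (row + g)) = z) e ∧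
        ¬ digit n e (s₁.var 37) < s₁.var 39 ∧
        s.arr 5 (s.arr 1 (row + digit n e (s₁.var 37))) = z := by
      rw [h3]
      constructor
      · rintro ⟨a1, a2⟩
        refine ⟨⟨fun t ht => a1 t (by omega), fun t ht => a2 t (by omega)⟩, ?_, a2 _ (by omega)⟩
        split_ifs with h
        · omega
        · have := a1 (s₁.var 37 - 1) (by omega)
          rw [Nat.sub_add_cancel (by omega)] at this
          omega
      · rintro ⟨⟨a1, a2⟩, a3, a4⟩
        refine ⟨fun t ht => ?_, fun t ht => ?_⟩
        · by_cases h : t + 1 < s₁.var 37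
          · exact a1 t h
          · have h' : t + 1 = s₁.var 37 := by omega
            rw [if_neg (by omega), ← h', Nat.add_sub_cancel] at a3
            rw [h'] at a3 ⊢
            omega
        · by_cases h : t < s₁.var 37
          · exact a2 t h
          · rwa [show t = s₁.var 37 by omega]
    simp only [hd, hdiv] at b1 b2 b3
    have hB : 0 < B := by omega
    -- The machine tests equality of colors by two strict comparisons.
    have hc : ∀ x : ℕ, (¬ x < z ∧ ¬ z < x) ↔ x = z := fun x => by omega
    rw [← hc] at hV
    simp [hn1, hd, hdiv, b1, b2, b3, hz1, hr1, ha5, ha1, hB]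
    and_intros
    · omega
    · omega
    · omega
    · omega
    · rw [hV, ← h4]
      split_ifs <;> simp_all
    · omega
  · rintro s₁ t F ⟨⟨h1, h2, h3, h4⟩, hb, ht⟩
    have hm1 : s₁.var 31 = m := by simpa [hm] using F.var 31
    simp [hm1] at hb ht
    rw [h4, show s₁.var 37 = m by omega]
    exact ⟨by omega, Iff.rfl⟩

/-- Change the machine of the jobs that are the first digits (their number is variable `31`) of
the code in variable `30`. -/
def flipProg : Prog :=
  .const 37 0 ;; .loop (.lt 37 31) (
    digitStep ;; .load 36 0 35 ;; .const 99 1 ;; .op .sub 36 99 36 ;; .store 0 35 36 ;;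
    mov 30 34 ;; inc 37)

/-- The digits increase, hence are distinct, and no flip is undone by a later one. -/
theorem flipProg_spec {B : ℕ} {s : State} {n m e : ℕ} (hn : s.var 0 = n)
    (hm : s.var 31 = m) (he : s.var 30 = e) (heB : e < B) (hmB : m + 1 < B)
    (hd : ∀ t, t + 1 < m → digit n e t < digit n e (t + 1)) :
    wp B flipProg s fun s' t => t ≤ 12 * m + 2 ∧
      ∀ g, s'.arr 0 g =
        if g ∈ (Finset.range m).image (digit n e) then 1 - s.arr 0 g else s.arr 0 g := by
  have hd' : ∀ t < m, ∀ t' < t, digit n e t' < digit n e t := by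
    intro t ht
    induction t with
    | zero => simp
    | succ t ih =>
      intro t' ht'
      rcases Nat.lt_succ_iff_lt_or_eq.1 ht' with h | rfl
      · exact (ih (by omega) t' h).trans (hd t ht)
      · exact hd _ ht
  unfold flipProg
  simp only [wp_seq, wp_const]
  refine ⟨by omega, wp.call (wp_loop
    (fun s' => s'.var 37 ≤ m ∧ s'.var 30 = e / n ^ s'.var 37 ∧ ∀ g, s'.arr 0 g =
        if g ∈ (Finset.range (s'.var 37)).image (digit n e) then 1 - s.arr 0 g else s.arr 0 g)
    (fun s' => m - s'.var 37) 11 ?_ ?_) ?_⟩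
  · simp [he]
  · rintro s₁ F ⟨h1, h2, h3⟩ hb
    have hn1 : s₁.var 0 = n := by simpa [hn] using F.var 0
    have hm1 : s₁.var 31 = m := by simpa [hm] using F.var 31
    simp only [Test.holds, hm1] at hb
    have hx : s₁.var 30 < B := by
      rw [h2]
      exact (Nat.div_le_self _ _).trans_lt heB
    obtain ⟨b1, b2, b3⟩ := digitStep_bounds (n := n) hx
    have hdg : s₁.var 30 % n = digit n e (s₁.var 37) := by rw [h2, digit]
    have hdiv : s₁.var 30 / n = e / n ^ (s₁.var 37 + 1) := by rw [h2, div_pow_succ]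
    simp only [hdg, hdiv] at b1 b2 b3
    have hB : 1 < B := by omega
    have hnot : ¬ digit n e (s₁.var 37) ∈ (Finset.range (s₁.var 37)).image (digit n e) := by
      simp only [Finset.mem_image, Finset.mem_range, not_exists, not_and]
      intro t ht
      exact (hd' _ hb t ht).ne
    simp [hn1, hdg, hdiv, b1, b2, b3, hB]
    and_intros
    · omega
    · omega
    · omega
    · intro g
      have hmem : (∃ a ≤ s₁.var 37, digit n e a = g) ↔ g = digit n e (s₁.var 37) ∨
          g ∈ (Finset.range (s₁.var 37)).image (digit n e) := by
        simp only [Finset.mem_image, Finset.mem_range, Nat.le_iff_lt_or_eq, or_and_right,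
          exists_or, exists_eq_left]
        rw [or_comm, eq_comm]
      rw [h3, h3, if_neg hnot]
      simp only [hmem]
      by_cases c : g = digit n e (s₁.var 37)
      · rw [if_pos c, if_pos (Or.inl c), c]
      · simp only [c, if_false, false_or]
    · omega
  · rintro s₁ t F ⟨⟨h1, h2, h3⟩, hb, ht⟩
    have hm1 : s₁.var 31 = m := by simpa [hm] using F.var 31
    simp [hm1] at hb ht
    rw [show s₁.var 37 = m by omega] at h3
    exact ⟨by omega, h3⟩


/-! ### Merge sort -/

/-- Merge the sorted blocks of length variable `40` of the first variable `33` entries of the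
array `a`, compared by their values in the array `u`, into blocks of twice the length in the
array `3`. -/
def mergeProg (u a : ℕ) : Prog :=
  .const 41 0 ;; .const 42 0 ;; .const 43 0 ;; .const 44 0 ;; .const 45 0 ;;
  .loop (.lt 41 33) (
    .cond (.lt 41 42) .skip (
      mov 43 42 ;; .op .add 44 42 40 ;; .op .sub 99 44 33 ;; .op .sub 44 44 99 ;; mov 45 44 ;;
      .op .add 42 42 40 ;; .op .add 42 42 40 ;; .op .sub 99 42 33 ;; .op .sub 42 42 99) ;;
    .load 46 a 43 ;; .load 47 a 45 ;;
    .cond (.lt 43 44)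
      (.cond (.lt 45 42)
        (.cond (.numLt u 47 u 46) (.store 3 41 47 ;; inc 45) (.store 3 41 46 ;; inc 43))
        (.store 3 41 46 ;; inc 43))
      (.store 3 41 47 ;; inc 45) ;;
    inc 41)

/-- Copy the first variable `33` entries of the array `3` to the array `a`. -/
def copyProg (a : ℕ) : Prog :=
  .const 41 0 ;; .loop (.lt 41 33) (.load 46 3 41 ;; .store a 41 46 ;; inc 41)

/-- Sort the first variable `33` entries of the array `a` by their values in the array `u`. -/
def sortProg (u a : ℕ) : Prog :=
  .const 40 1 ;; .loop (.lt 40 33) (mergeProg u a ;; copyProg a ;; .op .add 40 40 40)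

/-- The first `N` entries of `A` are sorted by `V` within the blocks of length `w`. -/
def BlockSorted (V : ℕ → ℝ) (A : ℕ → ℕ) (N w : ℕ) : Prop :=
  ∀ c i j, c * w ≤ i → i < j → j < c * w + w → j < N → V (A i) ≤ V (A j)

/-- Every one of the first `N` values of `A` occurs among the first `M` values of `D`. -/
def Occurs (A D : ℕ → ℕ) (N M : ℕ) : Prop := ∀ i < N, ∃ j < M, D j = A i

theorem Occurs.trans {A D E : ℕ → ℕ} {N M R : ℕ} (h : Occurs A D N M) (h' : Occurs D E M R) :
    Occurs A E N R := by
  intro i hi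
  obtain ⟨j, hj, e⟩ := h i hi
  obtain ⟨l, hl, e'⟩ := h' j hj
  exact ⟨l, hl, e'.trans e⟩

/-- The invariant of merging: `D` holds the merged output before position `pos`; the current
blocks are `[lo, mid)` and `[mid, hi)`, of which the parts before `pa` and `pb` are merged. -/
structure MergeInv (V : ℕ → ℝ) (A D : ℕ → ℕ) (N w c pos lo mid hi pa pb : ℕ) : Prop where
  lo_eq : lo = c * (w + w)
  mid_eq : mid = min (lo + w) N
  hi_eq : hi = min (lo + w + w) N
  lo_le : lo ≤ pa
  pa_le : pa ≤ mid
  mid_le : mid ≤ pb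
  pb_le : pb ≤ hi
  pos_eq : pos + mid = pa + pb
  sorted : BlockSorted V D pos (w + w)
  le_a : ∀ i j, lo ≤ i → i < pos → pa ≤ j → j < mid → V (D i) ≤ V (A j)
  le_b : ∀ i j, lo ≤ i → i < pos → pb ≤ j → j < hi → V (D i) ≤ V (A j)
  occ_lo : Occurs A D lo pos
  occ_a : ∀ i, lo ≤ i → i < pa → ∃ j < pos, D j = A i
  occ_b : ∀ i, mid ≤ i → i < pb → ∃ j < pos, D j = A i
  range : Occurs D A pos N

/-- New pairs arise only in the block that contains `pos`, and two blocks of equal length with a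
common position coincide. -/
theorem BlockSorted.snoc {V : ℕ → ℝ} {D D' : ℕ → ℕ} {c w pos : ℕ} (h : BlockSorted V D pos w)
    (hD : ∀ i < pos, D' i = D i) (h1 : c * w ≤ pos) (h2 : pos < c * w + w)
    (hle : ∀ i, c * w ≤ i → i < pos → V (D i) ≤ V (D' pos)) : BlockSorted V D' (pos + 1) w := by
  intro c' i j a1 a2 a3 a4
  rcases Nat.lt_succ_iff_lt_or_eq.1 a4 with hj | rfl
  · rw [hD i (by omega), hD j hj]
    exact h c' i j a1 a2 a3 hj
  · rw [hD i a2]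
    refine hle i ?_ a2
    have : c' = c := by
      apply le_antisymm
      · by_contra hc
        have := Nat.mul_le_mul_right w (show c + 1 ≤ c' by omega)
        rw [add_mul, one_mul] at this
        omega
      · by_contra hc
        have := Nat.mul_le_mul_right w (show c' + 1 ≤ c by omega)
        rw [add_mul, one_mul] at this
        omega
    rwa [← this]

section step

variable {V : ℕ → ℝ} {A D D' : ℕ → ℕ} {N w c pos lo mid hi pa pb : ℕ}

/-- The two blocks being merged are the blocks `2 * c` and `2 * c + 1` of length `w`. The element
taken is at most everything that remains: in its own block by `hA`, in the other one by `hb`. -/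
theorem MergeInv.takeA (I : MergeInv V A D N w c pos lo mid hi pa pb)
    (hA : BlockSorted V A N w)
    (hD : ∀ i < pos, D' i = D i) (hpos : D' pos = A pa) (ha : pa < mid)
    (hb : ∀ j, pb ≤ j → j < hi → V (A pa) ≤ V (A j)) :
    MergeInv V A D' N w c (pos + 1) lo mid hi (pa + 1) pb := by
  obtain ⟨h1, h2, h3, h4, h5, h6, h7, h8, h9, h10, h11, h12, h13, h14, h15⟩ := I
  have hocc : ∀ i, (∃ j < pos, D j = A i) → ∃ j < pos + 1, D' j = A i := by
    rintro i ⟨j, hj, e⟩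
    exact ⟨j, by omega, by rw [hD j hj, e]⟩
  refine ⟨h1, h2, h3, by omega, by omega, h6, h7, by omega, ?_, ?_, ?_, ?_, ?_, ?_, ?_⟩
  · refine h9.snoc hD (c := c) (by omega) (by omega) fun i a1 a2 => ?_
    rw [hpos]
    exact h10 i pa (by omega) a2 le_rfl ha
  · intro i j a1 a2 a3 a4
    rcases Nat.lt_succ_iff_lt_or_eq.1 a2 with hi | rfl
    · rw [hD i hi]
      exact h10 i j a1 hi (by omega) a4
    · rw [hpos]
      have e : c * (w + w) = (2 * c) * w := by ring
      exact hA (2 * c) pa j (by omega) (by omega) (by omega) (by omega)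
  · intro i j a1 a2 a3 a4
    rcases Nat.lt_succ_iff_lt_or_eq.1 a2 with hi | rfl
    · rw [hD i hi]
      exact h11 i j a1 hi a3 a4
    · rw [hpos]
      exact hb j a3 a4
  · exact fun i a => hocc i (h12 i a)
  · intro i a1 a2
    rcases Nat.lt_succ_iff_lt_or_eq.1 a2 with hi | rfl
    · exact hocc i (h13 i a1 hi)
    · exact ⟨pos, by omega, hpos⟩
  · exact fun i a1 a2 => hocc i (h14 i a1 a2)
  · intro i a
    rcases Nat.lt_succ_iff_lt_or_eq.1 a with hi | rfl
    · rw [hD i hi]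
      exact h15 i hi
    · exact ⟨pa, by omega, hpos.symm⟩

theorem MergeInv.takeB (I : MergeInv V A D N w c pos lo mid hi pa pb)
    (hA : BlockSorted V A N w)
    (hD : ∀ i < pos, D' i = D i) (hpos : D' pos = A pb) (hb : pb < hi)
    (ha : ∀ j, pa ≤ j → j < mid → V (A pb) ≤ V (A j)) :
    MergeInv V A D' N w c (pos + 1) lo mid hi pa (pb + 1) := by
  obtain ⟨h1, h2, h3, h4, h5, h6, h7, h8, h9, h10, h11, h12, h13, h14, h15⟩ := I
  have hocc : ∀ i, (∃ j < pos, D j = A i) → ∃ j < pos + 1, D' j = A i := by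
    rintro i ⟨j, hj, e⟩
    exact ⟨j, by omega, by rw [hD j hj, e]⟩
  refine ⟨h1, h2, h3, h4, h5, by omega, by omega, by omega, ?_, ?_, ?_, ?_, ?_, ?_, ?_⟩
  · refine h9.snoc hD (c := c) (by omega) (by omega) fun i a1 a2 => ?_
    rw [hpos]
    exact h11 i pb (by omega) a2 le_rfl hb
  · intro i j a1 a2 a3 a4
    rcases Nat.lt_succ_iff_lt_or_eq.1 a2 with hi | rfl
    · rw [hD i hi]
      exact h10 i j a1 hi a3 a4
    · rw [hpos]
      exact ha j a3 a4
  · intro i j a1 a2 a3 a4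
    rcases Nat.lt_succ_iff_lt_or_eq.1 a2 with hi | rfl
    · rw [hD i hi]
      exact h11 i j a1 hi (by omega) a4
    · rw [hpos]
      have e : c * (w + w) + w = (2 * c + 1) * w := by ring
      exact hA (2 * c + 1) pb j (by omega) (by omega) (by omega) (by omega)
  · exact fun i a => hocc i (h12 i a)
  · exact fun i a1 a2 => hocc i (h13 i a1 a2)
  · intro i a1 a2
    rcases Nat.lt_succ_iff_lt_or_eq.1 a2 with hi | rfl
    · exact hocc i (h14 i a1 hi)
    · exact ⟨pos, by omega, hpos⟩
  · intro i a
    rcases Nat.lt_succ_iff_lt_or_eq.1 a with hi | rfl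
    · rw [hD i hi]
      exact h15 i hi
    · exact ⟨pb, by omega, hpos.symm⟩

theorem MergeInv.occurs (I : MergeInv V A D N w c pos lo mid hi pa pb) (h : hi ≤ pos) :
    Occurs A D hi pos := by
  intro i a
  have := I.pos_eq
  have := I.pa_le
  have := I.pb_le
  have := I.lo_le
  by_cases h1 : i < lo
  · exact I.occ_lo i h1
  by_cases h2 : i < mid
  · exact I.occ_a i (by omega) (by omega)
  · exact I.occ_b i (by omega) (by omega)

/-- Since `pos < N`, the end `hi` of the finished pair was not clipped at `N`, so the next pair
starts at a multiple of `w + w`. -/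
theorem MergeInv.next (I : MergeInv V A D N w c pos lo mid hi pa pb) (h : hi ≤ pos)
    (hN : pos < N) :
    MergeInv V A D N w (c + 1) pos hi (min (hi + w) N) (min (hi + w + w) N) hi
      (min (hi + w) N) := by
  have hocc := I.occurs h
  obtain ⟨h1, h2, h3, h4, h5, h6, h7, h8, h9, h10, h11, h12, h13, h14, h15⟩ := I
  have hw : pos = hi := by omega
  have e : (c + 1) * (w + w) = c * (w + w) + w + w := by ring
  refine ⟨by omega, rfl, rfl, le_rfl, by omega, le_rfl, by omega, by omega, h9, ?_, ?_, hocc, ?_,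
    ?_, h15⟩ <;> intros <;> omega

theorem MergeInv.init (V : ℕ → ℝ) (A D : ℕ → ℕ) (N w : ℕ) :
    MergeInv V A D N w 0 0 0 (min w N) (min (w + w) N) 0 (min w N) := by
  refine ⟨by simp, by simp, by simp, le_rfl, by omega, le_rfl, by omega, by omega, ?_, ?_, ?_, ?_,
    ?_, ?_, ?_⟩
  · intro c i j _ _ _ h
    omega
  · intros; omega
  · intros; omega
  · intro i h
    omega
  · intros; omega
  · intros; omega
  · intro i h
    omega

end step

/-- Truncated subtraction clips the ends of blocks at the end of the array. -/
theorem min_eq_sub (x y : ℕ) : x - (x - y) = min x y := by omega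

/-- Each round writes one output cell, which makes the time linear; the next pair of blocks is
opened inside the round that finds the current pair exhausted. The alternative with both variables
`0` in the invariant means that no pair is open yet. -/
theorem mergeProg_spec {B u a : ℕ} {s : State} {N w : ℕ} (ha : a ≠ 3) (hN : s.var 33 = N)
    (hw : s.var 40 = w) (hw0 : 0 < w) (hB : N + w + w + 1 < B)
    (hs : BlockSorted (s.num u) (s.arr a) N w) :
    wp B (mergeProg u a) s fun s' t => t ≤ 30 * N + 6 ∧
      BlockSorted (s.num u) (s'.arr 3) N (w + w) ∧ Occurs (s.arr a) (s'.arr 3) N N ∧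
      Occurs (s'.arr 3) (s.arr a) N N := by
  unfold mergeProg
  simp only [wp_seq, wp_const]
  refine ⟨by omega, by omega, by omega, by omega, by omega, wp.call (wp_loop
    (fun s' => s'.var 41 ≤ N ∧ ((s'.var 41 = 0 ∧ s'.var 42 = 0) ∨
      ∃ c lo, MergeInv (s.num u) (s.arr a) (s'.arr 3) N w c (s'.var 41) lo (s'.var 44)
        (s'.var 42) (s'.var 43) (s'.var 45)))
    (fun s' => N - s'.var 41) 29 ?_ ?_) ?_⟩
  · simp
  · rintro s₁ F ⟨h1, h2⟩ hb
    have hN1 : s₁.var 33 = N := by simpa [hN] using F.var 33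
    have hw1 : s₁.var 40 = w := by simpa [hw] using F.var 40
    have ha1 : s₁.arr a = s.arr a := by
      simpa using F.arr a (by simp [Prog.wa, inc, mov, ha])
    have hu1 : s₁.num u = s.num u := by simpa using F.num u
    simp only [Test.holds, hN1] at hb
    rw [wp_seq]
    refine wp.call (R := fun s' t => t ≤ 15 ∧ (∃ c lo,
      MergeInv (s.num u) (s.arr a) (s₁.arr 3) N w c (s₁.var 41) lo (s'.var 44)
        (s'.var 42) (s'.var 43) (s'.var 45)) ∧ s₁.var 41 < s'.var 42) ?_ ?_
    · rw [wp_cond]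
      constructor
      · intro hlt
        rcases h2 with h2 | h2
        · simp at hlt
          omega
        · obtain ⟨c, lo, h2⟩ := h2
          simp at hlt ⊢
          exact ⟨⟨c, lo, h2⟩, hlt⟩
      · intro hlt
        simp at hlt
        have h3 : ∃ c, MergeInv (s.num u) (s.arr a) (s₁.arr 3) N w c (s₁.var 41) (s₁.var 42)
            (min (s₁.var 42 + w) N) (min (s₁.var 42 + w + w) N) (s₁.var 42)
            (min (s₁.var 42 + w) N) := by
          rcases h2 with ⟨h2, h2'⟩ | ⟨c, lo, h2⟩
          · rw [h2, h2']
            exact ⟨0, by simpa using MergeInv.init (s.num u) (s.arr a) (s₁.arr 3) N w⟩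
          · exact ⟨c + 1, h2.next hlt hb⟩
        obtain ⟨c, h3⟩ := h3
        have h4 := h3.pos_eq
        simp [hN1, hw1, min_eq_sub]
        and_intros
        · omega
        · omega
        · omega
        · omega
        · omega
        · omega
        · omega
        · omega
        · exact ⟨c, _, h3⟩
        · omega
        · omega
    · rintro s₂ t F2 ⟨ht, ⟨c, lo, h2⟩, hlt⟩
      have hN2 : s₂.var 33 = N := by simpa [hN1] using F2.var 33
      have hp2 : s₂.var 41 = s₁.var 41 := by simpa using F2.var 41
      have ha2 : s₂.arr a = s.arr a := by
        simpa [ha1] using F2.arr a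
      have hd2 : s₂.arr 3 = s₁.arr 3 := by simpa using F2.arr 3
      have hu2 : s₂.num u = s.num u := by simpa [hu1] using F2.num u
      have b1 := h2.pa_le
      have b2 := h2.pb_le
      have b3 := h2.mid_eq
      have b4 := h2.hi_eq
      have b5 := h2.pos_eq
      have b6 := h2.mid_le
      have hnew : ∀ x, ∀ i < s₁.var 41, (setArr s₂ 3 (s₁.var 41) x).arr 3 i = s₁.arr 3 i := by
        intro x i hi
        rw [setArr_arr, if_neg (by omega), hd2]
      -- Comparing with the head of the other block suffices, because that block is sorted.
      have hA : s₂.var 43 < s₂.var 44 →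
          (s₂.var 45 < s₂.var 42 →
            ¬ s.num u (s.arr a (s₂.var 45)) < s.num u (s.arr a (s₂.var 43))) →
          MergeInv (s.num u) (s.arr a)
            ((setArr s₂ 3 (s₁.var 41) (s.arr a (s₂.var 43))).arr 3) N w c (s₁.var 41 + 1) lo
            (s₂.var 44) (s₂.var 42) (s₂.var 43 + 1) (s₂.var 45) := by
        intro hlt' hle
        refine h2.takeA hs (hnew _) (by simp) hlt' fun j j1 j2 => ?_
        refine (not_lt.1 (hle (by omega))).trans ?_
        rcases Nat.lt_or_eq_of_le j1 with j1 | rfl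
        · have e : c * (w + w) + w = (2 * c + 1) * w := by ring
          have := h2.lo_eq
          exact hs (2 * c + 1) _ j (by omega) j1 (by omega) (by omega)
        · rfl
      have hB' : s₂.var 45 < s₂.var 42 →
          (s₂.var 43 < s₂.var 44 →
            s.num u (s.arr a (s₂.var 45)) < s.num u (s.arr a (s₂.var 43))) →
          MergeInv (s.num u) (s.arr a)
            ((setArr s₂ 3 (s₁.var 41) (s.arr a (s₂.var 45))).arr 3) N w c (s₁.var 41 + 1) lo
            (s₂.var 44) (s₂.var 42) (s₂.var 43) (s₂.var 45 + 1) := by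
        intro hlt' hle
        refine h2.takeB hs (hnew _) (by simp) hlt' fun j j1 j2 => ?_
        refine (hle (by omega)).le.trans ?_
        rcases Nat.lt_or_eq_of_le j1 with j1 | rfl
        · have e : c * (w + w) = (2 * c) * w := by ring
          have := h2.lo_eq
          have := h2.lo_le
          exact hs (2 * c) _ j (by omega) j1 (by omega) (by omega)
        · rfl
      rw [wp_seq, wp_load, wp_seq, wp_load, wp_seq]
      refine wp.call (R := fun s' t => t ≤ 6 ∧ s'.var 41 = s₁.var 41 ∧
        ∃ c lo, MergeInv (s.num u) (s.arr a) (s'.arr 3) N w c (s₁.var 41 + 1) lo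
          (s'.var 44) (s'.var 42) (s'.var 43) (s'.var 45)) ?_ ?_
      · have hadd : s₂.var 43 + 1 < B ∧ s₂.var 45 + 1 < B := by omega
        simp [ha2, hu2, hp2, hadd]
        refine ⟨fun c1 => ⟨fun c2 => ⟨fun c3 => ?_, fun c3 => ?_⟩, fun c2 => ?_⟩, fun c1 => ?_⟩
        · exact ⟨c, lo, hB' c2 fun _ => c3⟩
        · exact ⟨c, lo, hA c1 fun _ => not_lt.2 c3⟩
        · exact ⟨c, lo, hA c1 fun h => by omega⟩
        · exact ⟨c, lo, hB' (by omega) fun h => by omega⟩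
      · rintro s₃ t₃ F3 ⟨g1, g2, g3⟩
        simp [g2]
        and_intros
        · omega
        · omega
        · omega
        · exact g3
        · omega
  · rintro s₁ t F ⟨⟨h1, h2⟩, hb, ht⟩
    have hN1 : s₁.var 33 = N := by simpa [hN] using F.var 33
    simp [hN1] at hb ht
    obtain h : s₁.var 41 = N := by omega
    refine ⟨by omega, ?_⟩
    rw [h] at h2
    rcases h2 with ⟨rfl, h2⟩ | ⟨c, lo, h2⟩
    · refine ⟨?_, ?_, ?_⟩
      · intro c i j _ _ _ h
        omega
      · intro i h
        omega
      · intro i h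
        omega
    · have b1 := h2.pa_le
      have b2 := h2.pb_le
      have b3 := h2.mid_eq
      have b4 := h2.hi_eq
      have b5 := h2.pos_eq
      have b6 : s₁.var 42 = N := by omega
      have := h2.occurs b6.le
      rw [b6] at this
      exact ⟨h2.sorted, this, h2.range⟩

theorem copyProg_spec {B a : ℕ} {s : State} {N : ℕ} (ha : a ≠ 3) (hN : s.var 33 = N)
    (hB : N + 1 < B) :
    wp B (copyProg a) s fun s' t => t ≤ 5 * N + 2 ∧ ∀ i < N, s'.arr a i = s.arr 3 i := by
  unfold copyProg
  simp only [wp_seq, wp_const]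
  refine ⟨by omega, wp.call (wp_loop
    (fun s' => s'.var 41 ≤ N ∧ ∀ i < s'.var 41, s'.arr a i = s.arr 3 i)
    (fun s' => N - s'.var 41) 4 ?_ ?_) ?_⟩
  · simp
  · rintro s₁ F ⟨h1, h2⟩ hb
    have hN1 : s₁.var 33 = N := by simpa [hN] using F.var 33
    have ha1 : s₁.arr 3 = s.arr 3 := by
      simpa using F.arr 3 (by simp [Prog.wa, inc, ha.symm])
    simp [hN1] at hb
    simp [ha1]
    and_intros
    · omega
    · omega
    · intro i hi
      split_ifs with h
      · rw [h]
      · exact h2 i (by omega)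
    · omega
  · rintro s₁ t F ⟨⟨h1, h2⟩, hb, ht⟩
    have hN1 : s₁.var 33 = N := by simpa [hN] using F.var 33
    simp [hN1] at hb ht
    exact ⟨by omega, fun i hi => h2 i (by omega)⟩

theorem BlockSorted.congr {V V' : ℕ → ℝ} {A A' : ℕ → ℕ} {N w : ℕ} (h : BlockSorted V A N w)
    (hA : ∀ i < N, V (A i) = V' (A' i)) : BlockSorted V' A' N w := by
  intro c i j h1 h2 h3 h4
  rw [← hA i (by omega), ← hA j h4]
  exact h c i j h1 h2 h3 h4

/-- The width doubles until one block covers the array. `Occurs` in both directions replaces a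
permutation: for a list of all codes it is enough that none is lost and nothing else appears. -/
theorem sortProg_spec {B u a : ℕ} {s : State} {N l : ℕ} (ha : a ≠ 3) (hN : s.var 33 = N)
    (hN0 : 0 < N) (hl : N ≤ 2 ^ l) (hB : 4 * N + 2 < B) :
    wp B (sortProg u a) s fun s' t => t ≤ (36 * N + 10) * l + 2 ∧
      (∀ i j, i < j → j < N → s.num u (s'.arr a i) ≤ s.num u (s'.arr a j)) ∧
      Occurs (s.arr a) (s'.arr a) N N ∧ Occurs (s'.arr a) (s.arr a) N N := by
  unfold sortProg
  simp only [wp_seq, wp_const]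
  refine ⟨by omega, wp.call (wp_loop
    (fun s' => 0 < s'.var 40 ∧ s'.var 40 < 2 * N ∧
      BlockSorted (s.num u) (s'.arr a) N (s'.var 40) ∧
      Occurs (s.arr a) (s'.arr a) N N ∧ Occurs (s'.arr a) (s.arr a) N N ∧
      ∃ r ≤ l, s'.var 40 = 2 ^ r)
    -- The width is a power of two, and its logarithm counts the rounds.
    (fun s' => l - Nat.log 2 (s'.var 40)) (36 * N + 9) ?_ ?_) ?_⟩
  · refine ⟨by simp, by simp; omega, ?_, fun i hi => ⟨i, hi, rfl⟩, fun i hi => ⟨i, hi, rfl⟩, 0,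
      by omega, by simp⟩
    intro c i j h1 h2 h3
    simp at h1 h3
    omega
  · rintro s₁ F ⟨h0, h1, h2, h3, h4, r, hr, h5⟩ hb
    have hN1 : s₁.var 33 = N := by simpa [hN] using F.var 33
    have hu1 : s₁.num u = s.num u := by simpa using F.num u
    simp only [Test.holds, hN1] at hb
    rw [← hu1] at h2
    rw [wp_seq]
    refine wp.call (mergeProg_spec ha hN1 rfl h0 (by omega) h2) ?_
    rintro s₂ t₂ F2 ⟨g1, g2, g3, g4⟩
    rw [wp_seq]
    have hN2 : s₂.var 33 = N := by simpa [hN1] using F2.var 33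
    have hw2 : s₂.var 40 = s₁.var 40 := by simpa using F2.var 40
    have ha2 : s₂.arr a = s₁.arr a := F2.arr a (by simp [Prog.wa, mergeProg, mov, inc, ha])
    have hu2 : s₂.num u = s₁.num u := F2.num u
    refine wp.call (copyProg_spec ha hN2 (by omega)) ?_
    rintro s₃ t₃ F3 ⟨k1, k2⟩
    have hw3 : s₃.var 40 = s₁.var 40 := by simpa [hw2] using F3.var 40
    have o1 : Occurs (s₂.arr 3) (s₃.arr a) N N := fun i hi => ⟨i, hi, k2 i hi⟩
    have o2 : Occurs (s₃.arr a) (s₂.arr 3) N N := fun i hi => ⟨i, hi, (k2 i hi).symm⟩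
    simp [hw3]
    and_intros
    · omega
    · omega
    · omega
    · omega
    · rw [← hu1]
      exact g2.congr fun i hi => by rw [k2 i hi]
    · exact h3.trans (g3.trans o1)
    · exact o2.trans (g4.trans h4)
    · refine ⟨r + 1, ?_, by rw [h5, pow_succ]; ring⟩
      have : 2 ^ r < 2 ^ l := by omega
      have := (Nat.pow_lt_pow_iff_right (by norm_num : 1 < 2)).1 this
      omega
    · have e : s₁.var 40 + s₁.var 40 = 2 ^ (r + 1) := by rw [h5, pow_succ]; ring
      rw [e, h5, Nat.log_pow (by norm_num), Nat.log_pow (by norm_num)]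
      have : 2 ^ r < 2 ^ l := by omega
      have := (Nat.pow_lt_pow_iff_right (by norm_num : 1 < 2)).1 this
      omega
  · rintro s₁ t F ⟨⟨h0, h1, h2, h3, h4, h5⟩, hb, ht⟩
    have hN1 : s₁.var 33 = N := by simpa [hN] using F.var 33
    simp [hN1] at hb ht
    exact ⟨by linarith, fun i j hij hj => h2 0 i j (by omega) hij (by omega) hj, h3, h4⟩


/-! ### The makespan of a swapped schedule -/

variable {n : ℕ}

/-- The contribution of a job to the surplus. -/
noncomputable def signed (p : Fin n → ℝ) (σ : Schedule n) (j : Fin n) : ℝ :=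
  if σ j = critical p σ then p j else - p j

theorem surplus_eq_sum (p : Fin n → ℝ) (σ : Schedule n) (S : Finset (Fin n)) :
    surplus p σ S = ∑ j ∈ S, signed p σ j := by
  unfold surplus signed
  rw [Finset.sum_ite, Finset.sum_neg_distrib, sub_eq_add_neg]

theorem sum_eq_sum_univ_ite (S : Finset (Fin n)) (f : Fin n → ℝ) :
    ∑ j ∈ S, f j = ∑ j, if j ∈ S then f j else 0 := by
  rw [Finset.sum_ite_mem, Finset.univ_inter]

theorem one_sub_eq_iff (a c : Fin 2) : 1 - a = c ↔ a ≠ c := by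
  revert a c
  decide

theorem load_swap_critical (p : Fin n → ℝ) (σ : Schedule n) (S : Finset (Fin n)) :
    load p (swap σ S) (critical p σ) = load p σ (critical p σ) - surplus p σ S := by
  rw [surplus_eq_sum, sum_eq_sum_univ_ite S, load, load, Finset.sum_filter,
    Finset.sum_filter, ← Finset.sum_sub_distrib]
  refine Finset.sum_congr rfl fun j _ => ?_
  unfold swap signed
  by_cases h1 : j ∈ S <;> by_cases h2 : σ j = critical p σ <;> simp [h1, h2, one_sub_eq_iff]

theorem load_swap_other (p : Fin n → ℝ) (σ : Schedule n) (S : Finset (Fin n)) :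
    load p (swap σ S) (1 - critical p σ) = load p σ (1 - critical p σ) + surplus p σ S := by
  have hc : ∀ a c : Fin 2, a = 1 - c ↔ a ≠ c := by decide
  rw [surplus_eq_sum, sum_eq_sum_univ_ite S, load, load, Finset.sum_filter,
    Finset.sum_filter, ← Finset.sum_add_distrib]
  refine Finset.sum_congr rfl fun j _ => ?_
  unfold swap signed
  by_cases h1 : j ∈ S <;> by_cases h2 : σ j = critical p σ <;>
    simp [h1, h2, hc, one_sub_eq_iff]

theorem makespan_eq (p : Fin n → ℝ) (σ : Schedule n) (i : Fin 2) :
    makespan p σ = max (load p σ i) (load p σ (1 - i)) := by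
  fin_cases i <;> simp [makespan, max_comm]

theorem makespan_eq_critical (p : Fin n → ℝ) (σ : Schedule n) :
    makespan p σ = load p σ (critical p σ) := by
  unfold makespan critical
  split_ifs with h
  · exact max_eq_left h
  · exact max_eq_right (not_le.1 h).le

theorem gap_eq (p : Fin n → ℝ) (σ : Schedule n) :
    gap p σ = load p σ (critical p σ) - load p σ (1 - critical p σ) := by
  rw [gap, makespan_eq_critical]
  unfold critical
  split_ifs with h
  · simp [h]
  · simp [(not_le.1 h).le]

/-- With `v` the surplus, the two loads become `L_max - v` and `L_min + v`. The first is below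
`L_max` iff `0 < v`, the second iff `v < Δ`. -/
theorem makespan_swap_lt_iff (p : Fin n → ℝ) (σ : Schedule n) (S : Finset (Fin n)) :
    makespan p (swap σ S) < makespan p σ ↔ 0 < surplus p σ S ∧ surplus p σ S < gap p σ := by
  rw [makespan_eq p (swap σ S) (critical p σ), load_swap_critical, load_swap_other,
    makespan_eq_critical, gap_eq, max_lt_iff]
  constructor <;> rintro ⟨h1, h2⟩ <;> constructor <;> linarith

theorem surplus_union (p : Fin n → ℝ) (σ : Schedule n) {S T : Finset (Fin n)}
    (h : Disjoint S T) : surplus p σ (S ∪ T) = surplus p σ S + surplus p σ T := by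
  simp only [surplus_eq_sum, Finset.sum_union h]

/-! ### Recolorings -/

/-- After `2j` recolorings the zeros form the cyclic interval of length `⌈K/2⌉` starting at
`j`. -/
theorem recolor_two_mul {K j x : ℕ} (hK : 2 ≤ K) (hx : x < K) (hj : j ≤ (K + 1) / 2) :
    recolor K (2 * j) x = 0 ↔
      (j ≤ x ∧ x < j + (K + 1) / 2) ∨ x + K < j + (K + 1) / 2 := by
  induction j with
  | zero =>
    simp only [recolor, zero_le, zero_add, true_and]
    split_ifs with h
    · simp [h]
    · simp [h]
      omega
  | succ j ih =>
    have ih := ih (by omega)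
    rw [show 2 * (j + 1) = 2 * j + 1 + 1 by ring, recolor, recolor]
    have e1 : (2 * j + 1) % 2 = 1 := by omega
    have e2 : (2 * j + 1) / 2 = j := by omega
    have e3 : 2 * j % 2 = 0 := by omega
    have e4 : 2 * j / 2 = j := by omega
    rw [e1, e2, e3, e4]
    have hjK : j % K = j := Nat.mod_eq_of_lt (by omega)
    rw [hjK]
    -- The block wraps around at most once, because `j` stays below `⌈K/2⌉`.
    have hm : ((K + 1) / 2 + j) % K = if (K + 1) / 2 + j < K then (K + 1) / 2 + j
        else (K + 1) / 2 + j - K := by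
      split_ifs with h
      · exact Nat.mod_eq_of_lt h
      · rw [Nat.mod_eq_sub_mod (by omega), Nat.mod_eq_of_lt (by omega)]
    rw [hm]
    simp only [one_ne_zero, if_false, if_true]
    by_cases h1 : x = j
    · rw [if_pos h1]
      simp only [one_ne_zero, false_iff]
      omega
    · rw [if_neg h1]
      by_cases h2 : (K + 1) / 2 + j < K
      · rw [if_pos h2]
        by_cases h3 : x = (K + 1) / 2 + j
        · simp [h3]
          omega
        · rw [if_neg h3, ih]
          omega
      · rw [if_neg h2]
        by_cases h3 : x = (K + 1) / 2 + j - K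
        · simp only [h3, if_true, true_iff]
          omega
        · rw [if_neg h3, ih]
          omega

theorem recolor_succ_eq {K i x : ℕ} (h : recolor K (i + 1) x ≠ recolor K i x) :
    x = if i % 2 = 0 then ((K + 1) / 2 + i / 2) % K else (i / 2) % K := by
  by_contra hx
  apply h
  rw [recolor]
  split_ifs with h1 h2 h3 <;> simp_all

/-- A discrete intermediate value theorem: if `f (N + 1) ≠ v`, then a step of size at most one
cannot have jumped over `v`, so `v` already lies between `f 0` and `f N`. -/
theorem exists_crossing (f : ℕ → ℕ) (hf : ∀ i, f (i + 1) ≤ f i + 1 ∧ f i ≤ f (i + 1) + 1) (N v : ℕ)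
    (h : (f 0 ≤ v ∧ v ≤ f N) ∨ (f N ≤ v ∧ v ≤ f 0)) : ∃ i ≤ N, f i = v := by
  induction N with
  | zero => exact ⟨0, le_rfl, by omega⟩
  | succ N ih =>
    by_cases hv : f (N + 1) = v
    · exact ⟨_, le_rfl, hv⟩
    · have := hf N
      obtain ⟨i, hi, e⟩ := ih (by omega)
      exact ⟨i, by omega, e⟩

/-- If `k` numbers below `k²` are given, then some recoloring makes `⌈k/2⌉` of them `0`. -/
theorem exists_recolor {k : ℕ} (hk : 0 < k) (X : Finset ℕ) (hX : ∀ x ∈ X, x < k ^ 2)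
    (hcard : X.card = k) :
    ∃ i < 2 * k ^ 2, (X.filter fun x => recolor (k ^ 2) i x = 0).card = (k + 1) / 2 := by
  set K := k ^ 2 with hK
  have hK0 : 0 < K := by positivity
  -- With a single color `recolor_two_mul` does not apply, but the initial coloring already gives it
  -- the value `0`.
  by_cases hk1 : k = 1
  · subst hk1
    have hK1 : K = 1 := by simp [hK]
    rw [hK1] at hX
    refine ⟨0, by omega, ?_⟩
    have : ∀ x ∈ X, recolor K 0 x = 0 := fun x hx => by
      have := hX x hx
      simp [recolor, hK1]
      omega
    rw [Finset.filter_true_of_mem this, hcard]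
  have hK2 : 2 ≤ K := by
    have := Nat.mul_le_mul (show 2 ≤ k by omega) (show 2 ≤ k by omega)
    rw [hK, sq]
    omega
  set f : ℕ → ℕ := fun i => (X.filter fun x => recolor K i x = 0).card with hf
  have hstep : ∀ i, f (i + 1) ≤ f i + 1 ∧ f i ≤ f (i + 1) + 1 := by
    intro i
    set y := if i % 2 = 0 then ((K + 1) / 2 + i / 2) % K else (i / 2) % K
    have h : ∀ x, x ≠ y → recolor K (i + 1) x = recolor K i x := fun x hx => by
      by_contra hne
      exact hx (recolor_succ_eq hne)
    constructor
    · refine (Finset.card_le_card (t := insert y (X.filter fun x => recolor K i x = 0)) ?_).trans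
        (Finset.card_insert_le _ _)
      intro x hx
      rw [Finset.mem_filter] at hx
      rw [Finset.mem_insert, Finset.mem_filter]
      by_cases hxy : x = y
      · exact Or.inl hxy
      · exact Or.inr ⟨hx.1, (h x hxy) ▸ hx.2⟩
    · refine (Finset.card_le_card
        (t := insert y (X.filter fun x => recolor K (i + 1) x = 0)) ?_).trans
        (Finset.card_insert_le _ _)
      intro x hx
      rw [Finset.mem_filter] at hx
      rw [Finset.mem_insert, Finset.mem_filter]
      by_cases hxy : x = y
      · exact Or.inl hxy
      · exact Or.inr ⟨hx.1, (h x hxy).symm ▸ hx.2⟩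
  -- The last block of zeros starts where the first one ended. Together they cover every position
  -- once, except that for odd `K` position `0` is covered twice.
  have hsum : f 0 + f (2 * ((K + 1) / 2)) =
      k + (X.filter fun x => x + K < K + 1 ∧ K % 2 = 1).card := by
    rw [← hcard, hf]
    simp only [Finset.card_filter]
    rw [Finset.card_eq_sum_ones X, ← Finset.sum_add_distrib, ← Finset.sum_add_distrib]
    refine Finset.sum_congr rfl fun x hx => ?_
    have h0 := recolor_two_mul (j := 0) hK2 (hX x hx) (by omega)
    have h1 := recolor_two_mul (j := (K + 1) / 2) hK2 (hX x hx) le_rfl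
    have hxK := hX x hx
    rw [mul_zero] at h0
    simp only [h0, h1]
    split_ifs <;> omega
  have hle : (X.filter fun x => x + K < K + 1 ∧ K % 2 = 1).card ≤ K % 2 := by
    rcases Nat.mod_two_eq_zero_or_one K with h | h
    · simp [h]
    · rw [h]
      refine Finset.card_le_one.2 fun x hx y hy => ?_
      simp at hx hy
      omega
  -- An extra `1` in `hsum` thus needs odd `k`, and in every case `⌈k/2⌉` lies between the two
  -- counts.
  have hpar : K % 2 = k % 2 := by
    rw [hK, Nat.pow_mod]
    rcases Nat.mod_two_eq_zero_or_one k with h | h <;> simp [h]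
  obtain ⟨i, hi, e⟩ := exists_crossing f hstep (2 * ((K + 1) / 2)) ((k + 1) / 2) (by omega)
  exact ⟨i, by omega, e⟩


/-! ### Splitters -/

/-- The first `c < K` at which `f` is least. -/
def argmin (f : ℕ → ℕ) : ℕ → ℕ
  | 0 => 0
  | c + 1 => if f c < f (argmin f c) then c else argmin f c

theorem argmin_lt (f : ℕ → ℕ) {K : ℕ} (hK : 0 < K) : argmin f K < K := by
  induction K with
  | zero => omega
  | succ K ih =>
    rw [argmin]
    split_ifs with h
    · omega
    · rcases Nat.eq_zero_or_pos K with rfl | h0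
      · simp [argmin]
      · have := ih h0
        omega

theorem argmin_le (f : ℕ → ℕ) {K c : ℕ} (hc : c < K) : f (argmin f K) ≤ f c := by
  induction K with
  | zero => omega
  | succ K ih =>
    rw [argmin]
    rcases Nat.lt_succ_iff_lt_or_eq.1 hc with h | rfl
    · have := ih h
      split_ifs with h'
      · omega
      · exact this
    · split_ifs with h'
      · exact le_rfl
      · omega

/-- The weight of the numbers below `x` that have color `c`. -/
def colorSum (col w : ℕ → ℕ) (x c : ℕ) : ℕ :=
  ∑ y ∈ Finset.range x, if col y = c then w y else 0

/-- While the column `x` of a table is chosen greedily, a number `y < x` has the weight `2 ^ d`,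
where `d` is the number of rows so far in which `x` and `y` have the same color. -/
def greedyWeight (K : ℕ) (tab : ℕ → ℕ → ℕ) (x : ℕ) : ℕ → ℕ → ℕ
  | 0, _ => 1
  | r + 1, y =>
    if tab r y = argmin (colorSum (tab r) (greedyWeight K tab x r) x) K then
      greedyWeight K tab x r y + greedyWeight K tab x r y
    else greedyWeight K tab x r y

/-- The entry of the column `x` in the row `r`: the color of least weight. -/
def greedyColor (K : ℕ) (tab : ℕ → ℕ → ℕ) (x r : ℕ) : ℕ :=
  argmin (colorSum (tab r) (greedyWeight K tab x r) x) K

/-- The table of the first `x` greedily chosen columns. -/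
def greedyTab (K : ℕ) : ℕ → ℕ → ℕ → ℕ
  | 0, _, _ => 0
  | x + 1, r, y => if y = x then greedyColor K (greedyTab K x) x r else greedyTab K x r y

theorem greedyTab_of_lt {K x n r y : ℕ} (hy : y < x) (hx : x ≤ n) :
    greedyTab K n r y = greedyTab K x r y := by
  induction n with
  | zero =>
    obtain rfl : x = 0 := by omega
    rfl
  | succ n ih =>
    rcases Nat.le_succ_iff.1 hx with h | h
    · rw [greedyTab, if_neg (by omega), ih h]
    · rw [h]

theorem greedyTab_self {K x n r : ℕ} (hx : x < n) :
    greedyTab K n r x = greedyColor K (greedyTab K x) x r := by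
  rw [greedyTab_of_lt (Nat.lt_succ_self x) hx, greedyTab, if_pos rfl]

theorem greedyTab_lt {K n r y : ℕ} (hK : 0 < K) : greedyTab K n r y < K := by
  induction n with
  | zero => exact hK
  | succ n ih =>
    rw [greedyTab]
    split_ifs
    · exact argmin_lt _ hK
    · exact ih

/-- Turns the weights used while column `x` is built into collisions in the final table, whose
earlier columns no longer change. -/
theorem greedyWeight_eq {K x n L y : ℕ} (hy : y < x) (hx : x < n) :
    greedyWeight K (greedyTab K x) x L y =
      2 ^ ((Finset.range L).filter fun r => greedyTab K n r y = greedyTab K n r x).card := by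
  induction L with
  | zero => simp [greedyWeight]
  | succ L ih =>
    rw [greedyWeight, ih, Finset.range_add_one, Finset.filter_insert, greedyTab_self hx,
      greedyTab_of_lt hy hx.le]
    change (if _ = greedyColor K (greedyTab K x) x L then _ else _) = _
    split_ifs with h
    · rw [Finset.card_insert_of_notMem (by simp), pow_succ, mul_two]
    · rfl

/-- Only an inequality, because colors from `K` on are not counted. -/
theorem sum_colorSum_le (col w : ℕ → ℕ) (x K : ℕ) :
    ∑ c ∈ Finset.range K, colorSum col w x c ≤ ∑ y ∈ Finset.range x, w y := by
  unfold colorSum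
  rw [Finset.sum_comm]
  refine Finset.sum_le_sum fun y _ => ?_
  rw [Finset.sum_ite_eq]
  split_ifs
  · exact le_rfl
  · exact Nat.zero_le _

/-- The least of `K` class weights is at most their average. -/
theorem colorSum_argmin_le (col w : ℕ → ℕ) (x K : ℕ) :
    K * colorSum col w x (argmin (colorSum col w x) K) ≤ ∑ y ∈ Finset.range x, w y := by
  refine le_trans ?_ (sum_colorSum_le col w x K)
  have := Finset.card_nsmul_le_sum (Finset.range K) (colorSum col w x)
    (colorSum col w x (argmin (colorSum col w x) K))
    fun c hc => argmin_le _ (Finset.mem_range.1 hc)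
  simpa using this

theorem sum_greedyWeight_succ (K : ℕ) (tab : ℕ → ℕ → ℕ) (x r : ℕ) :
    ∑ y ∈ Finset.range x, greedyWeight K tab x (r + 1) y =
      ∑ y ∈ Finset.range x, greedyWeight K tab x r y +
        colorSum (tab r) (greedyWeight K tab x r) x (greedyColor K tab x r) := by
  rw [colorSum, ← Finset.sum_add_distrib]
  refine Finset.sum_congr rfl fun y _ => ?_
  rw [greedyWeight]
  change (if _ = greedyColor K tab x r then _ else _) = _
  split_ifs <;> rfl

/-- Doubling a lightest class multiplies the total by at most `1 + 1/K`. The powers of `K` clear the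
denominators. -/
theorem sum_greedyWeight_le (K : ℕ) (tab : ℕ → ℕ → ℕ) (x r : ℕ) :
    K ^ r * ∑ y ∈ Finset.range x, greedyWeight K tab x r y ≤ x * (K + 1) ^ r := by
  induction r with
  | zero => simp [greedyWeight]
  | succ r ih =>
    have := colorSum_argmin_le (tab r) (greedyWeight K tab x r) x K
    rw [sum_greedyWeight_succ]
    set W := ∑ y ∈ Finset.range x, greedyWeight K tab x r y
    set c := colorSum (tab r) (greedyWeight K tab x r) x (greedyColor K tab x r) with hc
    have : K * c ≤ W := this
    calc K ^ (r + 1) * (W + c) = K ^ r * (K * W + K * c) := by ring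
      _ ≤ K ^ r * (K * W + W) := by gcongr
      _ = (K ^ r * W) * (K + 1) := by ring
      _ ≤ (x * (K + 1) ^ r) * (K + 1) := by gcongr
      _ = x * (K + 1) ^ (r + 1) := by ring

/-- This is `(1 + 1/K) ^ K ≤ e < 3` without denominators. -/
theorem succ_pow_self_le (K : ℕ) : (K + 1) ^ K ≤ 3 * K ^ K := by
  rcases Nat.eq_zero_or_pos K with rfl | hK
  · simp
  have hK' : (0 : ℝ) < K := by exact_mod_cast hK
  have h1 : (1 + 1 / (K : ℝ)) ^ K ≤ 3 := by
    calc (1 + 1 / (K : ℝ)) ^ K ≤ (Real.exp (1 / K)) ^ K := by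
          gcongr
          rw [add_comm]
          exact Real.add_one_le_exp _
      _ = Real.exp 1 := by
          rw [← Real.exp_nat_mul]
          congr 1
          field_simp
      _ ≤ 3 := by
          have := Real.exp_one_lt_d9
          linarith
  have h2 : ((K + 1 : ℕ) : ℝ) ^ K ≤ 3 * (K : ℝ) ^ K := by
    calc ((K + 1 : ℕ) : ℝ) ^ K = (1 + 1 / (K : ℝ)) ^ K * (K : ℝ) ^ K := by
          rw [← mul_pow]
          congr 1
          push_cast
          field_simp
      _ ≤ 3 * (K : ℝ) ^ K := by gcongr
  exact_mod_cast h2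

/-- The total weight stays below `64 ^ l`, where `2 ^ l` bounds the number of columns. -/
theorem sum_greedyWeight_lt {K x l r : ℕ} (tab : ℕ → ℕ → ℕ) (hK : 0 < K) (hl : 0 < l)
    (hx : x ≤ 2 ^ l) (hr : r ≤ 3 * K * l) :
    ∑ y ∈ Finset.range x, greedyWeight K tab x r y < 64 ^ l := by
  set W := ∑ y ∈ Finset.range x, greedyWeight K tab x r y with hW
  obtain ⟨d, hd⟩ := Nat.exists_eq_add_of_le hr
  -- Padding to all `3 * K * l` rows, the total is at most `2 ^ l * (1 + 1/K) ^ (3 * K * l)`, and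
  -- this is at most `2 ^ l * 27 ^ l = 54 ^ l`.
  have h1 : K ^ (3 * K * l) * W ≤ K ^ (3 * K * l) * 54 ^ l := by
    calc K ^ (3 * K * l) * W = K ^ d * (K ^ r * W) := by rw [hd, pow_add]; ring
      _ ≤ K ^ d * (x * (K + 1) ^ r) := Nat.mul_le_mul_left _ (sum_greedyWeight_le K tab x r)
      _ ≤ (K + 1) ^ d * (x * (K + 1) ^ r) := by gcongr; omega
      _ = x * (K + 1) ^ (3 * K * l) := by rw [hd, pow_add]; ring
      _ = x * ((K + 1) ^ K) ^ (3 * l) := by rw [← pow_mul]; congr 2; ring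
      _ ≤ 2 ^ l * (3 * K ^ K) ^ (3 * l) := by
          gcongr
          exact succ_pow_self_le K
      _ = K ^ (3 * K * l) * 54 ^ l := by
          rw [mul_pow, ← pow_mul, pow_mul 3 3 l, show 54 = 2 * 3 ^ 3 by norm_num, mul_pow,
            show K * (3 * l) = 3 * K * l by ring]
          ring
  have h2 : W ≤ 54 ^ l := Nat.le_of_mul_le_mul_left h1 (by positivity)
  exact h2.trans_lt (Nat.pow_lt_pow_left (by norm_num) (by omega))

/-- A single weight `2 ^ d` is at most the total, which is below `64 ^ l = 2 ^ (6 * l)`. -/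
theorem collisions_lt {K n l x y : ℕ} (hK : 0 < K) (hl : 0 < l) (hn : n ≤ 2 ^ l) (hy : y < x)
    (hx : x < n) :
    ((Finset.range (3 * K * l)).filter
      fun r => greedyTab K n r y = greedyTab K n r x).card < 6 * l := by
  have h1 := sum_greedyWeight_lt (greedyTab K x) hK hl (hx.le.trans hn) (le_refl (3 * K * l))
  have h2 := Finset.single_le_sum (f := greedyWeight K (greedyTab K x) x (3 * K * l))
    (fun _ _ => Nat.zero_le _) (Finset.mem_range.2 hy)
  rw [greedyWeight_eq hy hx] at h2
  have h3 := h2.trans_lt h1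
  rw [show 64 = 2 ^ 6 by norm_num, ← pow_mul] at h3
  exact (Nat.pow_lt_pow_iff_right (by norm_num)).1 h3

/-! ### Hash functions that are injective on a given small set -/

/-- If any two columns agree in few rows, then some row is injective on a given small set. -/
theorem exists_injOn_of_collisions {q l : ℕ} (T : ℕ → ℕ → ℕ) (S : Finset ℕ) (hS : S.card = q)
    (hq : 0 < q) (hl : 0 < l)
    (h : ∀ x ∈ S, ∀ y ∈ S, y < x →
      ((Finset.range (3 * q ^ 2 * l)).filter fun r => T r y = T r x).card < 6 * l) :
    ∃ r < 3 * q ^ 2 * l, Set.InjOn (T r) S := by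
  by_contra hcon
  push Not at hcon
  set L := 3 * q ^ 2 * l with hL
  -- Double counting of rows and ordered pairs that collide in them: a row that is not injective has
  -- at least two such pairs.
  have h1 : ∀ r ∈ Finset.range L, 2 ≤ (S.offDiag.filter fun z => T r z.1 = T r z.2).card := by
    intro r hr
    have := hcon r (Finset.mem_range.1 hr)
    unfold Set.InjOn at this
    push Not at this
    obtain ⟨x, hx, y, hy, e, hne⟩ := this
    have hsub : {(x, y), (y, x)} ⊆ S.offDiag.filter fun z => T r z.1 = T r z.2 := by
      intro z hz
      simp only [Finset.mem_insert, Finset.mem_singleton] at hz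
      simp only [Finset.mem_filter, Finset.mem_offDiag]
      rcases hz with rfl | rfl
      · exact ⟨⟨hx, hy, hne⟩, e⟩
      · exact ⟨⟨hy, hx, hne.symm⟩, e.symm⟩
    refine le_trans ?_ (Finset.card_le_card hsub)
    rw [Finset.card_pair]
    simp [hne]
  have h2 : ∀ z ∈ S.offDiag,
      ((Finset.range L).filter fun r => T r z.1 = T r z.2).card ≤ 6 * l := by
    rintro ⟨x, y⟩ hz
    rw [Finset.mem_offDiag] at hz
    rcases lt_or_gt_of_ne hz.2.2 with hlt | hlt
    · exact (h y hz.2.1 x hz.1 hlt).le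
    · have := (h x hz.1 y hz.2.1 hlt).le
      simpa only [eq_comm] using this
  have h3 := Finset.card_nsmul_le_sum _ _ _ h1
  have h4 := Finset.sum_le_card_nsmul _ _ _ h2
  rw [Finset.sum_congr rfl fun r _ => Finset.card_filter _ _, Finset.sum_comm,
    ← Finset.sum_congr rfl fun z _ => Finset.card_filter _ _] at h3
  have h5 := h3.trans h4
  rw [Finset.offDiag_card, hS, Finset.card_range, smul_eq_mul, smul_eq_mul, hL] at h5
  -- The two counts give `2 * (3 * q ^ 2 * l) ≤ (q * q - q) * (6 * l)`, which is impossible.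
  have h6 : q * q - q < q * q := by
    have := Nat.mul_le_mul hq hq
    omega
  have h7 := Nat.mul_lt_mul_of_pos_right h6 (show 0 < 6 * l by omega)
  have h8 : 3 * q ^ 2 * l * 2 = q * q * (6 * l) := by ring
  omega

/-- The number of hash functions for sets of `q` jobs, where `2 ^ l` bounds the number of jobs. -/
def rows (q l : ℕ) : ℕ := 3 * q ^ 2 * l

/-- The table of the hash functions: the color of job `y` under the hash function number `r`. -/
def colorTable (q n r y : ℕ) : ℕ :=
  -- The greedy construction needs at least `n ^ 2` steps, too many when `k = 2`, where the time
  -- bound is linear in `n` up to logarithms. For `q = 2` the bits of `y` suffice; for `q = 1` every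
  -- entry is `0`.
  if q < 3 then y / 2 ^ r % q else greedyTab (q ^ 2) n r y

theorem colorTable_lt {q n r y : ℕ} (hq : 0 < q) : colorTable q n r y < q ^ 2 := by
  unfold colorTable
  split_ifs
  · exact (Nat.mod_lt _ hq).trans_le (by rw [sq]; exact Nat.le_mul_of_pos_left q hq)
  · exact greedyTab_lt (by positivity)

/-- Two distinct numbers below `2 ^ l` differ in a bit of index less than `l`, which settles `q =
2`; larger `q` follow from the bound on collisions. -/
theorem exists_injOn_colorTable {q n l : ℕ} (hl : 0 < l) (hn : n ≤ 2 ^ l) (hq : 2 ≤ q)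
    (S : Finset ℕ) (hS : S.card = q) (hSn : ∀ x ∈ S, x < n) :
    ∃ r < rows q l, Set.InjOn (colorTable q n r) S := by
  by_cases h3 : q < 3
  · obtain rfl : q = 2 := by omega
    obtain ⟨x, y, hne, rfl⟩ := Finset.card_eq_two.1 hS
    have hx := (hSn x (by simp)).trans_le hn
    have hy := (hSn y (by simp)).trans_le hn
    obtain ⟨r, hr⟩ : ∃ r, x.testBit r ≠ y.testBit r := by
      by_contra hcon
      push Not at hcon
      exact hne (Nat.eq_of_testBit_eq hcon)
    have hrl : r < l := by
      by_contra hcon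
      have := Nat.pow_le_pow_right (show 0 < 2 by norm_num) (not_lt.1 hcon)
      exact hr (by rw [Nat.testBit_lt_two_pow (by omega), Nat.testBit_lt_two_pow (by omega)])
    refine ⟨r, by unfold rows; omega, ?_⟩
    have hr' : colorTable 2 n r x ≠ colorTable 2 n r y := by
      simp only [colorTable, h3, if_true]
      intro e
      rw [Nat.testBit_eq_decide_div_mod_eq, Nat.testBit_eq_decide_div_mod_eq, e] at hr
      exact hr rfl
    rintro a ha b hb e
    simp only [Finset.coe_insert, Finset.coe_singleton, Set.mem_insert_iff,
      Set.mem_singleton_iff] at ha hb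
    rcases ha with rfl | rfl <;> rcases hb with rfl | rfl
    · rfl
    · exact absurd e hr'
    · exact absurd e.symm hr'
    · rfl
  · obtain ⟨r, hr, h⟩ := exists_injOn_of_collisions (greedyTab (q ^ 2) n) S hS (by omega) hl
      fun x hx y hy hlt => collisions_lt (by positivity) hl hn hlt (hSn x hx)
    refine ⟨r, hr, ?_⟩
    have e : colorTable q n r = greedyTab (q ^ 2) n r := by
      funext y
      simp [colorTable, h3]
    rwa [e]

/-- The hash function number `r` for sets of `q` jobs. -/
def hashFun (q n r : ℕ) (hq : 0 < q) (j : Fin n) : Fin (q ^ 2) :=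
  ⟨colorTable q n r j, colorTable_lt hq⟩

open Classical in
/-- The family of all hash functions for sets of `q` jobs. -/
noncomputable def hashFamily (n l q : ℕ) : Finset (Fin n → Fin (q ^ 2)) :=
  if hq : 0 < q then (Finset.range (rows q l)).image fun r => hashFun q n r hq else ∅

theorem card_hashFamily_le (n l q : ℕ) : (hashFamily n l q).card ≤ rows q l := by
  unfold hashFamily
  split_ifs with hq
  · exact Finset.card_image_le.trans (Finset.card_range _).le
  · simp

theorem mem_hashFamily {n l q : ℕ} (hq : 0 < q) {h : Fin n → Fin (q ^ 2)} :
    h ∈ hashFamily n l q ↔ ∃ r < rows q l, hashFun q n r hq = h := by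
  simp [hashFamily, hq]

/-- A function that is injective on `S` takes each color at most once there, so the counts differ by
at most one. For `q = 1` there is only one color. -/
theorem isSplitter_hashFamily {n l q : ℕ} (hl : 0 < l) (hn : n ≤ 2 ^ l) (hq : 0 < q) :
    IsSplitter q (hashFamily n l q) := by
  intro S hS
  rcases Nat.lt_or_ge q 2 with h1 | h2
  · obtain rfl : q = 1 := by omega
    refine ⟨hashFun 1 n 0 hq, (mem_hashFamily hq).2 ⟨0, by unfold rows; omega, rfl⟩, ?_⟩
    intro c c'
    have h : c = c' := by
      apply Fin.ext
      have := c.isLt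
      have := c'.isLt
      omega
    rw [h]
    exact Nat.le_succ _
  · obtain ⟨r, hr, hinj⟩ := exists_injOn_colorTable hl hn h2 (S.map Fin.valEmbedding)
      (by rw [Finset.card_map, hS]) (by simp)
    refine ⟨hashFun q n r hq, (mem_hashFamily hq).2 ⟨r, hr, rfl⟩, fun c c' => ?_⟩
    refine le_trans (Finset.card_le_one.2 ?_) (Nat.le_add_left _ _)
    intro a ha b hb
    rw [Finset.mem_filter] at ha hb
    have e : hashFun q n r hq a = hashFun q n r hq b := ha.2.trans hb.2.symm
    exact Fin.ext (hinj (by simpa [-Finset.coe_map] using ⟨a, ha.1, rfl⟩)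
      (by simpa [-Finset.coe_map] using ⟨b, hb.1, rfl⟩) (congrArg Fin.val e))


/-! ### Codes and sets of jobs -/

variable {n : ℕ}

/-- The set of the jobs that are the first `m` digits of `e`. -/
def codeSet (n m e : ℕ) : Finset (Fin n) :=
  Finset.univ.filter fun j => (j : ℕ) ∈ (Finset.range m).image (digit n e)

theorem ValidCode.strictMonoOn {m e : ℕ} {P : ℕ → Prop} (h : ValidCode n m P e) :
    ∀ t < m, ∀ t' < t, digit n e t' < digit n e t := by
  intro t ht
  induction t with
  | zero => simp
  | succ t ih =>
    intro t' ht'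
    rcases Nat.lt_succ_iff_lt_or_eq.1 ht' with hlt | rfl
    · exact (ih (by omega) t' hlt).trans (h.1 t ht)
    · exact h.1 _ ht

theorem ValidCode.injOn {m e : ℕ} {P : ℕ → Prop} (h : ValidCode n m P e) :
    Set.InjOn (digit n e) (Finset.range m) := by
  intro a ha b hb hab
  rw [Finset.mem_coe, Finset.mem_range] at ha hb
  rcases lt_trichotomy a b with hlt | rfl | hlt
  · exact absurd hab (h.strictMonoOn b hb a hlt).ne
  · rfl
  · exact absurd hab (h.strictMonoOn a ha b hlt).ne'

/-- All digits are below `n`, so none is lost when digits are read as jobs. -/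
theorem map_codeSet (hn : 0 < n) (m e : ℕ) :
    (codeSet n m e).map Fin.valEmbedding = (Finset.range m).image (digit n e) := by
  ext x
  simp only [codeSet, Finset.mem_map, Finset.mem_filter, Finset.mem_univ, true_and,
    Fin.valEmbedding_apply]
  constructor
  · rintro ⟨j, hj, rfl⟩
    exact hj
  · intro hx
    obtain ⟨t, -, rfl⟩ := Finset.mem_image.1 hx
    exact ⟨⟨digit n e t, Nat.mod_lt _ hn⟩, hx, rfl⟩

theorem ValidCode.card_codeSet {m e : ℕ} {P : ℕ → Prop} (h : ValidCode n m P e) (hn : 0 < n) :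
    (codeSet n m e).card = m := by
  rw [← Finset.card_map Fin.valEmbedding, map_codeSet hn, Finset.card_image_of_injOn h.injOn,
    Finset.card_range]

theorem ValidCode.of_mem {m e : ℕ} {P : ℕ → Prop} (h : ValidCode n m P e) {j : Fin n}
    (hj : j ∈ codeSet n m e) : P j := by
  rw [codeSet, Finset.mem_filter] at hj
  obtain ⟨t, ht, e⟩ := Finset.mem_image.1 hj.2
  rw [← e]
  exact h.2 t (Finset.mem_range.1 ht)

/-- A valid code lists its set without repetition. -/
theorem ValidCode.codeVal_eq {m e : ℕ} {P : ℕ → Prop} (h : ValidCode n m P e) (hn : 0 < n)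
    {v : ℕ → ℝ} {f : Fin n → ℝ} (hv : ∀ j : Fin n, v j = f j) :
    codeVal v n m e = ∑ j ∈ codeSet n m e, f j := by
  rw [codeVal, ← Finset.sum_image (f := v) h.injOn, ← map_codeSet hn, Finset.sum_map]
  exact Finset.sum_congr rfl fun j _ => hv j

/-- Horner's scheme, least significant digit first: put `f 0` below a code of the shifted sequence.
-/
theorem exists_digits (m : ℕ) (f : ℕ → ℕ) (hf : ∀ t, f t < n) :
    ∃ e < n ^ m, ∀ t < m, digit n e t = f t := by
  induction m generalizing f with
  | zero => exact ⟨0, by simp, by simp⟩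
  | succ m ih =>
    obtain ⟨e, he, h⟩ := ih (fun t => f (t + 1)) fun t => hf _
    have h0 := hf 0
    have hn : 0 < n := by omega
    refine ⟨f 0 + n * e, ?_, fun t ht => ?_⟩
    · rw [pow_succ, mul_comm (n ^ m)]
      have := Nat.mul_le_mul_left n (show e + 1 ≤ n ^ m from he)
      rw [mul_add, mul_one] at this
      omega
    · cases t with
      | zero => simp [digit, Nat.mod_eq_of_lt h0]
      | succ t =>
        rw [← h t (by omega), digit, digit, pow_succ', ← Nat.div_div_eq_div_mul,
          Nat.add_mul_div_left _ _ hn, Nat.div_eq_of_lt h0, zero_add]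

/-- The digits are the jobs of `S` in increasing order. Outside the first `m` places the default `0`
is a legitimate digit because `0 < n`. -/
theorem exists_validCode {m : ℕ} {P : ℕ → Prop} (hn : 0 < n) (S : Finset (Fin n))
    (hS : S.card = m) (hP : ∀ j ∈ S, P j) :
    ∃ e < n ^ m, ValidCode n m P e ∧ codeSet n m e = S := by
  obtain ⟨e, he, h⟩ := exists_digits (n := n) m
    (fun t => if ht : t < m then (S.orderEmbOfFin hS ⟨t, ht⟩ : Fin n) else 0) fun t => by
      split_ifs
      · exact Fin.isLt _
      · exact hn
  refine ⟨e, he, ⟨fun t ht => ?_, fun t ht => ?_⟩, ?_⟩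
  · rw [h t (by omega), h (t + 1) ht, dif_pos (by omega), dif_pos ht]
    exact (S.orderEmbOfFin hS).strictMono (by simp [Fin.lt_def])
  · rw [h t ht, dif_pos ht]
    exact hP _ (Finset.orderEmbOfFin_mem S hS _)
  · ext j
    rw [codeSet, Finset.mem_filter]
    simp only [Finset.mem_univ, true_and, Finset.mem_image, Finset.mem_range]
    constructor
    · rintro ⟨t, ht, e⟩
      rw [h t ht, dif_pos ht] at e
      rw [← Fin.ext e]
      exact Finset.orderEmbOfFin_mem S hS _
    · intro hj
      have : j ∈ Set.range (S.orderEmbOfFin hS) := by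
        rw [Finset.range_orderEmbOfFin]
        exact hj
      obtain ⟨t, rfl⟩ := this
      exact ⟨t, t.isLt, by rw [h t t.isLt, dif_pos t.isLt]⟩

/-! ### Hits in terms of codes -/

/-- The color of the job `g` under the hash function number `r` and the recoloring number `i`. -/
def jobColor (q n i r g : ℕ) : ℕ := recolor (q ^ 2) i (colorTable q n r g)

/-- The codes `e₁`, `e₂` describe a hit in the division given by the hash function number `r` and
the recoloring number `i`. -/
structure CodeHit (v : ℕ → ℝ) (Δ : ℝ) (n q i r e₁ e₂ : ℕ) : Prop where
  valid₁ : ValidCode n ((q + 1) / 2) (fun g => jobColor q n i r g = 0) e₁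
  valid₂ : ValidCode n (q / 2) (fun g => jobColor q n i r g = 1) e₂
  pos : 0 < codeVal v n ((q + 1) / 2) e₁ + codeVal v n (q / 2) e₂
  lt : codeVal v n ((q + 1) / 2) e₁ + codeVal v n (q / 2) e₂ < Δ

section hit

variable {p : Fin n → ℝ} {σ : Schedule n} {v : ℕ → ℝ} {q i r : ℕ}

theorem mem_part_hashFun (hq : 0 < q) (j : Fin n) :
    j ∈ part (hashFun q n r hq) i ↔ jobColor q n i r j = 0 := by
  rw [part, Finset.mem_filter]
  simp [hashFun, jobColor]

theorem mem_compl_part_hashFun (hq : 0 < q) (j : Fin n) :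
    j ∈ (part (hashFun q n r hq) i)ᶜ ↔ jobColor q n i r j = 1 := by
  rw [Finset.mem_compl, mem_part_hashFun]
  unfold jobColor
  have := (recolor (q ^ 2) i (colorTable q n r j)).isLt
  omega

/-- With its converse `IsHit.exists_codeHit` this reduces the search over sets of jobs to a search
over pairs of numbers. -/
theorem CodeHit.isHit {e₁ e₂ : ℕ} (hn : 0 < n) (hq : 0 < q)
    (hv : ∀ j : Fin n, v j = signed p σ j) (h : CodeHit v (gap p σ) n q i r e₁ e₂) :
    IsHit p σ q (part (hashFun q n r hq) i) (codeSet n ((q + 1) / 2) e₁)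
      (codeSet n (q / 2) e₂) := by
  obtain ⟨h1, h2, h3, h4⟩ := h
  rw [h1.codeVal_eq hn hv, h2.codeVal_eq hn hv, ← surplus_eq_sum, ← surplus_eq_sum] at h3 h4
  refine ⟨fun j hj => (mem_part_hashFun hq j).2 (h1.of_mem hj), h1.card_codeSet hn,
    fun j hj => (mem_compl_part_hashFun hq j).2 (h2.of_mem hj), h2.card_codeSet hn, h3, h4⟩

theorem IsHit.exists_codeHit (hn : 0 < n) (hq : 0 < q)
    (hv : ∀ j : Fin n, v j = signed p σ j) {S₁ S₂ : Finset (Fin n)}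
    (h : IsHit p σ q (part (hashFun q n r hq) i) S₁ S₂) :
    ∃ e₁ < n ^ ((q + 1) / 2), ∃ e₂ < n ^ (q / 2), CodeHit v (gap p σ) n q i r e₁ e₂ := by
  obtain ⟨h1, h2, h3, h4, h5, h6⟩ := h
  obtain ⟨e₁, he₁, g1, rfl⟩ := exists_validCode (P := fun g => jobColor q n i r g = 0) hn S₁ h2
    fun j hj => (mem_part_hashFun hq j).1 (h1 hj)
  obtain ⟨e₂, he₂, g2, rfl⟩ := exists_validCode (P := fun g => jobColor q n i r g = 1) hn S₂ h4
    fun j hj => (mem_compl_part_hashFun hq j).1 (h3 hj)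
  rw [surplus_eq_sum, surplus_eq_sum, ← g1.codeVal_eq hn hv, ← g2.codeVal_eq hn hv] at h5 h6
  exact ⟨e₁, he₁, e₂, he₂, g1, g2, h5, h6⟩

theorem IsHit.card_union {k : ℕ} {A S₁ S₂ : Finset (Fin n)} (h : IsHit p σ k A S₁ S₂) :
    (S₁ ∪ S₂).card = k := by
  rw [Finset.card_union_of_disjoint
    (disjoint_compl_right.mono h.1 h.2.2.1), h.2.1, h.2.2.2.1]
  omega

theorem IsHit.makespan_lt {k : ℕ} {A S₁ S₂ : Finset (Fin n)} (h : IsHit p σ k A S₁ S₂) :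
    makespan p (swap σ (S₁ ∪ S₂)) < makespan p σ := by
  rw [makespan_swap_lt_iff, surplus_union p σ
    (disjoint_compl_right.mono h.1 h.2.2.1)]
  exact ⟨h.2.2.2.2.1, h.2.2.2.2.2⟩

/-- If some swap of `q` jobs decreases the makespan, then the search has a hit. -/
theorem exists_isHit {l : ℕ} (hl : 0 < l) (hn : n ≤ 2 ^ l) (hq : 0 < q) {S : Finset (Fin n)}
    (hS : S.card = q) (hlt : makespan p (swap σ S) < makespan p σ) :
    ∃ h ∈ hashFamily n l q, ∃ i < 2 * q ^ 2, ∃ S₁ S₂ : Finset (Fin n),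
      IsHit p σ q (part h i) S₁ S₂ := by
  obtain ⟨h, hh, hinj⟩ : ∃ h ∈ hashFamily n l q, Set.InjOn h S := by
    rcases Nat.lt_or_ge q 2 with h1 | h2
    · obtain rfl : q = 1 := by omega
      refine ⟨hashFun 1 n 0 hq, (mem_hashFamily hq).2 ⟨0, by unfold rows; omega, rfl⟩, ?_⟩
      intro a ha b hb _
      exact Finset.card_le_one.1 hS.le a ha b hb
    · obtain ⟨r, hr, hinj⟩ := exists_injOn_colorTable hl hn h2 (S.map Fin.valEmbedding)
        (by rw [Finset.card_map, hS]) (by simp)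
      refine ⟨hashFun q n r hq, (mem_hashFamily hq).2 ⟨r, hr, rfl⟩, ?_⟩
      intro a ha b hb e
      exact Fin.ext (hinj (by simpa [-Finset.coe_map] using ⟨a, ha, rfl⟩)
        (by simpa [-Finset.coe_map] using ⟨b, hb, rfl⟩) (congrArg Fin.val e))
  have hinj' : Set.InjOn (fun j => (h j : ℕ)) S := fun a ha b hb e => hinj ha hb (Fin.ext e)
  -- By injectivity the images of `S` are `q` distinct numbers below `q ^ 2`, to which the
  -- recoloring argument applies.
  obtain ⟨i, hi, hcard⟩ := exists_recolor hq (S.image fun j => (h j : ℕ))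
    (fun x hx => by
      obtain ⟨j, -, rfl⟩ := Finset.mem_image.1 hx
      exact (h j).isLt) (by rw [Finset.card_image_of_injOn hinj', hS])
  rw [Finset.filter_image, Finset.card_image_of_injOn
    (hinj'.mono fun x hx => (Finset.mem_filter.1 hx).1)] at hcard
  have hS1 : (S.filter fun j => j ∈ part h i) = S.filter fun j => recolor (q ^ 2) i (h j) = 0 :=
    Finset.filter_congr fun j _ => by simp [part]
  have hdisj := Finset.disjoint_filter_filter_not S S (fun j => j ∈ part h i)
  have hun := Finset.filter_union_filter_not_eq (fun j => j ∈ part h i) S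
  refine ⟨h, hh, i, hi, S.filter fun j => j ∈ part h i, S.filter fun j => ¬ j ∈ part h i,
    fun j hj => (Finset.mem_filter.1 hj).2, by rw [hS1, hcard],
    fun j hj => Finset.mem_compl.2 (Finset.mem_filter.1 hj).2, ?_, ?_⟩
  · have := Finset.card_union_of_disjoint hdisj
    rw [hun, hS, hS1, hcard] at this
    omega
  · rw [← surplus_union p σ hdisj, hun, ← makespan_swap_lt_iff]
    exact hlt

end hit


/-! ### Computing the splitters -/

/-- The table is stored row by row in one array; division with remainder by `n` shows that its cells
do not overlap. -/
theorem row_add_inj {n r y r' y' : ℕ} (hy : y < n) (hy' : y' < n) :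
    r * n + y = r' * n + y' ↔ r = r' ∧ y = y' := by
  constructor
  · intro h
    have hn : 0 < n := by omega
    have h1 : (y + r * n) / n = (y' + r' * n) / n := by rw [add_comm y, h, add_comm]
    rw [Nat.add_mul_div_right _ _ hn, Nat.add_mul_div_right _ _ hn, Nat.div_eq_of_lt hy,
      Nat.div_eq_of_lt hy'] at h1
    have h2 : r = r' := by omega
    subst h2
    omega
  · rintro ⟨rfl, rfl⟩
    rfl

theorem row_add_lt {n r L y : ℕ} (hr : r < L) (hy : y < n) : r * n + y < L * n := by
  have := Nat.mul_le_mul_right n (show r + 1 ≤ L from hr)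
  rw [add_mul] at this
  omega

/-- Fill the first variable `8` rows of the table in array `1` for sets of at most two jobs. -/
def bitsProg : Prog :=
  .const 70 1 ;; .const 18 0 ;; .const 19 0 ;; .loop (.lt 18 8) (
    .const 71 0 ;; .loop (.lt 71 0) (
      .op .div 72 71 70 ;; .op .div 73 72 3 ;; .op .mul 73 73 3 ;; .op .sub 73 72 73 ;;
      .op .add 74 19 71 ;; .store 1 74 73 ;; inc 71) ;;
    .op .add 70 70 70 ;; .op .add 19 19 0 ;; inc 18)

/-- The hypothesis `2 ^ L < B` is for variable `70`, which holds `2 ^ r` and reaches `2 ^ L` after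
the last row. -/
theorem bitsProg_spec {B : ℕ} {s : State} {n q L : ℕ} (hn : s.var 0 = n) (hq : s.var 3 = q)
    (hL : s.var 8 = L) (h2 : 2 ^ L < B) (hB : L * n + n + L + 1 < B) :
    wp B bitsProg s fun s' t => t ≤ (9 * n + 8) * L + 4 ∧
      ∀ r < L, ∀ y < n, s'.arr 1 (r * n + y) = y / 2 ^ r % q := by
  unfold bitsProg
  simp only [wp_seq, wp_const]
  refine ⟨by omega, by omega, by omega, wp.call (wp_loop
    (fun s' => s'.var 18 ≤ L ∧ s'.var 70 = 2 ^ s'.var 18 ∧ s'.var 19 = s'.var 18 * n ∧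
      ∀ r < s'.var 18, ∀ y < n, s'.arr 1 (r * n + y) = y / 2 ^ r % q)
    (fun s' => L - s'.var 18) (9 * n + 7) ?_ ?_) ?_⟩
  · simp
  · rintro s₁ F ⟨h1, g2, h3, h4⟩ hb
    have hn1 : s₁.var 0 = n := by simpa [hn] using F.var 0
    have hq1 : s₁.var 3 = q := by simpa [hq] using F.var 3
    have hL1 : s₁.var 8 = L := by simpa [hL] using F.var 8
    simp only [Test.holds, hL1] at hb
    have hrow := Nat.mul_le_mul_right n (show s₁.var 18 + 1 ≤ L from hb)
    rw [add_mul, one_mul] at hrow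
    have hpow := Nat.pow_le_pow_right (show 0 < 2 by norm_num) (show s₁.var 18 + 1 ≤ L from hb)
    rw [pow_succ] at hpow
    simp
    refine ⟨by omega, wp.call (wp_loop
      (fun s' => s'.var 71 ≤ n ∧
        (∀ r < s₁.var 18, ∀ y < n, s'.arr 1 (r * n + y) = y / 2 ^ r % q) ∧
        ∀ y < s'.var 71, s'.arr 1 (s₁.var 18 * n + y) = y / 2 ^ s₁.var 18 % q)
      (fun s' => n - s'.var 71) 8 ?_ ?_) ?_⟩
    · simp
      exact h4
    · rintro s₂ F2 ⟨k1, k2, k3⟩ hb2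
      have hn2 : s₂.var 0 = n := by simpa [hn1] using F2.var 0
      have hq2 : s₂.var 3 = q := by simpa [hq1] using F2.var 3
      have hp2 : s₂.var 70 = 2 ^ s₁.var 18 := by simpa [g2] using F2.var 70
      have hr2 : s₂.var 19 = s₁.var 18 * n := by simpa [h3] using F2.var 19
      simp only [Test.holds, hn2] at hb2
      have hx : s₂.var 71 / 2 ^ s₁.var 18 < B :=
        (Nat.div_le_self _ _).trans_lt (by omega)
      obtain ⟨b1, b2, b3⟩ := digitStep_bounds (n := q) hx
      have hmod : s₂.var 71 / 2 ^ s₁.var 18 - s₂.var 71 / 2 ^ s₁.var 18 / q * q =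
          s₂.var 71 / 2 ^ s₁.var 18 % q := by
        rw [Nat.mod_eq_sub_div_mul]
      simp [hq2, hp2, hr2, hx, b1, b2, b3, hmod]
      and_intros
      · omega
      · omega
      · omega
      · intro r hr y hy
        rw [if_neg, k2 r hr y hy]
        rw [row_add_inj hy hb2]
        omega
      · intro y hy
        split_ifs with h
        · rw [h]
        · exact k3 y (by omega)
      · omega
    · rintro s₂ t F2 ⟨⟨k1, k2, k3⟩, hb2, ht⟩
      have hn2 : s₂.var 0 = n := by simpa [hn1] using F2.var 0
      have hp2 : s₂.var 70 = 2 ^ s₁.var 18 := by simpa [g2] using F2.var 70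
      have hr2 : s₂.var 19 = s₁.var 18 * n := by simpa [h3] using F2.var 19
      have hi2 : s₂.var 18 = s₁.var 18 := by simpa using F2.var 18
      simp [hn2] at hb2 ht
      simp [hn2, hp2, hr2, hi2]
      and_intros
      · omega
      · omega
      · omega
      · omega
      · omega
      · rw [pow_succ]; ring
      · ring
      · intro r hr y hy
        rcases Nat.lt_or_eq_of_le hr with h | rfl
        · exact k2 r h y hy
        · exact k3 y (by omega)
      · omega
  · rintro s₁ t F ⟨⟨h1, g2, h3, h4⟩, hb, ht⟩
    have hL1 : s₁.var 8 = L := by simpa [hL] using F.var 8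
    simp [hL1] at hb ht
    exact ⟨by linarith, fun r hr => h4 r (by omega)⟩

/-! ### The greedy table -/

/-- Set the first variable `7` entries of array `7` to `0`. -/
def clearProg : Prog :=
  .const 71 0 ;; .const 72 0 ;; .loop (.lt 71 7) (.store 7 71 72 ;; inc 71)

theorem clearProg_spec {B : ℕ} {s : State} {K : ℕ} (hK : s.var 7 = K) (hB : K + 1 < B) :
    wp B clearProg s fun s' t => t ≤ 4 * K + 3 ∧ ∀ c < K, s'.arr 7 c = 0 := by
  unfold clearProg
  simp only [wp_seq, wp_const]
  refine ⟨by omega, by omega, wp.call (wp_loop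
    (fun s' => s'.var 71 ≤ K ∧ ∀ c < s'.var 71, s'.arr 7 c = 0)
    (fun s' => K - s'.var 71) 3 ?_ ?_) ?_⟩
  · simp
  · rintro s₁ F ⟨h1, h2⟩ hb
    have hK1 : s₁.var 7 = K := by simpa [hK] using F.var 7
    have hz : s₁.var 72 = 0 := by simpa using F.var 72
    simp [hK1] at hb
    simp [hz]
    and_intros
    · omega
    · omega
    · intro c hc hne
      exact h2 c (by omega)
    · omega
  · rintro s₁ t F ⟨⟨h1, h2⟩, hb, ht⟩
    have hK1 : s₁.var 7 = K := by simpa [hK] using F.var 7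
    simp [hK1] at hb ht
    exact ⟨by omega, fun c hc => h2 c (by omega)⟩

/-- Add the weights (array `6`) of the numbers below variable `75` to the entries of array `7`
given by the colors in the current row. -/
def addWeightsProg : Prog :=
  .const 71 0 ;; .loop (.lt 71 75) (
    .op .add 72 19 71 ;; .load 72 1 72 ;; .load 73 7 72 ;; .load 74 6 71 ;;
    .op .add 73 73 74 ;; .store 7 72 73 ;; inc 71)

theorem colorSum_le (col w : ℕ → ℕ) (x c : ℕ) :
    colorSum col w x c ≤ ∑ y ∈ Finset.range x, w y := by
  unfold colorSum
  refine Finset.sum_le_sum fun y _ => ?_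
  split_ifs
  · exact le_rfl
  · exact Nat.zero_le _

/-- Every partial class sum is at most the total weight, so the bound `hw` on the total excludes
overflow. -/
theorem addWeightsProg_spec {B : ℕ} {s : State} {K x row : ℕ} (hx : s.var 75 = x)
    (hr : s.var 19 = row) (h0 : ∀ c < K, s.arr 7 c = 0) (hcol : ∀ y < x, s.arr 1 (row + y) < K)
    (hw : ∑ y ∈ Finset.range x, s.arr 6 y < B) (hB : row + x + 1 < B) :
    wp B addWeightsProg s fun s' t => t ≤ 9 * x + 2 ∧
      ∀ c < K, s'.arr 7 c = colorSum (fun y => s.arr 1 (row + y)) (s.arr 6) x c := by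
  unfold addWeightsProg
  simp only [wp_seq, wp_const]
  refine ⟨by omega, wp.call (wp_loop
    (fun s' => s'.var 71 ≤ x ∧
      ∀ c < K, s'.arr 7 c = colorSum (fun y => s.arr 1 (row + y)) (s.arr 6) (s'.var 71) c)
    (fun s' => x - s'.var 71) 8 ?_ ?_) ?_⟩
  · simpa [colorSum] using h0
  · rintro s₁ F ⟨h1, h2⟩ hb
    have hx1 : s₁.var 75 = x := by simpa [hx] using F.var 75
    have hr1 : s₁.var 19 = row := by simpa [hr] using F.var 19
    have ha1 : s₁.arr 1 = s.arr 1 := by simpa using F.arr 1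
    have ha6 : s₁.arr 6 = s.arr 6 := by simpa using F.arr 6
    simp [hx1] at hb
    have hs : ∀ c, colorSum (fun y => s.arr 1 (row + y)) (s.arr 6) (s₁.var 71 + 1) c =
        colorSum (fun y => s.arr 1 (row + y)) (s.arr 6) (s₁.var 71) c +
          if s.arr 1 (row + s₁.var 71) = c then s.arr 6 (s₁.var 71) else 0 := fun c => by
      rw [colorSum, colorSum, Finset.sum_range_succ]
    have hlt : colorSum (fun y => s.arr 1 (row + y)) (s.arr 6) (s₁.var 71)
        (s.arr 1 (row + s₁.var 71)) + s.arr 6 (s₁.var 71) < B := by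
      have e1 := hs (s.arr 1 (row + s₁.var 71))
      rw [if_pos rfl] at e1
      rw [← e1]
      refine ((colorSum_le _ _ _ _).trans ?_).trans_lt hw
      exact Finset.sum_le_sum_of_subset (by simpa using hb)
    simp [hr1, ha1, ha6, h2 _ (hcol _ hb), hlt]
    and_intros
    · omega
    · omega
    · omega
    · intro c hc
      rw [hs, h2 c hc]
      by_cases h : c = s.arr 1 (row + s₁.var 71)
      · rw [if_pos h, if_pos h.symm, h]
      · rw [if_neg h, if_neg (Ne.symm h), add_zero]
    · omega
  · rintro s₁ t F ⟨⟨h1, h2⟩, hb, ht⟩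
    have hx1 : s₁.var 75 = x := by simpa [hx] using F.var 75
    simp [hx1] at hb ht
    rw [show s₁.var 71 = x by omega] at h2
    exact ⟨by omega, h2⟩

/-- Variable `76` becomes the first position below variable `7` of the least entry of
array `7`. -/
def argminProg : Prog :=
  .const 71 0 ;; .const 76 0 ;; .loop (.lt 71 7) (
    .load 72 7 71 ;; .load 73 7 76 ;; .cond (.lt 72 73) (mov 76 71) (mov 76 76) ;; inc 71)

theorem argminProg_spec {B : ℕ} {s : State} {K : ℕ} (hK : s.var 7 = K) (hB : K + 1 < B) :
    wp B argminProg s fun s' t => t ≤ 8 * K + 3 ∧ s'.var 76 = argmin (s.arr 7) K := by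
  unfold argminProg
  simp only [wp_seq, wp_const]
  refine ⟨by omega, by omega, wp.call (wp_loop
    (fun s' => s'.var 71 ≤ K ∧ s'.var 76 = argmin (s.arr 7) (s'.var 71))
    (fun s' => K - s'.var 71) 7 ?_ ?_) ?_⟩
  · simp [argmin]
  · rintro s₁ F ⟨h1, h2⟩ hb
    have hK1 : s₁.var 7 = K := by simpa [hK] using F.var 7
    have ha : s₁.arr 7 = s.arr 7 := by simpa using F.arr 7
    simp [hK1] at hb
    have hlt : argmin (s.arr 7) (s₁.var 71) ≤ s₁.var 71 := by
      rcases Nat.eq_zero_or_pos (s₁.var 71) with h | h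
      · rw [h, argmin]
      · exact (argmin_lt _ h).le
    by_cases hc : s.arr 7 (s₁.var 71) < s.arr 7 (argmin (s.arr 7) (s₁.var 71)) <;>
    · simp [ha, h2, hc, argmin]
      omega
  · rintro s₁ t F ⟨⟨h1, h2⟩, hb, ht⟩
    have hK1 : s₁.var 7 = K := by simpa [hK] using F.var 7
    simp [hK1] at hb ht
    rw [h2, show s₁.var 71 = K by omega]
    exact ⟨by omega, rfl⟩

/-- Double the weights of the numbers below variable `75` whose color in the current row is
variable `76`. -/
def doubleProg : Prog :=
  .const 71 0 ;; .loop (.lt 71 75) (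
    .op .add 72 19 71 ;; .load 72 1 72 ;; .cond (.lt 72 76) .skip (.cond (.lt 76 72) .skip (
      .load 73 6 71 ;; .op .add 73 73 73 ;; .store 6 71 73)) ;; inc 71)

theorem doubleProg_spec {B : ℕ} {s : State} {x row b : ℕ} (hx : s.var 75 = x)
    (hr : s.var 19 = row) (hb : s.var 76 = b) (hw : ∀ y < x, s.arr 6 y + s.arr 6 y < B)
    (hB : row + x + 1 < B) :
    wp B doubleProg s fun s' t => t ≤ 10 * x + 2 ∧
      ∀ y < x, s'.arr 6 y =
        if s.arr 1 (row + y) = b then s.arr 6 y + s.arr 6 y else s.arr 6 y := by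
  unfold doubleProg
  simp only [wp_seq, wp_const]
  refine ⟨by omega, wp.call (wp_loop
    (fun s' => s'.var 71 ≤ x ∧ (∀ y < s'.var 71, s'.arr 6 y =
        if s.arr 1 (row + y) = b then s.arr 6 y + s.arr 6 y else s.arr 6 y) ∧
      ∀ y, s'.var 71 ≤ y → s'.arr 6 y = s.arr 6 y)
    (fun s' => x - s'.var 71) 9 ?_ ?_) ?_⟩
  · simp
  · rintro s₁ F ⟨h1, h2, h3⟩ hlt
    have hx1 : s₁.var 75 = x := by simpa [hx] using F.var 75
    have hr1 : s₁.var 19 = row := by simpa [hr] using F.var 19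
    have hb1 : s₁.var 76 = b := by simpa [hb] using F.var 76
    have ha1 : s₁.arr 1 = s.arr 1 := by simpa using F.arr 1
    simp [hx1] at hlt
    have h3' := h3 _ le_rfl
    have hw' := hw _ hlt
    rw [wp_seq, wp_op, wp_seq, wp_load, wp_seq]
    simp only [Op.eval, setVar_var, hr1, ha1, setVar_arr, if_true]
    refine ⟨by omega, wp.call (R := fun s' t => t ≤ 5 ∧ s'.var 71 = s₁.var 71 ∧
      (∀ y ≠ s₁.var 71, s'.arr 6 y = s₁.arr 6 y) ∧ s'.arr 6 (s₁.var 71) =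
        if s.arr 1 (row + s₁.var 71) = b then s.arr 6 (s₁.var 71) + s.arr 6 (s₁.var 71)
        else s.arr 6 (s₁.var 71)) ?_ ?_⟩
    · rcases lt_trichotomy (s.arr 1 (row + s₁.var 71)) b with hc | hc | hc
      · simp [hb1, hc, hc.ne, h3']
      · simp +contextual [hb1, hc, h3', hw']
      · simp [hb1, hc, hc.ne', hc.not_gt, h3']
    · rintro s₂ t F2 ⟨g1, g2, g3, g4⟩
      simp [g2]
      and_intros
      · omega
      · omega
      · omega
      · intro y hy
        rcases Nat.lt_or_eq_of_le hy with h | rfl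
        · rw [g3 y h.ne, h2 y h]
        · exact g4
      · intro y hy
        rw [g3 y (by omega), h3 y (by omega)]
      · omega
  · rintro s₁ t F ⟨⟨h1, h2, h3⟩, hlt, ht⟩
    have hx1 : s₁.var 75 = x := by simpa [hx] using F.var 75
    simp [hx1] at hlt ht
    exact ⟨by omega, fun y hy => h2 y (by omega)⟩


/-- Set the first variable `75` weights to `1`. -/
def onesProg : Prog :=
  .const 71 0 ;; .const 72 1 ;; .loop (.lt 71 75) (.store 6 71 72 ;; inc 71)

theorem onesProg_spec {B : ℕ} {s : State} {x : ℕ} (hx : s.var 75 = x) (hB : x + 1 < B) :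
    wp B onesProg s fun s' t => t ≤ 4 * x + 3 ∧ ∀ y < x, s'.arr 6 y = 1 := by
  unfold onesProg
  simp only [wp_seq, wp_const]
  refine ⟨by omega, by omega, wp.call (wp_loop
    (fun s' => s'.var 71 ≤ x ∧ ∀ y < s'.var 71, s'.arr 6 y = 1)
    (fun s' => x - s'.var 71) 3 ?_ ?_) ?_⟩
  · simp
  · rintro s₁ F ⟨h1, h2⟩ hb
    have hx1 : s₁.var 75 = x := by simpa [hx] using F.var 75
    have hz : s₁.var 72 = 1 := by simpa using F.var 72
    simp [hx1] at hb
    simp [hz]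
    and_intros
    · omega
    · omega
    · intro y hy hne
      exact h2 y (by omega)
    · omega
  · rintro s₁ t F ⟨⟨h1, h2⟩, hb, ht⟩
    have hx1 : s₁.var 75 = x := by simpa [hx] using F.var 75
    simp [hx1] at hb ht
    exact ⟨by omega, fun y hy => h2 y (by omega)⟩

/-- Choose one entry of the column variable `75` greedily. -/
def entryProg : Prog :=
  clearProg ;; addWeightsProg ;; argminProg ;; .op .add 72 19 75 ;; .store 1 72 76 ;; doubleProg ;;
  .op .add 19 19 0 ;; inc 18

/-- Choose the column variable `75` of the table greedily. -/
def columnProg : Prog :=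
  onesProg ;; .const 18 0 ;; .const 19 0 ;; .loop (.lt 18 8) entryProg

theorem colorSum_congr {col col' w w' : ℕ → ℕ} {x : ℕ} (h : ∀ y < x, col y = col' y)
    (h' : ∀ y < x, w y = w' y) (c : ℕ) : colorSum col w x c = colorSum col' w' x c := by
  unfold colorSum
  refine Finset.sum_congr rfl fun y hy => ?_
  rw [h y (Finset.mem_range.1 hy), h' y (Finset.mem_range.1 hy)]

theorem argmin_congr {f g : ℕ → ℕ} {K : ℕ} (h : ∀ c < K, f c = g c) : argmin f K = argmin g K := by
  induction K with
  | zero => rfl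
  | succ K ih =>
    have ih := ih fun c hc => h c (by omega)
    have hlt : argmin g K < K + 1 := by
      rcases Nat.eq_zero_or_pos K with rfl | h0
      · simp [argmin]
      · have := argmin_lt g h0
        omega
    rw [argmin, argmin, ih, h K (by omega), h _ hlt]

/-- Only the columns before `x` are read, so unfinished columns do not matter. The factor `2` in
`hW` allows for doubling a single weight. -/
theorem entryProg_spec {B : ℕ} {s : State} {n K L x r : ℕ} (hn : s.var 0 = n) (hK : s.var 7 = K)
    (hx : s.var 75 = x) (hr : s.var 18 = r) (hrow : s.var 19 = r * n) (hxn : x < n) (hrL : r < L)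
    (hK0 : 0 < K)
    (hT : ∀ y < x, s.arr 1 (r * n + y) = greedyTab K x r y)
    (hw : ∀ y < x, s.arr 6 y = greedyWeight K (greedyTab K x) x r y)
    (hW : 2 * ∑ y ∈ Finset.range x, greedyWeight K (greedyTab K x) x r y < B)
    (hB : L * n + n + K + L + 1 < B) :
    wp B entryProg s fun s' t => t ≤ 12 * K + 19 * n + 15 ∧ s'.var 18 = r + 1 ∧
      s'.var 19 = (r + 1) * n ∧
      (∀ i, s'.arr 1 i = if i = r * n + x then greedyColor K (greedyTab K x) x r else s.arr 1 i) ∧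
      ∀ y < x, s'.arr 6 y = greedyWeight K (greedyTab K x) x (r + 1) y := by
  have hrl := row_add_lt hrL hxn
  have hrl' : r * n + n ≤ L * n := by
    have := Nat.mul_le_mul_right n (show r + 1 ≤ L from hrL)
    rwa [add_mul, one_mul] at this
  have hsum : ∑ y ∈ Finset.range x, s.arr 6 y =
      ∑ y ∈ Finset.range x, greedyWeight K (greedyTab K x) x r y :=
    Finset.sum_congr rfl fun y hy => hw y (Finset.mem_range.1 hy)
  unfold entryProg
  rw [wp_seq]
  refine wp.call (clearProg_spec hK (by omega)) ?_
  rintro s₁ t₁ F1 ⟨ht1, h1⟩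
  rw [wp_seq]
  have hx1 : s₁.var 75 = x := by simpa [hx] using F1.var 75
  have hrow1 : s₁.var 19 = r * n := by simpa [hrow] using F1.var 19
  have ha1 : s₁.arr 1 = s.arr 1 := F1.arr 1
  have ha6 : s₁.arr 6 = s.arr 6 := F1.arr 6
  refine wp.call (addWeightsProg_spec hx1 hrow1 h1 (fun y hy => ?_) ?_ (by omega)) ?_
  · rw [ha1, hT y hy]
    exact greedyTab_lt hK0
  · rw [ha6, hsum]
    omega
  rintro s₂ t₂ F2 ⟨ht2, h2⟩
  rw [wp_seq]
  have hK2 : s₂.var 7 = K := by rw [F2.var 7, F1.var 7, hK]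
  refine wp.call (argminProg_spec hK2 (by omega)) ?_
  rintro s₃ t₃ F3 ⟨ht3, h3⟩
  have hcol : s₃.var 76 = greedyColor K (greedyTab K x) x r := by
    rw [h3, greedyColor]
    refine argmin_congr fun c hc => ?_
    rw [h2 c hc, ha1, ha6]
    exact colorSum_congr hT hw c
  have hx3 : s₃.var 75 = x := by rw [F3.var 75, F2.var 75, hx1]
  have hrow3 : s₃.var 19 = r * n := by rw [F3.var 19, F2.var 19, hrow1]
  have hb1 : s₃.arr 1 = s.arr 1 := by rw [F3.arr 1, F2.arr 1, ha1]
  have hb6 : s₃.arr 6 = s.arr 6 := by rw [F3.arr 6, F2.arr 6, ha6]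
  simp [hrow3, hx3, hcol]
  refine ⟨by omega, ?_⟩
  refine wp.call (doubleProg_spec (x := x) (row := r * n)
    (b := greedyColor K (greedyTab K x) x r) (by simpa using hx3) (by simpa using hrow3)
    (by simpa using hcol) (fun y hy => ?_) (by omega)) ?_
  · simp only [setArr_arr, setVar_arr, hb6]
    rw [if_neg (by omega)]
    have := Finset.single_le_sum (f := s.arr 6) (fun _ _ => Nat.zero_le _) (Finset.mem_range.2 hy)
    omega
  rintro s₄ t₄ F4 ⟨ht4, h4⟩
  have hn4 : s₄.var 0 = n := by
    rw [F4.var 0, setArr_var, setVar_var, if_neg (by omega), F3.var 0, F2.var 0, F1.var 0, hn]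
  have hr4 : s₄.var 18 = r := by
    rw [F4.var 18, setArr_var, setVar_var, if_neg (by omega), F3.var 18, F2.var 18, F1.var 18, hr]
  have hrow4 : s₄.var 19 = r * n := by
    rw [F4.var 19, setArr_var, setVar_var, if_neg (by omega), hrow3]
  have hd1 : s₄.arr 1 = _ := F4.arr 1
  simp [hn4, hr4, hrow4]
  and_intros
  · omega
  · omega
  · omega
  · ring
  · intro i
    rw [hd1]
    simp [hb1]
  · intro y hy
    rw [h4 y hy]
    simp [hb1, hb6, hy.ne, hT y hy, hw y hy]
    rw [greedyWeight]
    rfl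

/-- The weights of a column accumulate over its rows, so the table is filled column by column
although it is stored by rows. -/
theorem columnProg_spec {B : ℕ} {s : State} {n K L x : ℕ} (hn : s.var 0 = n) (hK : s.var 7 = K)
    (hL : s.var 8 = L) (hx : s.var 75 = x) (hxn : x < n) (hK0 : 0 < K)
    (hT : ∀ r < L, ∀ y < x, s.arr 1 (r * n + y) = greedyTab K x r y)
    (hW : ∀ r ≤ L, 2 * ∑ y ∈ Finset.range x, greedyWeight K (greedyTab K x) x r y < B)
    (hB : L * n + n + K + L + 1 < B) :
    wp B columnProg s fun s' t => t ≤ (12 * K + 19 * n + 16) * L + 4 * n + 6 ∧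
      ∀ r < L, ∀ y < x + 1, s'.arr 1 (r * n + y) = greedyTab K (x + 1) r y := by
  unfold columnProg
  rw [wp_seq]
  refine wp.call (onesProg_spec hx (by omega)) ?_
  rintro s₁ t₁ F1 ⟨ht1, h1⟩
  have hn1 : s₁.var 0 = n := by rw [F1.var 0, hn]
  have hK1 : s₁.var 7 = K := by rw [F1.var 7, hK]
  have hL1 : s₁.var 8 = L := by rw [F1.var 8, hL]
  have hx1 : s₁.var 75 = x := by rw [F1.var 75, hx]
  have ha1 : s₁.arr 1 = s.arr 1 := F1.arr 1
  simp only [wp_seq, wp_const]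
  refine ⟨by omega, by omega, wp.call (wp_loop
    (fun s' => s'.var 18 ≤ L ∧ s'.var 19 = s'.var 18 * n ∧
      (∀ r < L, ∀ y < x, s'.arr 1 (r * n + y) = greedyTab K x r y) ∧
      (∀ r < s'.var 18, s'.arr 1 (r * n + x) = greedyColor K (greedyTab K x) x r) ∧
      ∀ y < x, s'.arr 6 y = greedyWeight K (greedyTab K x) x (s'.var 18) y)
    (fun s' => L - s'.var 18) (12 * K + 19 * n + 15) ?_ ?_) ?_⟩
  · simp [ha1]
    exact ⟨hT, h1⟩
  · rintro s₂ F ⟨g1, g2, g3, g4, g5⟩ hb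
    have hn2 : s₂.var 0 = n := by simpa [hn1] using F.var 0
    have hK2 : s₂.var 7 = K := by simpa [hK1] using F.var 7
    have hL2 : s₂.var 8 = L := by simpa [hL1] using F.var 8
    have hx2 : s₂.var 75 = x := by simpa [hx1] using F.var 75
    simp only [Test.holds, hL2] at hb
    refine wp.call (entryProg_spec hn2 hK2 hx2 rfl g2 hxn hb hK0 (g3 _ hb) g5 (hW _ g1) hB) ?_
    rintro s₃ t₃ F3 ⟨k1, k2, k3, k4, k5⟩
    refine ⟨k1, ⟨by omega, by rw [k3, k2], fun r hr y hy => ?_, fun r hr => ?_, by rwa [k2]⟩,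
      by omega⟩
    · rw [k4, if_neg, g3 r hr y hy]
      rw [row_add_inj (by omega) hxn]
      omega
    · rw [k4]
      rw [k2] at hr
      rcases Nat.lt_succ_iff_lt_or_eq.1 hr with h | rfl
      · rw [if_neg, g4 r h]
        rw [row_add_inj hxn hxn]
        omega
      · rw [if_pos rfl]
  · rintro s₂ t F ⟨⟨g1, g2, g3, g4, g5⟩, hb, ht⟩
    have hL2 : s₂.var 8 = L := by simpa [hL1] using F.var 8
    simp [hL2] at hb ht
    refine ⟨by linarith, fun r hr y hy => ?_⟩
    rw [greedyTab]
    split_ifs with h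
    · rw [h]
      exact g4 r (by omega)
    · exact g3 r hr y (by omega)

/-- Choose the whole table greedily. -/
def greedyProg : Prog := .const 75 0 ;; .loop (.lt 75 0) (columnProg ;; inc 75)

theorem greedyProg_spec {B : ℕ} {s : State} {n K L : ℕ} (hn : s.var 0 = n) (hK : s.var 7 = K)
    (hL : s.var 8 = L) (hK0 : 0 < K)
    (hW : ∀ x < n, ∀ r ≤ L,
      2 * ∑ y ∈ Finset.range x, greedyWeight K (greedyTab K x) x r y < B)
    (hB : L * n + n + K + L + 1 < B) :
    wp B greedyProg s fun s' t => t ≤ ((12 * K + 19 * n + 16) * L + 4 * n + 9) * n + 2 ∧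
      ∀ r < L, ∀ y < n, s'.arr 1 (r * n + y) = greedyTab K n r y := by
  unfold greedyProg
  simp only [wp_seq, wp_const]
  refine ⟨by omega, wp.call (wp_loop
    (fun s' => s'.var 75 ≤ n ∧
      ∀ r < L, ∀ y < s'.var 75, s'.arr 1 (r * n + y) = greedyTab K (s'.var 75) r y)
    (fun s' => n - s'.var 75) ((12 * K + 19 * n + 16) * L + 4 * n + 8) ?_ ?_) ?_⟩
  · simp
  · rintro s₁ F ⟨h1, h2⟩ hb
    have hn1 : s₁.var 0 = n := by simpa [hn] using F.var 0
    have hK1 : s₁.var 7 = K := by simpa [hK] using F.var 7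
    have hL1 : s₁.var 8 = L := by simpa [hL] using F.var 8
    simp only [Test.holds, hn1] at hb
    rw [wp_seq]
    refine wp.call (columnProg_spec hn1 hK1 hL1 rfl hb hK0 h2 (hW _ hb) hB) ?_
    rintro s₂ t₂ F2 ⟨k1, k2⟩
    have hx2 : s₂.var 75 = s₁.var 75 := F2.var 75
    rw [wp_inc (by omega)]
    simp only [setVar_var, if_true, setVar_arr, hx2]
    exact ⟨by omega, by omega, ⟨by omega, k2⟩, by omega⟩
  · rintro s₁ t F ⟨⟨h1, h2⟩, hb, ht⟩
    have hn1 : s₁.var 0 = n := by simpa [hn] using F.var 0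
    simp [hn1] at hb ht
    rw [show s₁.var 75 = n by omega] at h2
    exact ⟨by linarith, h2⟩

/-- Compute the table of the hash functions for sets of variable `3` jobs. -/
def splitterProg : Prog := .const 77 3 ;; .cond (.lt 3 77) bitsProg greedyProg

/-- A bound for the number of steps of the computation of the splitter. -/
def splitterTime (n q l : ℕ) : ℕ :=
  if q < 3 then (9 * n + 8) * rows q l + 6
  else ((12 * q ^ 2 + 19 * n + 16) * rows q l + 4 * n + 9) * n + 4

/-- The bound `2 ^ (12 * l)` serves both constructions: for `q ≤ 2` there are at most `12 * l` rows,
and twice a total weight is below `2 * 64 ^ l ≤ 64 ^ l * 64 ^ l`. -/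
theorem splitterProg_spec {B : ℕ} {s : State} {n q l : ℕ} (hn : s.var 0 = n) (hq : s.var 3 = q)
    (hK : s.var 7 = q ^ 2) (hL : s.var 8 = rows q l) (hq0 : 0 < q) (hl : 0 < l) (hnl : n ≤ 2 ^ l)
    (hB1 : 2 ^ (12 * l) < B)
    (hB : rows q l * n + n + q ^ 2 + rows q l + 1 < B) (hB3 : 3 < B) :
    wp B splitterProg s fun s' t => t ≤ splitterTime n q l ∧
      ∀ r < rows q l, ∀ y < n, s'.arr 1 (r * n + y) = colorTable q n r y := by
  unfold splitterProg splitterTime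
  rw [wp_seq, wp_const, wp_cond]
  refine ⟨hB3, fun h => ?_, fun h => ?_⟩
  · simp [hq] at h
    refine wp.call (bitsProg_spec (n := n) (q := q) (L := rows q l) (by simpa using hn)
      (by simpa using hq) (by simpa using hL) (lt_of_le_of_lt ?_ hB1) (by omega)) ?_
    · refine Nat.pow_le_pow_right (by norm_num) ?_
      unfold rows
      have : q ^ 2 ≤ 2 ^ 2 := Nat.pow_le_pow_left (by omega) 2
      nlinarith
    · rintro s' t F ⟨h1, h2⟩
      rw [if_pos h]
      refine ⟨by omega, fun r hr y hy => ?_⟩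
      rw [h2 r hr y hy, colorTable, if_pos h]
  · simp [hq] at h
    refine wp.call (greedyProg_spec (n := n) (K := q ^ 2) (L := rows q l) (by simpa using hn)
      (by simpa using hK) (by simpa using hL) (by positivity) (fun x hx r hr => ?_) (by omega)) ?_
    · have := sum_greedyWeight_lt (greedyTab (q ^ 2) x) (by positivity : 0 < q ^ 2) hl
        (hx.le.trans hnl) hr
      have e : (2 : ℕ) ^ (12 * l) = 64 ^ l * 64 ^ l := by
        rw [pow_mul, ← mul_pow]
        norm_num
      have h64 : 64 ^ 1 ≤ 64 ^ l := Nat.pow_le_pow_right (by norm_num) hl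
      rw [e] at hB1
      nlinarith
    · rintro s' t F ⟨h1, h2⟩
      rw [if_neg (by omega)]
      refine ⟨by omega, fun r hr y hy => ?_⟩
      rw [h2 r hr y hy, colorTable, if_neg (by omega)]


/-! ### One pass of the search -/

/-- Record the codes in the variables `53` and `54` as a hit, and end the pass. -/
def hitProg : Prog :=
  .const 2 1 ;; mov 12 53 ;; mov 13 54 ;; mov 14 5 ;; mov 15 6 ;; mov 50 10

/-- One step of the search with two pointers. -/
def pairStep : Prog :=
  .cond (.lt 55 51) (
    .const 99 1 ;; .op .sub 52 51 99 ;; .load 53 2 50 ;; .load 54 4 52 ;;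
    mov 30 53 ;; mov 31 5 ;; .const 32 0 ;; validProg ;;
    .cond (.lt 55 38) (
      mov 30 54 ;; mov 31 6 ;; .const 32 1 ;; validProg ;;
      .cond (.lt 55 38) (
        .numCopy 8 55 4 53 ;; .numAdd 8 55 5 54 ;;
        .cond (.numLt 6 55 8 55) (.cond (.numLt 8 55 7 55) hitProg (mov 51 52)) (inc 50))
      (mov 51 52)) (inc 50))
  (mov 50 10)

/-- Search the sorted arrays `2` and `4` of codes for a hit in the current division. -/
def pairProg : Prog :=
  .const 50 0 ;; mov 51 11 ;; .const 55 0 ;; .loop (.lt 50 10) pairStep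

/-- The codes `e₁`, `e₂` are a hit for the table, colors, values and gap stored in `s`. -/
structure StateHit (s : State) (n m₁ m₂ row e₁ e₂ : ℕ) : Prop where
  valid₁ : ValidCode n m₁ (fun g => s.arr 5 (s.arr 1 (row + g)) = 0) e₁
  valid₂ : ValidCode n m₂ (fun g => s.arr 5 (s.arr 1 (row + g)) = 1) e₂
  pos : 0 < s.num 4 e₁ + s.num 5 e₂
  lt : s.num 4 e₁ + s.num 5 e₂ < s.num 7 0

/-- The state holds the record of the codes `e₁`, `e₂` of `m₁`- and `m₂`-tuples. -/
structure Recorded (s : State) (b m₁ m₂ e₁ e₂ : ℕ) : Prop where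
  flag : s.var 2 = b
  code₁ : s.var 12 = e₁
  code₂ : s.var 13 = e₂
  len₁ : s.var 14 = m₁
  len₂ : s.var 15 = m₂

/-- The data of a pass of the search. -/
structure PassData (B : ℕ) (s : State) (n m₁ m₂ N₁ N₂ row : ℕ) : Prop where
  n_eq : s.var 0 = n
  m₁_eq : s.var 5 = m₁
  m₂_eq : s.var 6 = m₂
  N₁_eq : s.var 10 = N₁
  N₂_eq : s.var 11 = N₂
  row_eq : s.var 19 = row
  zero : s.num 6 0 = 0
  sorted₁ : ∀ i j, i < j → j < N₁ → s.num 4 (s.arr 2 i) ≤ s.num 4 (s.arr 2 j)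
  sorted₂ : ∀ i j, i < j → j < N₂ → s.num 5 (s.arr 4 i) ≤ s.num 5 (s.arr 4 j)
  lt₁ : ∀ i < N₁, s.arr 2 i < N₁
  lt₂ : ∀ i < N₂, s.arr 4 i < N₂
  n_pos : 0 < n
  bound : N₁ + N₂ + m₁ + m₂ + row + n + 1 < B

/-- The invariant of a pass: the pointers are `i` and `j`. -/
def PairInv (s₀ : State) (n m₁ m₂ N₁ N₂ row : ℕ) (s : State) : Prop :=
  (s.var 50 ≤ N₁ ∧ s.var 51 ≤ N₂ ∧
    Recorded s (s₀.var 2) (s₀.var 14) (s₀.var 15) (s₀.var 12) (s₀.var 13) ∧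
    ∀ i < N₁, ∀ j < N₂, i < s.var 50 ∨ s.var 51 ≤ j →
      ¬ StateHit s₀ n m₁ m₂ row (s₀.arr 2 i) (s₀.arr 4 j)) ∨
  (s.var 50 = N₁ ∧ ∃ i < N₁, ∃ j < N₂,
    StateHit s₀ n m₁ m₂ row (s₀.arr 2 i) (s₀.arr 4 j) ∧
    Recorded s 1 m₁ m₂ (s₀.arr 2 i) (s₀.arr 4 j))

theorem le_of_sorted {f : ℕ → ℝ} {N i j : ℕ} (h : ∀ i j, i < j → j < N → f i ≤ f j)
    (hij : i ≤ j) (hj : j < N) : f i ≤ f j := by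
  rcases Nat.lt_or_eq_of_le hij with hlt | rfl
  · exact h i j hlt hj
  · exact le_rfl

/-- The pointer `j` is exclusive, so the pair under test is `(i, j - 1)`. If its sum is not
positive, neither is that of `(i, j')` for `j' < j`, and `i` moves up; if its sum is at least `Δ`,
so is that of `(i', j - 1)` for `i' ≥ i`, and `j` moves down. An invalid code rules out all its
pairs at once. -/
theorem pairStep_spec {B : ℕ} {s₀ s : State} {n m₁ m₂ N₁ N₂ row : ℕ}
    (D : PassData B s₀ n m₁ m₂ N₁ N₂ row) (F : Frame pairStep s₀ s)
    (hI : PairInv s₀ n m₁ m₂ N₁ N₂ row s) (hi : s.var 50 < N₁) (h55 : s.var 55 = 0) :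
    wp B pairStep s fun s' t => t ≤ 21 * m₁ + 21 * m₂ + 50 ∧ s'.var 55 = 0 ∧
      PairInv s₀ n m₁ m₂ N₁ N₂ row s' ∧
      N₁ - s'.var 50 + s'.var 51 < N₁ - s.var 50 + s.var 51 := by
  have hB := D.bound
  have hn : s.var 0 = n := by rw [F.var 0, D.n_eq]
  have hm1 : s.var 5 = m₁ := by rw [F.var 5, D.m₁_eq]
  have hm2 : s.var 6 = m₂ := by rw [F.var 6, D.m₂_eq]
  have hN1 : s.var 10 = N₁ := by rw [F.var 10, D.N₁_eq]
  have hrow : s.var 19 = row := by rw [F.var 19, D.row_eq]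
  have ha1 : s.arr 1 = s₀.arr 1 := F.arr 1
  have ha2 : s.arr 2 = s₀.arr 2 := F.arr 2
  have ha4 : s.arr 4 = s₀.arr 4 := F.arr 4
  have ha5 : s.arr 5 = s₀.arr 5 := F.arr 5
  have hv4 : s.num 4 = s₀.num 4 := F.num 4
  have hv5 : s.num 5 = s₀.num 5 := F.num 5
  have hv6 : s.num 6 = s₀.num 6 := F.num 6
  have hv7 : s.num 7 = s₀.num 7 := F.num 7
  -- After a recorded hit `i` equals `N₁`, and the loop has ended.
  rcases hI with ⟨g1, g2, g3, g4⟩ | ⟨g1, -⟩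
  swap
  · omega
  obtain ⟨r1, r2, r3, r4, r5⟩ := g3
  have hstep : ∀ i' j' : ℕ, i' ≤ N₁ → j' ≤ N₂ →
      (∀ i < N₁, ∀ j < N₂, (s.var 50 ≤ i ∧ j < s.var 51) → i < i' ∨ j' ≤ j →
        ¬ StateHit s₀ n m₁ m₂ row (s₀.arr 2 i) (s₀.arr 4 j)) →
      ∀ i < N₁, ∀ j < N₂, i < i' ∨ j' ≤ j →
        ¬ StateHit s₀ n m₁ m₂ row (s₀.arr 2 i) (s₀.arr 4 j) := by
    intro i' j' h1 h2 h i hi j hj hij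
    by_cases hc : i < s.var 50 ∨ s.var 51 ≤ j
    · exact g4 i hi j hj hc
    · exact h i hi j hj (by omega) hij
  have hinc : (∀ j < s.var 51, ¬ StateHit s₀ n m₁ m₂ row (s₀.arr 2 (s.var 50)) (s₀.arr 4 j)) →
      ∀ i < N₁, ∀ j < N₂, i < s.var 50 + 1 ∨ s.var 51 ≤ j →
        ¬ StateHit s₀ n m₁ m₂ row (s₀.arr 2 i) (s₀.arr 4 j) := by
    intro h
    refine hstep _ _ hi g2 fun i _ j _ hij hor => ?_
    obtain rfl : i = s.var 50 := by omega
    exact h j hij.2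
  have hdec : (∀ i, s.var 50 ≤ i → i < N₁ →
      ¬ StateHit s₀ n m₁ m₂ row (s₀.arr 2 i) (s₀.arr 4 (s.var 51 - 1))) →
      ∀ i < N₁, ∀ j < N₂, i < s.var 50 ∨ s.var 51 - 1 ≤ j →
        ¬ StateHit s₀ n m₁ m₂ row (s₀.arr 2 i) (s₀.arr 4 j) := by
    intro h
    refine hstep _ _ g1 (by omega) fun i hi j _ hij hor => ?_
    obtain rfl : j = s.var 51 - 1 := by omega
    exact h i hij.1 hi
  have finInc : ∀ s' : State, s'.var 50 = s.var 50 + 1 → s'.var 51 = s.var 51 →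
      s'.var 2 = s.var 2 → s'.var 12 = s.var 12 → s'.var 13 = s.var 13 →
      s'.var 14 = s.var 14 → s'.var 15 = s.var 15 →
      (∀ j < s.var 51, ¬ StateHit s₀ n m₁ m₂ row (s₀.arr 2 (s.var 50)) (s₀.arr 4 j)) →
      PairInv s₀ n m₁ m₂ N₁ N₂ row s' := by
    intro s' e1 e2 e3 e4 e5 e6 e7 h
    refine Or.inl ⟨by omega, by omega, ⟨by rw [e3, r1], by rw [e4, r2], by rw [e5, r3],
      by rw [e6, r4], by rw [e7, r5]⟩, ?_⟩
    rw [e1, e2]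
    exact hinc h
  have finDec : ∀ s' : State, s'.var 50 = s.var 50 → s'.var 51 = s.var 51 - 1 →
      s'.var 2 = s.var 2 → s'.var 12 = s.var 12 → s'.var 13 = s.var 13 →
      s'.var 14 = s.var 14 → s'.var 15 = s.var 15 →
      (∀ i, s.var 50 ≤ i → i < N₁ →
        ¬ StateHit s₀ n m₁ m₂ row (s₀.arr 2 i) (s₀.arr 4 (s.var 51 - 1))) →
      PairInv s₀ n m₁ m₂ N₁ N₂ row s' := by
    intro s' e1 e2 e3 e4 e5 e6 e7 h
    refine Or.inl ⟨by omega, by omega, ⟨by rw [e3, r1], by rw [e4, r2], by rw [e5, r3],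
      by rw [e6, r4], by rw [e7, r5]⟩, ?_⟩
    rw [e1, e2]
    exact hdec h
  unfold pairStep
  rw [wp_cond]
  refine ⟨fun hj => ?_, fun hj => ?_⟩
  · simp [h55] at hj
    have he1 := D.lt₁ _ hi
    have he2 := D.lt₂ (s.var 51 - 1) (by omega)
    simp [ha2, ha4, hm1]
    and_intros
    · omega
    · omega
    · omega
    · omega
    · omega
    refine wp.call (validProg_spec (n := n) (m := m₁) (e := s₀.arr 2 (s.var 50)) (z := 0)
      (row := row) (by simpa using hn) (by simp) (by simp) (by simp) (by simpa using hrow)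
      (by omega) (by omega) (by omega) D.n_pos) ?_
    rintro s₁ t₁ F1 ⟨ht1, hv1⟩
    simp only [setVar_arr, ha5, ha1] at hv1
    have q51 : s₁.var 51 = s.var 51 := by simpa using F1.var 51
    have q50 : s₁.var 50 = s.var 50 := by simpa using F1.var 50
    have q52 : s₁.var 52 = s.var 51 - 1 := by simpa using F1.var 52
    have q53 : s₁.var 53 = s₀.arr 2 (s.var 50) := by simpa [ha2] using F1.var 53
    have q54 : s₁.var 54 = s₀.arr 4 (s.var 51 - 1) := by simpa [ha4] using F1.var 54
    have q55 : s₁.var 55 = 0 := by simpa [h55] using F1.var 55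
    have q2 : s₁.var 2 = s.var 2 := by simpa using F1.var 2
    have q12 : s₁.var 12 = s.var 12 := by simpa using F1.var 12
    have q13 : s₁.var 13 = s.var 13 := by simpa using F1.var 13
    have q14 : s₁.var 14 = s.var 14 := by simpa using F1.var 14
    have q15 : s₁.var 15 = s.var 15 := by simpa using F1.var 15
    have q5 : s₁.var 5 = m₁ := by simpa [hm1] using F1.var 5
    have q6 : s₁.var 6 = m₂ := by simpa [hm2] using F1.var 6
    have q0 : s₁.var 0 = n := by simpa [hn] using F1.var 0
    have q10 : s₁.var 10 = N₁ := by simpa [hN1] using F1.var 10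
    have q19 : s₁.var 19 = row := by simpa [hrow] using F1.var 19
    have a1 : s₁.arr 1 = s₀.arr 1 := by simpa [ha1] using F1.arr 1
    have a5 : s₁.arr 5 = s₀.arr 5 := by simpa [ha5] using F1.arr 5
    have v4 : s₁.num 4 = s₀.num 4 := by simpa [hv4] using F1.num 4
    have v5 : s₁.num 5 = s₀.num 5 := by simpa [hv5] using F1.num 5
    have v6 : s₁.num 6 = s₀.num 6 := by simpa [hv6] using F1.num 6
    have v7 : s₁.num 7 = s₀.num 7 := by simpa [hv7] using F1.num 7
    simp only [q55, q54, q6, q50]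
    refine ⟨fun hok => ?_, fun hok => ?_⟩
    · and_intros
      · omega
      · omega
      · omega
      refine wp.call (validProg_spec (n := n) (m := m₂) (e := s₀.arr 4 (s.var 51 - 1)) (z := 1)
        (row := row) (by simpa using q0) (by simp) (by simp) (by simp) (by simpa using q19)
        (by omega) (by omega) (by omega) D.n_pos) ?_
      rintro s₂ t₂ F2 ⟨ht2, hv2⟩
      simp only [setVar_arr, a5, a1] at hv2
      have p51 : s₂.var 51 = s.var 51 := by simpa [q51] using F2.var 51
      have p50 : s₂.var 50 = s.var 50 := by simpa [q50] using F2.var 50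
      have p52 : s₂.var 52 = s.var 51 - 1 := by simpa [q52] using F2.var 52
      have p53 : s₂.var 53 = s₀.arr 2 (s.var 50) := by simpa [q53] using F2.var 53
      have p54 : s₂.var 54 = s₀.arr 4 (s.var 51 - 1) := by simpa [q54] using F2.var 54
      have p55 : s₂.var 55 = 0 := by simpa [q55] using F2.var 55
      have p2 : s₂.var 2 = s.var 2 := by simpa [q2] using F2.var 2
      have p12 : s₂.var 12 = s.var 12 := by simpa [q12] using F2.var 12
      have p13 : s₂.var 13 = s.var 13 := by simpa [q13] using F2.var 13
      have p14 : s₂.var 14 = s.var 14 := by simpa [q14] using F2.var 14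
      have p15 : s₂.var 15 = s.var 15 := by simpa [q15] using F2.var 15
      have p5 : s₂.var 5 = m₁ := by simpa [q5] using F2.var 5
      have p6 : s₂.var 6 = m₂ := by simpa [q6] using F2.var 6
      have p10 : s₂.var 10 = N₁ := by simpa [q10] using F2.var 10
      have w4 : s₂.num 4 = s₀.num 4 := by simpa [v4] using F2.num 4
      have w5 : s₂.num 5 = s₀.num 5 := by simpa [v5] using F2.num 5
      have w6 : s₂.num 6 = s₀.num 6 := by simpa [v6] using F2.num 6
      have w7 : s₂.num 7 = s₀.num 7 := by simpa [v7] using F2.num 7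
      simp only [p55]
      refine ⟨fun hok2 => ?_, fun hok2 => ?_⟩
      · simp [p53, p54, w4, w5, w6, w7, D.zero]
        refine ⟨fun hpos => ⟨fun hlt => ?_, fun hge => ?_⟩, fun hneg => ?_⟩
        · unfold hitProg
          simp [p53, p54, p5, p6, p10]
          and_intros
          · omega
          · omega
          · omega
          · omega
          · omega
          · omega
          · omega
          · exact p55
          · refine Or.inr ⟨by simp, s.var 50, hi, s.var 51 - 1, by omega,
              ⟨hv1.1 hok, hv2.1 hok2, hpos, hlt⟩, ?_⟩
            constructor <;> simp
          · simp [p51]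
            omega
        · simp [p50, p52]
          refine ⟨by omega, by omega, finDec _ (by simpa using p50) (by simp) (by simpa using p2)
            (by simpa using p12) (by simpa using p13) (by simpa using p14) (by simpa using p15)
            fun i hi1 hi2 hh => ?_, by omega⟩
          have h1 := hh.lt
          have h2 := le_of_sorted (f := fun i => s₀.num 4 (s₀.arr 2 i)) D.sorted₁ hi1 hi2
          linarith
        · simp [p50, p51]
          refine ⟨by omega, by omega, finInc _ (by simp) (by simpa using p51) (by simpa using p2)
            (by simpa using p12) (by simpa using p13) (by simpa using p14) (by simpa using p15)
            fun j hj1 hh => ?_, by omega⟩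
          have h1 := hh.pos
          have h2 := le_of_sorted (f := fun j => s₀.num 5 (s₀.arr 4 j)) (i := j) D.sorted₂
            (show j ≤ s.var 51 - 1 by omega) (by omega)
          linarith
      · simp [p50, p52]
        exact ⟨by omega, by omega, finDec _ (by simpa using p50) (by simp) (by simpa using p2)
          (by simpa using p12) (by simpa using p13) (by simpa using p14) (by simpa using p15)
          fun i _ _ hh => not_lt.2 hok2 (hv2.2 hh.valid₂), by omega⟩
    · simp [q51]
      exact ⟨by omega, by omega, finInc _ (by simp) (by simpa using q51) (by simpa using q2)
        (by simpa using q12) (by simpa using q13) (by simpa using q14) (by simpa using q15)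
        fun j _ hh => not_lt.2 hok (hv1.2 hh.valid₁), by omega⟩
  -- Here `j = 0`: every pair is excluded, and setting `i` to `N₁` ends the pass.
  · simp [h55] at hj
    simp [hN1, h55]
    refine ⟨by omega, Or.inl ⟨by simp, by simpa using g2, ?_, fun i hi j hj' _ => ?_⟩, by omega⟩
    · constructor <;> simp [r1, r2, r3, r4, r5]
    · exact g4 i hi j hj' (Or.inr (by omega))

theorem pairProg_spec {B : ℕ} {s : State} {n m₁ m₂ N₁ N₂ row : ℕ}
    (D : PassData B s n m₁ m₂ N₁ N₂ row) :
    wp B pairProg s fun s' t => t ≤ (21 * m₁ + 21 * m₂ + 51) * (N₁ + N₂) + 5 ∧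
      ((Recorded s' (s.var 2) (s.var 14) (s.var 15) (s.var 12) (s.var 13) ∧
        ∀ i < N₁, ∀ j < N₂, ¬ StateHit s n m₁ m₂ row (s.arr 2 i) (s.arr 4 j)) ∨
      (∃ i < N₁, ∃ j < N₂, StateHit s n m₁ m₂ row (s.arr 2 i) (s.arr 4 j) ∧
        Recorded s' 1 m₁ m₂ (s.arr 2 i) (s.arr 4 j))) := by
  have hB := D.bound
  -- A hit depends on the arrays alone, which the initial assignments do not touch.
  have hs : ∀ e₁ e₂, StateHit (setVar (setVar (setVar (setVar s 50 0) 99 0) 51 N₂) 55 0) n m₁ m₂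
      row e₁ e₂ ↔ StateHit s n m₁ m₂ row e₁ e₂ :=
    fun e₁ e₂ => ⟨fun h => ⟨h.1, h.2, h.3, h.4⟩, fun h => ⟨h.1, h.2, h.3, h.4⟩⟩
  unfold pairProg
  simp [D.N₂_eq]
  refine ⟨by omega, by omega, by omega, wp.call (wp_loop
    (fun s' => s'.var 55 = 0 ∧
      PairInv (setVar (setVar (setVar (setVar s 50 0) 99 0) 51 N₂) 55 0) n m₁ m₂ N₁ N₂ row s')
    (fun s' => N₁ - s'.var 50 + s'.var 51) (21 * m₁ + 21 * m₂ + 50) ?_ ?_) ?_⟩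
  · refine ⟨by simp, Or.inl ⟨by simp, by simp, ?_, fun i _ j hj h => ?_⟩⟩
    · constructor <;> simp
    · simp at h
      omega
  · rintro s₁ F ⟨h1, h2⟩ hb
    have hN1 : s₁.var 10 = N₁ := by simpa [D.N₁_eq] using F.var 10
    simp only [Test.holds, hN1] at hb
    refine wp.call (pairStep_spec ?_ F h2 hb h1) fun s' t _ h =>
      ⟨h.1, ⟨h.2.1, h.2.2.1⟩, h.2.2.2⟩
    exact ⟨by simpa using D.n_eq, by simpa using D.m₁_eq, by simpa using D.m₂_eq,
      by simpa using D.N₁_eq, by simpa using D.N₂_eq, by simpa using D.row_eq, D.zero, D.sorted₁,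
      D.sorted₂, D.lt₁, D.lt₂, D.n_pos, D.bound⟩
  · rintro s₁ t F ⟨⟨-, hI⟩, hb, ht⟩
    have hN1 : s₁.var 10 = N₁ := by simpa [D.N₁_eq] using F.var 10
    simp [hN1] at hb ht
    refine ⟨by linarith, ?_⟩
    rcases hI with ⟨g1, g2, g3, g4⟩ | ⟨g1, i, hi, j, hj, g2, g3⟩
    · refine Or.inl ⟨by simpa using g3, fun i hi j hj h => ?_⟩
      exact g4 i hi j hj (Or.inl (by omega)) ((hs _ _).2 h)
    · exact Or.inr ⟨i, hi, j, hj, (hs _ _).1 g2, g3⟩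


/-! ### The search for swaps of a fixed number of jobs -/

/-- The data of the search for swaps of `q` jobs: the table of hash functions and the sorted
arrays of codes. -/
structure SearchData (B : ℕ) (v : ℕ → ℝ) (Δ : ℝ) (n q l : ℕ) (s : State) : Prop where
  n_eq : s.var 0 = n
  m₁_eq : s.var 5 = (q + 1) / 2
  m₂_eq : s.var 6 = q / 2
  K_eq : s.var 7 = q ^ 2
  L_eq : s.var 8 = rows q l
  N₁_eq : s.var 10 = n ^ ((q + 1) / 2)
  N₂_eq : s.var 11 = n ^ (q / 2)
  zero : s.num 6 0 = 0
  gap_eq : s.num 7 0 = Δ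
  table : ∀ r < rows q l, ∀ y < n, s.arr 1 (r * n + y) = colorTable q n r y
  sorted₁ : ∀ i j, i < j → j < n ^ ((q + 1) / 2) → s.num 4 (s.arr 2 i) ≤ s.num 4 (s.arr 2 j)
  sorted₂ : ∀ i j, i < j → j < n ^ (q / 2) → s.num 5 (s.arr 4 i) ≤ s.num 5 (s.arr 4 j)
  lt₁ : ∀ i < n ^ ((q + 1) / 2), s.arr 2 i < n ^ ((q + 1) / 2)
  lt₂ : ∀ i < n ^ (q / 2), s.arr 4 i < n ^ (q / 2)
  occ₁ : ∀ e < n ^ ((q + 1) / 2), ∃ i < n ^ ((q + 1) / 2), s.arr 2 i = e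
  occ₂ : ∀ e < n ^ (q / 2), ∃ i < n ^ (q / 2), s.arr 4 i = e
  val₁ : ∀ e < n ^ ((q + 1) / 2), s.num 4 e = codeVal v n ((q + 1) / 2) e
  val₂ : ∀ e < n ^ (q / 2), s.num 5 e = codeVal v n (q / 2) e
  n_pos : 0 < n
  q_pos : 0 < q
  bound : n ^ ((q + 1) / 2) + n ^ (q / 2) + q + rows q l * n + n + rows q l + 3 * q ^ 2 + 5 < B

theorem SearchData.of_eq {B : ℕ} {v : ℕ → ℝ} {Δ : ℝ} {n q l : ℕ} {s s' : State}
    (D : SearchData B v Δ n q l s)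
    (hv : ∀ x ∈ [0, 5, 6, 7, 8, 10, 11], s'.var x = s.var x)
    (ha : ∀ a ∈ [1, 2, 4], s'.arr a = s.arr a) (hu : ∀ u ∈ [4, 5, 6, 7], s'.num u = s.num u) :
    SearchData B v Δ n q l s' := by
  have a1 := ha 1 (by simp)
  have a2 := ha 2 (by simp)
  have a4 := ha 4 (by simp)
  have u4 := hu 4 (by simp)
  have u5 := hu 5 (by simp)
  have u6 := hu 6 (by simp)
  have u7 := hu 7 (by simp)
  obtain ⟨h1, h2, h3, h4, h5, h6, h7, h8, h9, h10, h11, h12, h13, h14, h15, h16, h17, h18, h19,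
    h20, h21⟩ := D
  refine ⟨by rw [hv 0 (by simp), h1], by rw [hv 5 (by simp), h2], by rw [hv 6 (by simp), h3],
    by rw [hv 7 (by simp), h4], by rw [hv 8 (by simp), h5], by rw [hv 10 (by simp), h6],
    by rw [hv 11 (by simp), h7], by rwa [u6], by rwa [u7], by rwa [a1], by rwa [u4, a2],
    by rwa [u5, a4], by rwa [a2], by rwa [a4], by rwa [a2], by rwa [a4], by rwa [u4],
    by rwa [u5], h19, h20, h21⟩

theorem SearchData.setVar {B : ℕ} {v : ℕ → ℝ} {Δ : ℝ} {n q l : ℕ} {s : State}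
    (D : SearchData B v Δ n q l s) (x y : ℕ) (hx : x ∉ [0, 5, 6, 7, 8, 10, 11] := by decide) :
    SearchData B v Δ n q l (setVar s x y) :=
  D.of_eq (fun z hz => by
    rw [setVar_var, if_neg]
    rintro rfl
    exact hx hz) (fun _ _ => rfl) fun _ _ => rfl

theorem SearchData.of_frame {B : ℕ} {v : ℕ → ℝ} {Δ : ℝ} {n q l : ℕ} {P : Prog} {s s' : State}
    (D : SearchData B v Δ n q l s) (F : Frame P s s')
    (hv : ∀ x ∈ [0, 5, 6, 7, 8, 10, 11], P.wv x = false := by decide)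
    (ha : ∀ a ∈ [1, 2, 4], P.wa a = false := by decide)
    (hu : ∀ u ∈ [4, 5, 6, 7], P.wn u = false := by decide) : SearchData B v Δ n q l s' :=
  D.of_eq (fun x hx => F.var x (hv x hx)) (fun a h => F.arr a (ha a h)) fun u h =>
    F.num u (hu u h)

theorem digit_lt {n e t : ℕ} (hn : 0 < n) : digit n e t < n := Nat.mod_lt _ hn

theorem validCode_congr {n m e : ℕ} {P P' : ℕ → Prop} (hn : 0 < n) (h : ∀ g < n, P g ↔ P' g) :
    ValidCode n m P e ↔ ValidCode n m P' e := by
  unfold ValidCode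
  refine and_congr_right fun _ => forall₂_congr fun t _ => h _ (digit_lt hn)

/-- The hash table in array `1` followed by the colors in array `5` is `jobColor`. -/
theorem SearchData.stateHit_iff {B : ℕ} {v : ℕ → ℝ} {Δ : ℝ} {n q l i r e₁ e₂ : ℕ} {s : State}
    (D : SearchData B v Δ n q l s) (hc : ∀ c < q ^ 2, s.arr 5 c = recolor (q ^ 2) i c)
    (hr : r < rows q l) (h₁ : e₁ < n ^ ((q + 1) / 2)) (h₂ : e₂ < n ^ (q / 2)) :
    StateHit s n ((q + 1) / 2) (q / 2) (r * n) e₁ e₂ ↔ CodeHit v Δ n q i r e₁ e₂ := by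
  have hcol : ∀ g < n, s.arr 5 (s.arr 1 (r * n + g)) = jobColor q n i r g := by
    intro g hg
    rw [D.table r hr g hg, hc _ (colorTable_lt D.q_pos), jobColor]
  have e1 := D.val₁ e₁ h₁
  have e2 := D.val₂ e₂ h₂
  constructor
  · rintro ⟨a1, a2, a3, a4⟩
    rw [e1, e2] at a3 a4
    rw [D.gap_eq] at a4
    exact ⟨(validCode_congr D.n_pos fun g hg => by rw [hcol g hg]).1 a1,
      (validCode_congr D.n_pos fun g hg => by rw [hcol g hg]).1 a2, a3, a4⟩
  · rintro ⟨a1, a2, a3, a4⟩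
    rw [← e1, ← e2] at a3 a4
    rw [← D.gap_eq] at a4
    exact ⟨(validCode_congr D.n_pos fun g hg => by rw [hcol g hg]).2 a1,
      (validCode_congr D.n_pos fun g hg => by rw [hcol g hg]).2 a2, a3, a4⟩

/-- Either no hit is recorded, and the divisions in `Done` have none, or a hit for a division in
`Good` is recorded. -/
def Status (v : ℕ → ℝ) (Δ : ℝ) (n : ℕ) (Good Done : ℕ → ℕ → ℕ → Prop) (s : State) : Prop :=
  (Recorded s 0 0 0 0 0 ∧ ∀ q i r, Done q i r → ∀ e₁ < n ^ ((q + 1) / 2), ∀ e₂ < n ^ (q / 2),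
    ¬ CodeHit v Δ n q i r e₁ e₂) ∨
  ∃ q i r, Good q i r ∧ ∃ e₁ < n ^ ((q + 1) / 2), ∃ e₂ < n ^ (q / 2),
    CodeHit v Δ n q i r e₁ e₂ ∧ Recorded s 1 ((q + 1) / 2) (q / 2) e₁ e₂

/-- A record persists as long as its five variables do, and claiming fewer finished divisions only
weakens the status. -/
theorem Status.mono {v : ℕ → ℝ} {Δ : ℝ} {n : ℕ} {Good Done Done' : ℕ → ℕ → ℕ → Prop}
    {s s' : State} (h : Status v Δ n Good Done s) (hD : ∀ q i r, Done' q i r → Done q i r)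
    (hs : Recorded s' (s.var 2) (s.var 14) (s.var 15) (s.var 12) (s.var 13)) :
    Status v Δ n Good Done' s' := by
  obtain ⟨a1, a2, a3, a4, a5⟩ := hs
  rcases h with ⟨⟨b1, b2, b3, b4, b5⟩, h⟩ | ⟨q, i, r, hg, e₁, h₁, e₂, h₂, h, ⟨b1, b2, b3, b4, b5⟩⟩
  · exact Or.inl ⟨⟨by rw [a1, b1], by rw [a2, b2], by rw [a3, b3], by rw [a4, b4], by rw [a5, b5]⟩,
      fun q i r hd => h q i r (hD q i r hd)⟩
  · exact Or.inr ⟨q, i, r, hg, e₁, h₁, e₂, h₂, h,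
      ⟨by rw [a1, b1], by rw [a2, b2], by rw [a3, b3], by rw [a4, b4], by rw [a5, b5]⟩⟩

theorem Status.setVar {v : ℕ → ℝ} {Δ : ℝ} {n : ℕ} {Good Done Done' : ℕ → ℕ → ℕ → Prop}
    {s : State} (h : Status v Δ n Good Done s) (hD : ∀ q i r, Done' q i r → Done q i r)
    (x y : ℕ) (hx : x ∉ [2, 12, 13, 14, 15] := by decide) :
    Status v Δ n Good Done' (setVar s x y) := by
  simp only [List.mem_cons, List.not_mem_nil, or_false, not_or] at hx
  obtain ⟨h1, h2, h3, h4, h5⟩ := hx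
  refine h.mono hD ?_
  constructor <;> simp [Ne.symm h1, Ne.symm h2, Ne.symm h3, Ne.symm h4, Ne.symm h5]

theorem Status.of_frame {v : ℕ → ℝ} {Δ : ℝ} {n : ℕ} {Good Done Done' : ℕ → ℕ → ℕ → Prop}
    {P : Prog} {s s' : State} (h : Status v Δ n Good Done s) (F : Frame P s s')
    (hD : ∀ q i r, Done' q i r → Done q i r)
    (hv : ∀ x ∈ [2, 12, 13, 14, 15], P.wv x = false := by decide) :
    Status v Δ n Good Done' s' :=
  h.mono hD ⟨F.var 2 (hv 2 (by simp)), F.var 12 (hv 12 (by simp)), F.var 13 (hv 13 (by simp)),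
    F.var 14 (hv 14 (by simp)), F.var 15 (hv 15 (by simp))⟩

/-- A bound for the number of steps of one pass. -/
def passTime (n q : ℕ) : ℕ :=
  (21 * ((q + 1) / 2) + 21 * (q / 2) + 51) * (n ^ ((q + 1) / 2) + n ^ (q / 2)) + 5

/-- An unsuccessful pass leaves an earlier record intact, a successful one overwrites it. As the
sorted arrays contain every code, the absence of hits among positions means their absence among
codes. -/
theorem SearchData.pairProg_spec {B : ℕ} {v : ℕ → ℝ} {Δ : ℝ} {n q l i r : ℕ} {s : State}
    {Good Done : ℕ → ℕ → ℕ → Prop} (D : SearchData B v Δ n q l s)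
    (hc : ∀ c < q ^ 2, s.arr 5 c = recolor (q ^ 2) i c) (hr : r < rows q l)
    (hrow : s.var 19 = r * n) (hg : Good q i r) (hS : Status v Δ n Good Done s) :
    wp B pairProg s fun s' t => t ≤ passTime n q ∧
      Status v Δ n Good (fun q' i' r' => Done q' i' r' ∨ (q' = q ∧ i' = i ∧ r' = r)) s' := by
  have hB := D.bound
  have hrl := row_add_lt hr D.n_pos
  refine wp.call (KSwap.pairProg_spec (n := n) (m₁ := (q + 1) / 2) (m₂ := q / 2)
    (N₁ := n ^ ((q + 1) / 2)) (N₂ := n ^ (q / 2)) (row := r * n)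
    ⟨D.n_eq, D.m₁_eq, D.m₂_eq, D.N₁_eq, D.N₂_eq, hrow, D.zero, D.sorted₁, D.sorted₂, D.lt₁, D.lt₂,
      D.n_pos, by omega⟩) ?_
  rintro s' t F ⟨ht, h⟩
  refine ⟨ht, ?_⟩
  rcases h with ⟨hrec, hno⟩ | ⟨a, ha, b, hb, hhit, hrec⟩
  · have hS' := hS.mono (Done' := Done) (fun _ _ _ h => h) hrec
    rcases hS' with ⟨h1, h2⟩ | h
    · refine Or.inl ⟨h1, ?_⟩
      rintro q' i' r' (hd | ⟨rfl, rfl, rfl⟩) e₁ he₁ e₂ he₂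
      · exact h2 q' i' r' hd e₁ he₁ e₂ he₂
      · obtain ⟨a, ha, rfl⟩ := D.occ₁ e₁ he₁
        obtain ⟨b, hb, rfl⟩ := D.occ₂ e₂ he₂
        rw [← D.stateHit_iff hc hr he₁ he₂]
        exact hno a ha b hb
    · exact Or.inr h
  · exact Or.inr ⟨q, i, r, hg, _, D.lt₁ a ha, _, D.lt₂ b hb,
      (D.stateHit_iff hc hr (D.lt₁ a ha) (D.lt₂ b hb)).1 hhit, hrec⟩

/-- Run through all hash functions for the current recoloring. -/
def rowsProg : Prog :=
  .const 18 0 ;; .const 19 0 ;; .loop (.lt 18 8) (pairProg ;; .op .add 19 19 0 ;; inc 18)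

theorem rowsProg_spec {B : ℕ} {v : ℕ → ℝ} {Δ : ℝ} {n q l i : ℕ} {s : State}
    {Good Done : ℕ → ℕ → ℕ → Prop} (D : SearchData B v Δ n q l s)
    (hc : ∀ c < q ^ 2, s.arr 5 c = recolor (q ^ 2) i c)
    (hg : ∀ r < rows q l, Good q i r) (hS : Status v Δ n Good Done s) :
    wp B rowsProg s fun s' t => t ≤ (passTime n q + 4) * rows q l + 3 ∧
      Status v Δ n Good
        (fun q' i' r' => Done q' i' r' ∨ (q' = q ∧ i' = i ∧ r' < rows q l)) s' := by
  have hB := D.bound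
  unfold rowsProg
  simp only [wp_seq, wp_const]
  refine ⟨by omega, by omega, wp.call (wp_loop
    (fun s' => s'.var 18 ≤ rows q l ∧ s'.var 19 = s'.var 18 * n ∧
      (∀ c < q ^ 2, s'.arr 5 c = recolor (q ^ 2) i c) ∧ SearchData B v Δ n q l s' ∧
      Status v Δ n Good
        (fun q' i' r' => Done q' i' r' ∨ (q' = q ∧ i' = i ∧ r' < s'.var 18)) s')
    (fun s' => rows q l - s'.var 18) (passTime n q + 3) ?_ ?_) ?_⟩
  · refine ⟨by simp, by simp, hc, (D.setVar 18 0).setVar 19 0, ?_⟩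
    refine (hS.setVar (fun _ _ _ h => h) 18 0).setVar ?_ 19 0
    intro q' i' r' h
    simpa using h
  · rintro s₁ F ⟨g1, g2, g3, g4, g5⟩ hb
    rw [Test.holds_lt, g4.L_eq] at hb
    rw [wp_seq]
    refine wp.call (g4.pairProg_spec g3 hb g2 (hg _ hb) g5) ?_
    rintro s₂ t F2 ⟨k1, k2⟩
    have D2 := g4.of_frame F2
    have h18 : s₂.var 18 = s₁.var 18 := F2.var 18
    have h19 : s₂.var 19 = s₁.var 18 * n := by rw [F2.var 19, g2]
    have ha5 : s₂.arr 5 = s₁.arr 5 := F2.arr 5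
    have hrow : s₁.var 18 * n + n ≤ rows q l * n := by
      have := Nat.mul_le_mul_right n (show s₁.var 18 + 1 ≤ rows q l from hb)
      rwa [add_mul, one_mul] at this
    simp [D2.n_eq, h18, h19]
    refine ⟨by omega, by omega, by omega, ⟨by omega, by ring, by rwa [ha5],
      ((D2.setVar 19 _).setVar 99 1).setVar 18 _, ?_⟩, by omega⟩
    refine ((k2.setVar (fun _ _ _ h => h) 19 _).setVar (fun _ _ _ h => h) 99 1).setVar ?_ 18 _
    rintro q' i' r' (h | ⟨rfl, rfl, h⟩)
    · exact Or.inl (Or.inl h)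
    · rcases Nat.lt_or_eq_of_le h with h | rfl
      · exact Or.inl (Or.inr ⟨rfl, rfl, h⟩)
      · exact Or.inr ⟨rfl, rfl, rfl⟩
  · rintro s₁ t F ⟨⟨g1, g2, g3, g4, g5⟩, hb, ht⟩
    rw [Test.holds_lt, g4.L_eq] at hb
    simp at ht
    rw [show s₁.var 18 = rows q l by omega] at g5
    exact ⟨by linarith, g5⟩

/-! ### Running through the recolorings -/

/-- Set the colors (array `5`) of the first variable `7` numbers to the first recoloring;
variable `61` becomes `⌈K/2⌉`. -/
def recolorInitProg : Prog :=
  .const 99 1 ;; .op .add 61 7 99 ;; .const 99 2 ;; .op .div 61 61 99 ;; .const 60 0 ;;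
  .loop (.lt 60 7) (
    .cond (.lt 60 61) (.const 62 0) (.const 62 1) ;; .store 5 60 62 ;; inc 60)

theorem recolorInitProg_spec {B : ℕ} {s : State} {K : ℕ} (hK : s.var 7 = K) (hB : K + 2 < B) :
    wp B recolorInitProg s fun s' t => t ≤ 6 * K + 6 ∧ s'.var 61 = (K + 1) / 2 ∧
      ∀ c < K, s'.arr 5 c = recolor K 0 c := by
  unfold recolorInitProg
  simp [hK]
  refine ⟨by omega, by omega, by omega, by omega, by omega, wp.call (wp_loop
    (fun s' => s'.var 60 ≤ K ∧ ∀ c < s'.var 60, s'.arr 5 c = recolor K 0 c)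
    (fun s' => K - s'.var 60) 5 ?_ ?_) ?_⟩
  · simp
  · rintro s₁ F ⟨h1, h2⟩ hb
    have hK1 : s₁.var 7 = K := by simpa [hK] using F.var 7
    have h61 : s₁.var 61 = (K + 1) / 2 := by simpa using F.var 61
    simp [hK1] at hb
    have hB1 : 1 < B := by omega
    have hB0 : 0 < B := by omega
    have hB2 : s₁.var 60 + 1 < B := by omega
    by_cases hc : s₁.var 60 < (K + 1) / 2
    · simp [h61, hc, hB0, hB2]
      refine ⟨⟨by omega, fun c hcl => ?_⟩, by omega⟩
      rcases Nat.lt_or_eq_of_le hcl with h | rfl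
      · rw [if_neg h.ne, h2 c h]
      · simp [recolor, hc]
    · simp [h61, hc, hB1, hB2]
      refine ⟨⟨by omega, fun c hcl => ?_⟩, by omega⟩
      rcases Nat.lt_or_eq_of_le hcl with h | rfl
      · rw [if_neg h.ne, h2 c h]
      · simp [recolor, hc]
  · rintro s₁ t F ⟨⟨h1, h2⟩, hb, ht⟩
    have hK1 : s₁.var 7 = K := by simpa [hK] using F.var 7
    have h61 : s₁.var 61 = (K + 1) / 2 := by simpa using F.var 61
    simp [hK1] at hb ht
    exact ⟨by omega, h61, fun c hc => h2 c (by omega)⟩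

/-- Pass from the recoloring number variable `17` to the next one. -/
def recolorStepProg : Prog :=
  .const 99 2 ;; .op .div 64 17 99 ;; .op .mul 65 64 99 ;;
  .cond (.lt 65 17)
    (.op .div 65 64 7 ;; .op .mul 65 65 7 ;; .op .sub 65 64 65 ;; .const 66 1 ;; .store 5 65 66)
    (.op .add 64 61 64 ;; .op .div 65 64 7 ;; .op .mul 65 65 7 ;; .op .sub 65 64 65 ;;
      .const 66 0 ;; .store 5 65 66)

/-- Consecutive recolorings differ in at most one cell, so an update in place takes constant time.
-/
theorem recolorStepProg_spec {B : ℕ} {s : State} {K i : ℕ} (hK : s.var 7 = K)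
    (hi : s.var 17 = i) (h61 : s.var 61 = (K + 1) / 2)
    (hc : ∀ c < K, s.arr 5 c = recolor K i c) (hB : i + K + 3 < B) :
    wp B recolorStepProg s fun s' t => t ≤ 10 ∧ ∀ c < K, s'.arr 5 c = recolor K (i + 1) c := by
  have hmod : ∀ x, x - x / K * K = x % K := fun x => by rw [Nat.mod_eq_sub_div_mul]
  unfold recolorStepProg
  -- The machine tests parity by this comparison.
  have e : i / 2 * 2 < i ↔ i % 2 ≠ 0 := by omega
  by_cases h : i % 2 = 0
  · obtain ⟨b1, b2, b3⟩ := digitStep_bounds (x := (K + 1) / 2 + i / 2) (n := K) (B := B) (by omega)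
    simp [hK, hi, h61, e, h, b1, b2, b3, hmod]
    refine ⟨by omega, by omega, by omega, fun _ => ⟨by omega, by omega, fun c hcK => ?_⟩⟩
    rw [recolor, if_pos h, hc c hcK]
    split_ifs <;> rfl
  · obtain ⟨b1, b2, b3⟩ := digitStep_bounds (x := i / 2) (n := K) (B := B) (by omega)
    simp [hK, hi, e, h, b1, b2, b3, hmod]
    and_intros
    · omega
    · omega
    · omega
    · omega
    · intro c hcK
      rw [recolor, if_neg h, hc c hcK]
      split_ifs <;> rfl

/-- Run through all recolorings and hash functions. -/
def divisionsProg : Prog :=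
  recolorInitProg ;; .op .add 63 7 7 ;; .const 17 0 ;;
  .loop (.lt 17 63) (rowsProg ;; recolorStepProg ;; inc 17)

/-- A bound for the number of steps of all passes for sets of `q` jobs. -/
def divisionsTime (n q l : ℕ) : ℕ :=
  ((passTime n q + 4) * rows q l + 16) * (2 * q ^ 2) + 6 * q ^ 2 + 9

/-- Recolorings form the outer loop because the color array does not depend on the hash function and
can be updated step by step. -/
theorem divisionsProg_spec {B : ℕ} {v : ℕ → ℝ} {Δ : ℝ} {n q l : ℕ} {s : State}
    {Good Done : ℕ → ℕ → ℕ → Prop} (D : SearchData B v Δ n q l s)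
    (hg : ∀ i < 2 * q ^ 2, ∀ r < rows q l, Good q i r) (hS : Status v Δ n Good Done s) :
    wp B divisionsProg s fun s' t => t ≤ divisionsTime n q l ∧
      Status v Δ n Good
        (fun q' i' r' => Done q' i' r' ∨ (q' = q ∧ i' < 2 * q ^ 2 ∧ r' < rows q l)) s' := by
  have hB := D.bound
  unfold divisionsProg
  rw [wp_seq]
  refine wp.call (recolorInitProg_spec D.K_eq (by omega)) ?_
  rintro s₁ t₁ F1 ⟨ht1, h61, hcol⟩
  have D1 := D.of_frame F1
  have S1 := hS.of_frame F1 fun _ _ _ h => h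
  simp [D1.K_eq, ← two_mul]
  refine ⟨by omega, by omega, wp.call (wp_loop
    (fun s' => s'.var 17 ≤ 2 * q ^ 2 ∧
      (∀ c < q ^ 2, s'.arr 5 c = recolor (q ^ 2) (s'.var 17) c) ∧ SearchData B v Δ n q l s' ∧
      Status v Δ n Good
        (fun q' i' r' => Done q' i' r' ∨ (q' = q ∧ i' < s'.var 17 ∧ r' < rows q l)) s')
    (fun s' => 2 * q ^ 2 - s'.var 17) ((passTime n q + 4) * rows q l + 15) ?_ ?_) ?_⟩
  · refine ⟨by simp, by simpa using hcol, (D1.setVar 63 _).setVar 17 0, ?_⟩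
    refine (S1.setVar (fun _ _ _ h => h) 63 _).setVar ?_ 17 0
    intro q' i' r' h
    simpa using h
  · rintro s₂ F ⟨g1, g2, g3, g4⟩ hb
    have h61' : s₂.var 61 = (q ^ 2 + 1) / 2 := by simpa [h61] using F.var 61
    have h63 : s₂.var 63 = 2 * q ^ 2 := by simpa using F.var 63
    rw [Test.holds_lt, h63] at hb
    rw [wp_seq]
    refine wp.call (rowsProg_spec g3 g2 (hg _ hb) g4) ?_
    rintro s₃ t₃ F3 ⟨k1, k2⟩
    have D3 := g3.of_frame F3
    have h17 : s₃.var 17 = s₂.var 17 := F3.var 17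
    have ha5 : s₃.arr 5 = s₂.arr 5 := F3.arr 5
    rw [wp_seq]
    refine wp.call (recolorStepProg_spec D3.K_eq h17 (by rw [F3.var 61, h61'])
      (by rwa [ha5]) (by omega)) ?_
    rintro s₄ t₄ F4 ⟨m1, m2⟩
    have D4 := D3.of_frame F4
    have S4 := k2.of_frame F4 fun _ _ _ h => h
    have h17' : s₄.var 17 = s₂.var 17 := by rw [F4.var 17, h17]
    simp [h17']
    refine ⟨by omega, by omega, ⟨by omega, m2, (D4.setVar 99 1).setVar 17 _, ?_⟩, by omega⟩
    refine (S4.setVar (fun _ _ _ h => h) 99 1).setVar ?_ 17 _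
    rintro q' i' r' (h | ⟨rfl, h, hr⟩)
    · exact Or.inl (Or.inl h)
    · rcases Nat.lt_or_eq_of_le h with h | rfl
      · exact Or.inl (Or.inr ⟨rfl, h, hr⟩)
      · exact Or.inr ⟨rfl, rfl, hr⟩
  · rintro s₂ t F ⟨⟨g1, g2, g3, g4⟩, hb, ht⟩
    have h63 : s₂.var 63 = 2 * q ^ 2 := by simpa using F.var 63
    rw [Test.holds_lt, h63] at hb
    simp at ht
    rw [show s₂.var 17 = 2 * q ^ 2 by omega] at g4
    refine ⟨?_, g4⟩
    unfold divisionsTime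
    linarith


/-! ### Preparation -/

/-- Compute the loads in array `2` of real numbers. -/
def loadsProg : Prog :=
  .const 20 0 ;; .loop (.lt 20 0) (.load 21 0 20 ;; .numAdd 2 21 0 20 ;; inc 20)

theorem loadsProg_spec {B n : ℕ} {s : State} (hn : s.var 0 = n) (h0 : ∀ i, s.num 2 i = 0)
    (hB : n + 1 < B) :
    wp B loadsProg s fun s' t => t ≤ 5 * n + 2 ∧
      ∀ i, s'.num 2 i = ∑ j ∈ Finset.range n, if s.arr 0 j = i then s.num 0 j else 0 := by
  unfold loadsProg
  simp only [wp_seq, wp_const]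
  refine ⟨by omega, wp.call (wp_loop
    (fun s' => s'.var 20 ≤ n ∧ ∀ i, s'.num 2 i =
      ∑ j ∈ Finset.range (s'.var 20), if s.arr 0 j = i then s.num 0 j else 0)
    (fun s' => n - s'.var 20) 4 ?_ ?_) ?_⟩
  · simpa using h0
  · rintro s₁ F ⟨h1, h2⟩ hb
    have hn1 : s₁.var 0 = n := by simpa [hn] using F.var 0
    have ha : s₁.arr 0 = s.arr 0 := by simpa using F.arr 0
    have hp : s₁.num 0 = s.num 0 := by simpa using F.num 0
    simp [hn1] at hb
    simp [ha, hp]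
    refine ⟨by omega, ⟨by omega, fun i => ?_⟩, by omega⟩
    rw [Finset.sum_range_succ, ← h2]
    by_cases h : i = s.arr 0 (s₁.var 20)
    · rw [if_pos h, if_pos h.symm, h]
    · rw [if_neg h, if_neg (Ne.symm h), add_zero]
  · rintro s₁ t F ⟨⟨h1, h2⟩, hb, ht⟩
    have hn1 : s₁.var 0 = n := by simpa [hn] using F.var 0
    simp [hn1] at hb ht
    rw [show s₁.var 20 = n by omega] at h2
    exact ⟨by omega, h2⟩

theorem sum_range_eq_load {n : ℕ} {p : Fin n → ℝ} {σ : Schedule n} {a : ℕ → ℕ} {v : ℕ → ℝ}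
    (ha : ∀ j : Fin n, a j = σ j) (hv : ∀ j : Fin n, v j = p j) (i : Fin 2) :
    (∑ j ∈ Finset.range n, if a j = i then v j else 0) = load p σ i := by
  rw [load, Finset.sum_filter, ← Fin.sum_univ_eq_sum_range fun j => if a j = i then v j else 0]
  refine Finset.sum_congr rfl fun j _ => ?_
  rw [ha, hv]
  simp only [Fin.ext_iff]

/-- Variable `16` becomes the critical machine and cell `0` of array `7` the gap. -/
def gapProg : Prog :=
  .const 21 0 ;; .const 22 1 ;;
  .cond (.numLt 2 21 2 22)
    (.const 16 1 ;; .numAdd 7 21 2 22 ;; .numSub 7 21 2 21)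
    (.const 16 0 ;; .numAdd 7 21 2 21 ;; .numSub 7 21 2 22)

theorem gapProg_spec {B n : ℕ} {s : State} {p : Fin n → ℝ} {σ : Schedule n}
    (h0 : s.num 2 0 = load p σ 0) (h1 : s.num 2 1 = load p σ 1) (h7 : s.num 7 0 = 0)
    (hB : 1 < B) :
    wp B gapProg s fun s' t => t ≤ 6 ∧ s'.var 16 = critical p σ ∧ s'.num 7 0 = gap p σ := by
  unfold gapProg
  by_cases h : load p σ 0 < load p σ 1
  · have hc : critical p σ = 1 := by rw [critical, if_neg (not_le.2 h)]
    simp [h0, h1, h7, h, hB, hc, gap_eq]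
    omega
  · have hc : critical p σ = 0 := by rw [critical, if_pos (not_lt.1 h)]
    simp [h0, h1, h7, hB, hc, gap_eq]
    exact ⟨by omega, not_lt.1 h, fun _ => by omega⟩

/-- Compute the signed processing times in array `1` of real numbers. -/
def signedProg : Prog :=
  .const 20 0 ;; .loop (.lt 20 0) (
    .load 21 0 20 ;; .cond (.lt 21 16) (.numSub 1 20 0 20)
      (.cond (.lt 16 21) (.numSub 1 20 0 20) (.numAdd 1 20 0 20)) ;; inc 20)

theorem signedProg_spec {B n c : ℕ} {s : State} (hn : s.var 0 = n) (hc : s.var 16 = c)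
    (h0 : ∀ j, s.num 1 j = 0) (hB : n + 1 < B) :
    wp B signedProg s fun s' t => t ≤ 7 * n + 2 ∧
      ∀ j < n, s'.num 1 j = if s.arr 0 j = c then s.num 0 j else - s.num 0 j := by
  unfold signedProg
  simp only [wp_seq, wp_const]
  refine ⟨by omega, wp.call (wp_loop
    (fun s' => s'.var 20 ≤ n ∧ (∀ j < s'.var 20, s'.num 1 j =
      if s.arr 0 j = c then s.num 0 j else - s.num 0 j) ∧ ∀ j, s'.var 20 ≤ j → s'.num 1 j = 0)
    (fun s' => n - s'.var 20) 6 ?_ ?_) ?_⟩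
  · simpa using h0
  · rintro s₁ F ⟨h1, h2, h3⟩ hb
    have hn1 : s₁.var 0 = n := by simpa [hn] using F.var 0
    have hc1 : s₁.var 16 = c := by simpa [hc] using F.var 16
    have ha : s₁.arr 0 = s.arr 0 := by simpa using F.arr 0
    have hp : s₁.num 0 = s.num 0 := by simpa using F.num 0
    have h4 := h3 _ le_rfl
    simp [hn1] at hb
    rw [wp_seq, wp_load, wp_seq]
    refine wp.call (R := fun s' t => t ≤ 3 ∧ s'.var 20 = s₁.var 20 ∧
      (∀ j ≠ s₁.var 20, s'.num 1 j = s₁.num 1 j) ∧ s'.num 1 (s₁.var 20) =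
        if s.arr 0 (s₁.var 20) = c then s.num 0 (s₁.var 20) else - s.num 0 (s₁.var 20)) ?_ ?_
    · rcases lt_trichotomy (s.arr 0 (s₁.var 20)) c with h | h | h
      · simp +contextual [hc1, ha, hp, h, h.ne, h4]
      · simp +contextual [hc1, ha, hp, h, h4]
      · simp +contextual [hc1, ha, hp, h, h.ne', h.not_gt, h4]
    · rintro s₂ t F2 ⟨g1, g2, g3, g4⟩
      simp [g2]
      refine ⟨by omega, by omega, ⟨by omega, fun j hj => ?_, fun j hj => ?_⟩, by omega⟩
      · rcases Nat.lt_or_eq_of_le hj with h | rfl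
        · rw [g3 j h.ne, h2 j h]
        · exact g4
      · rw [g3 j (by omega), h3 j (by omega)]
  · rintro s₁ t F ⟨⟨h1, h2, h3⟩, hb, ht⟩
    have hn1 : s₁.var 0 = n := by simpa [hn] using F.var 0
    simp [hn1] at hb ht
    exact ⟨by omega, fun j hj => h2 j (by omega)⟩

/-- Variable `9` becomes the least `l` with `n ≤ 2 ^ l`. -/
def logProg : Prog :=
  .const 9 0 ;; .const 80 1 ;; .loop (.lt 80 0) (.op .add 80 80 80 ;; inc 9)

theorem logProg_spec {B n : ℕ} {s : State} (hn : s.var 0 = n) (hn2 : 2 ≤ n)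
    (hB : 2 * n < B) :
    wp B logProg s fun s' t => t ≤ 4 * Nat.clog 2 n + 3 ∧ s'.var 9 = Nat.clog 2 n := by
  have hcl : Nat.clog 2 n < B := by
    have := Nat.clog_le_of_le_pow (b := 2) (x := n) (y := n) (Nat.lt_two_pow_self).le
    omega
  unfold logProg
  simp only [wp_seq, wp_const]
  refine ⟨by omega, by omega, wp.call (wp_loop
    (fun s' => s'.var 9 ≤ Nat.clog 2 n ∧ s'.var 80 = 2 ^ s'.var 9)
    (fun s' => Nat.clog 2 n - s'.var 9) 3 ?_ ?_) ?_⟩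
  · simp
  · rintro s₁ F ⟨h1, h2⟩ hb
    have hn1 : s₁.var 0 = n := by simpa [hn] using F.var 0
    simp [hn1] at hb
    have hlt : s₁.var 9 < Nat.clog 2 n := by
      rw [Nat.lt_clog_iff_pow_lt (by norm_num)]
      omega
    simp
    refine ⟨by omega, by omega, ⟨by omega, ?_⟩, by omega⟩
    rw [pow_succ]
    omega
  · rintro s₁ t F ⟨⟨h1, h2⟩, hb, ht⟩
    have hn1 : s₁.var 0 = n := by simpa [hn] using F.var 0
    simp [hn1] at hb ht
    have : Nat.clog 2 n ≤ s₁.var 9 := Nat.clog_le_of_le_pow (by omega)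
    omega

/-- All preparations. -/
def prepareProg : Prog := loadsProg ;; gapProg ;; signedProg ;; logProg

theorem prepareProg_spec {B n k : ℕ} {p : Fin n → ℝ} {σ : Schedule n} (hn2 : 2 ≤ n)
    (hB : 2 * n + 1 < B) :
    wp B prepareProg (input k p σ) fun s' t => t ≤ 12 * n + 4 * Nat.clog 2 n + 13 ∧
      s'.var 9 = Nat.clog 2 n ∧ s'.num 7 0 = gap p σ ∧
      ∀ j : Fin n, s'.num 1 j = signed p σ j := by
  have hσ : ∀ j : Fin n, (input k p σ).arr 0 j = σ j := fun j => by simp [input]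
  have hp : ∀ j : Fin n, (input k p σ).num 0 j = p j := fun j => by simp [input]
  unfold prepareProg
  rw [wp_seq]
  refine wp.call (loadsProg_spec (n := n) (by simp [input]) (by simp [input]) (by omega)) ?_
  rintro s₁ t₁ F1 ⟨ht1, h1⟩
  have l0 : s₁.num 2 0 = load p σ 0 := by
    rw [h1, ← sum_range_eq_load hσ hp]
    rfl
  have l1 : s₁.num 2 1 = load p σ 1 := by
    rw [h1, ← sum_range_eq_load hσ hp]
    rfl
  rw [wp_seq]
  refine wp.call (gapProg_spec l0 l1 (by rw [F1.num 7]; simp [input]) (by omega)) ?_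
  rintro s₂ t₂ F2 ⟨ht2, hc, h7⟩
  have n2 : s₂.var 0 = n := by rw [F2.var 0, F1.var 0]; simp [input]
  rw [wp_seq]
  refine wp.call (signedProg_spec n2 hc (fun j => by rw [F2.num 1, F1.num 1]; simp [input])
    (by omega)) ?_
  rintro s₃ t₃ F3 ⟨ht3, h3⟩
  refine wp.call (logProg_spec (by rw [F3.var 0, n2]) hn2 (by omega)) ?_
  rintro s₄ t₄ F4 ⟨ht4, h4⟩
  refine ⟨by omega, h4, by rw [F4.num 7, F3.num 7, h7], fun j => ?_⟩
  rw [F4.num 1, h3 j j.isLt, F2.arr 0, F1.arr 0, F2.num 0, F1.num 0, hσ, hp, signed]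
  simp only [Fin.ext_iff]


/-! ### The search for one size, and its use for a range of sizes -/

/-- The sizes for sets of variable `3` jobs. -/
def sizesProg : Prog :=
  .const 99 1 ;; .op .add 5 3 99 ;; .const 99 2 ;; .op .div 5 5 99 ;; .op .div 6 3 99 ;;
  .op .mul 7 3 3 ;; .const 99 3 ;; .op .mul 8 99 7 ;; .op .mul 8 8 9

theorem sizesProg_spec {B q l : ℕ} {s : State} (hq : s.var 3 = q) (hl : s.var 9 = l)
    (hl0 : 0 < l) (hB : rows q l + q + 3 < B) :
    wp B sizesProg s fun s' t => t ≤ 9 ∧ s'.var 5 = (q + 1) / 2 ∧ s'.var 6 = q / 2 ∧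
      s'.var 7 = q ^ 2 ∧ s'.var 8 = rows q l := by
  have h1 : 3 * q ^ 2 ≤ rows q l := Nat.le_mul_of_pos_right _ hl0
  have h2 : q * q = q ^ 2 := (sq q).symm
  have h3 : 3 * q ^ 2 * l = rows q l := rfl
  unfold sizesProg
  simp [hq, hl, h2, h3]
  and_intros <;> omega

/-- Compute in the array `u` of real numbers the values of the codes of tuples whose length is
variable `x`, sort the codes in the array `a`, and put their number into variable `y`. -/
def codesProg (u a x y : ℕ) : Prog :=
  mov 31 x ;; powProg ;; valuesProg u a ;; sortProg u a ;; mov y 33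

/-- A bound for the number of steps of the computation of the sorted array of the codes of
`m`-tuples. -/
def codesTime (n m l : ℕ) : ℕ := (10 * m + 12) * n ^ m + (36 * n ^ m + 10) * (m * l) + 4 * m + 11

/-- From `n ^ m ≤ 2 ^ (m * l)` sorting needs at most `m * l` rounds. The array starts as the
identity, so `Occurs` says that its entries are exactly the codes below `n ^ m`. -/
theorem codesProg_spec {B u a x y n m l : ℕ} {s : State} (hu : u ≠ 1) (ha : a ≠ 3) (hx : x ≠ 99)
    (hn : s.var 0 = n) (hm : s.var x = m) (h0 : 0 < n) (hnl : n ≤ 2 ^ l)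
    (hB : 4 * n ^ m + m + 2 < B) :
    wp B (codesProg u a x y) s fun s' t => t ≤ codesTime n m l ∧ s'.var y = n ^ m ∧
      (∀ i j, i < j → j < n ^ m → s'.num u (s'.arr a i) ≤ s'.num u (s'.arr a j)) ∧
      (∀ i < n ^ m, s'.arr a i < n ^ m) ∧ (∀ e < n ^ m, ∃ i < n ^ m, s'.arr a i = e) ∧
      ∀ e < n ^ m, s'.num u e = codeVal (s.num 1) n m e := by
  have hpos : 0 < n ^ m := by positivity
  unfold codesProg
  rw [wp_seq, wp_mov hx, wp_seq]
  refine ⟨by omega, wp.call (powProg_spec (n := n) (m := m) (by simpa using hn) (by simpa using hm)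
    h0 (by omega) (by omega)) ?_⟩
  rintro s₁ t₁ F1 ⟨ht1, h1⟩
  have n1 : s₁.var 0 = n := by simpa [hn] using F1.var 0
  have m1 : s₁.var 31 = m := by simpa [hm] using F1.var 31
  have v1 : s₁.num 1 = s.num 1 := by simpa using F1.num 1
  rw [wp_seq]
  refine wp.call (valuesProg_spec hu n1 m1 h1 (by omega) (by omega)) ?_
  rintro s₂ t₂ F2 ⟨ht2, h2, h2'⟩
  have N2 : s₂.var 33 = n ^ m := by rw [F2.var 33, h1]
  rw [wp_seq]
  refine wp.call (sortProg_spec (l := m * l) ha N2 hpos ?_ (by omega)) ?_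
  · rw [mul_comm, pow_mul]
    exact Nat.pow_le_pow_left hnl m
  rintro s₃ t₃ F3 ⟨ht3, h3, o1, o2⟩
  have N3 : s₃.var 33 = n ^ m := by rw [F3.var 33, N2]
  have V3 : s₃.num u = s₂.num u := F3.num u
  rw [wp_mov (by omega)]
  simp only [setVar_var, if_true, setVar_arr, setVar_num, N3]
  refine ⟨by omega, ?_, trivial, by rwa [V3], fun i hi => ?_, fun e he => ?_, fun e he => ?_⟩
  · unfold codesTime
    omega
  · obtain ⟨j, hj, e⟩ := o2 i hi
    rw [← e, h2' j hj]
    exact hj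
  · obtain ⟨j, hj, e'⟩ := o1 e he
    exact ⟨j, hj, by rw [e', h2' e he]⟩
  · rw [V3, h2 e he, v1]

/-- Search for swaps of variable `3` jobs. -/
def sizedProg : Prog :=
  sizesProg ;; splitterProg ;; codesProg 4 2 5 10 ;; codesProg 5 4 6 11 ;; divisionsProg

/-- A bound for the number of steps of the search for swaps of `q` jobs. -/
def sizedTime (n q l : ℕ) : ℕ :=
  splitterTime n q l + codesTime n ((q + 1) / 2) l + codesTime n (q / 2) l +
    divisionsTime n q l + 9

/-- The words that occur in the search for swaps of `q` jobs are below `B`. -/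
def WordBound (B n q l : ℕ) : Prop :=
  4 * n ^ ((q + 1) / 2) + 4 * n ^ (q / 2) + q + rows q l * n + n + rows q l + 3 * q ^ 2 + 5 +
    2 ^ (12 * l) < B

/-- All codes are sorted once, independently of the divisions, so the cost of sorting is not
multiplied by the number of passes. -/
theorem sizedProg_spec {B : ℕ} {v : ℕ → ℝ} {Δ : ℝ} {n q l : ℕ} {s : State}
    {Good Done : ℕ → ℕ → ℕ → Prop} (hn : s.var 0 = n) (hq : s.var 3 = q) (hl : s.var 9 = l)
    (hv : s.num 1 = v) (h6 : s.num 6 0 = 0) (h7 : s.num 7 0 = Δ)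
    (hn0 : 0 < n) (hq0 : 0 < q) (hl0 : 0 < l) (hnl : n ≤ 2 ^ l) (hB : WordBound B n q l)
    (hg : ∀ i < 2 * q ^ 2, ∀ r < rows q l, Good q i r) (hS : Status v Δ n Good Done s) :
    wp B sizedProg s fun s' t => t ≤ sizedTime n q l ∧
      Status v Δ n Good
        (fun q' i' r' => Done q' i' r' ∨ (q' = q ∧ i' < 2 * q ^ 2 ∧ r' < rows q l)) s' := by
  unfold WordBound at hB
  have hpow : 0 < 2 ^ (12 * l) := by positivity
  unfold sizedProg
  rw [wp_seq]
  refine wp.call (sizesProg_spec hq hl hl0 (by omega)) ?_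
  rintro s₁ t₁ F1 ⟨ht1, a1, a2, a3, a4⟩
  rw [wp_seq]
  refine wp.call (splitterProg_spec (n := n) (q := q) (l := l) (by rw [F1.var 0, hn])
    (by rw [F1.var 3, hq]) a3 a4 hq0 hl0 hnl (by omega) (by omega) (by omega)) ?_
  rintro s₂ t₂ F2 ⟨ht2, htab⟩
  have n2 : s₂.var 0 = n := by rw [F2.var 0, F1.var 0, hn]
  have b1 : s₂.var 5 = (q + 1) / 2 := by rw [F2.var 5, a1]
  rw [wp_seq]
  refine wp.call (codesProg_spec (u := 4) (a := 2) (x := 5) (y := 10) (by omega) (by omega)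
    (by omega) n2 b1 hn0 hnl (by omega)) ?_
  rintro s₃ t₃ F3 ⟨ht3, c1, c2, c3, c4, c5⟩
  have n3 : s₃.var 0 = n := by rw [F3.var 0, n2]
  have b2 : s₃.var 6 = q / 2 := by rw [F3.var 6, F2.var 6, a2]
  rw [wp_seq]
  refine wp.call (codesProg_spec (u := 5) (a := 4) (x := 6) (y := 11) (by omega) (by omega)
    (by omega) n3 b2 hn0 hnl (by omega)) ?_
  rintro s₄ t₄ F4 ⟨ht4, d1, d2, d3, d4, d5⟩
  have hv2 : s₂.num 1 = v := by rw [F2.num 1, F1.num 1, hv]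
  have hv3 : s₃.num 1 = v := by rw [F3.num 1, hv2]
  rw [hv2] at c5
  rw [hv3] at d5
  have e4 : s₄.num 4 = s₃.num 4 := F4.num 4
  have e2 : s₄.arr 2 = s₃.arr 2 := F4.arr 2
  have D : SearchData B v Δ n q l s₄ := by
    refine ⟨by rw [F4.var 0, n3], by rw [F4.var 5, F3.var 5, b1], by rw [F4.var 6, b2],
      by rw [F4.var 7, F3.var 7, F2.var 7, a3], by rw [F4.var 8, F3.var 8, F2.var 8, a4],
      by rw [F4.var 10, c1], d1, by rw [F4.num 6, F3.num 6, F2.num 6, F1.num 6, h6],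
      by rw [F4.num 7, F3.num 7, F2.num 7, F1.num 7, h7], ?_, by rwa [e4, e2], d2, by rwa [e2], d3,
      by rwa [e2], d4, by rwa [e4], d5, hn0, hq0, by omega⟩
    rw [F4.arr 1, F3.arr 1]
    exact htab
  have S : Status v Δ n Good Done s₄ :=
    (((hS.of_frame F1 fun _ _ _ h => h).of_frame F2 fun _ _ _ h => h).of_frame F3
      fun _ _ _ h => h).of_frame F4 fun _ _ _ h => h
  refine wp.call (divisionsProg_spec D hg S) ?_
  rintro s₅ t₅ F5 ⟨ht5, h5⟩
  refine ⟨?_, h5⟩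
  unfold sizedTime
  omega

/-- Carry out the swap that is recorded. -/
def finishProg : Prog :=
  mov 30 12 ;; mov 31 14 ;; flipProg ;; mov 30 13 ;; mov 31 15 ;; flipProg

/-- Needs no test for success: without a hit both recorded lengths are `0` and nothing is flipped.
-/
theorem finishProg_spec {B b n m₁ m₂ e₁ e₂ : ℕ} {P₁ P₂ : ℕ → Prop} {s : State}
    (hn : s.var 0 = n) (hR : Recorded s b m₁ m₂ e₁ e₂) (h₁ : ValidCode n m₁ P₁ e₁)
    (h₂ : ValidCode n m₂ P₂ e₂) (hB : m₁ + m₂ + e₁ + e₂ + 1 < B) :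
    wp B finishProg s fun s' t => t ≤ 12 * m₁ + 12 * m₂ + 12 ∧ s'.var 2 = b ∧
      ∀ g, s'.arr 0 g =
        if g ∈ (Finset.range m₂).image (digit n e₂) then
          1 - (if g ∈ (Finset.range m₁).image (digit n e₁) then 1 - s.arr 0 g else s.arr 0 g)
        else if g ∈ (Finset.range m₁).image (digit n e₁) then 1 - s.arr 0 g else s.arr 0 g := by
  obtain ⟨r1, r2, r3, r4, r5⟩ := hR
  unfold finishProg
  simp [r2, r4]
  refine ⟨by omega, by omega, wp.call (flipProg_spec (n := n) (m := m₁) (e := e₁)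
    (by simpa using hn) (by simp) (by simp) (by omega) (by omega) h₁.1) ?_⟩
  rintro s₁ t₁ F1 ⟨ht1, h1⟩
  have q13 : s₁.var 13 = e₂ := by simpa [r3] using F1.var 13
  have q15 : s₁.var 15 = m₂ := by simpa [r5] using F1.var 15
  have q2 : s₁.var 2 = b := by simpa [r1] using F1.var 2
  have q0 : s₁.var 0 = n := by simpa [hn] using F1.var 0
  simp only [q13, q15]
  refine ⟨by omega, by omega, wp.call (flipProg_spec (n := n) (m := m₂) (e := e₂)
    (by simpa using q0) (by simp) (by simp) (by omega) (by omega) h₂.1) ?_⟩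
  rintro s₂ t₂ F2 ⟨ht2, h2⟩
  have p2 : s₂.var 2 = b := by simpa [q2] using F2.var 2
  refine ⟨by omega, p2, fun g => ?_⟩
  rw [h2]
  simp only [setVar_arr] at h1 ⊢
  rw [h1]
  simp

/-- Search for swaps of all sizes from variable `3` up to variable `1`. -/
def searchProg : Prog :=
  mov 81 1 ;; inc 81 ;; .loop (.lt 3 81) (sizedProg ;; inc 3)

/-- The search goes on after a hit. In the invariant the admissible divisions stay fixed, while the
finished ones grow with the current size. -/
theorem searchProg_spec {B : ℕ} {v : ℕ → ℝ} {Δ : ℝ} {n k q₀ l T : ℕ} {s : State}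
    (hn : s.var 0 = n) (hk : s.var 1 = k) (hq : s.var 3 = q₀) (hl : s.var 9 = l)
    (hv : s.num 1 = v) (h6 : s.num 6 0 = 0) (h7 : s.num 7 0 = Δ)
    (hn0 : 0 < n) (hq0 : 0 < q₀) (hqk : q₀ ≤ k) (hl0 : 0 < l) (hnl : n ≤ 2 ^ l)
    (hB : ∀ q, 0 < q → q ≤ k → WordBound B n q l) (hBk : k + 2 < B)
    (hT : ∀ q, 0 < q → q ≤ k → sizedTime n q l ≤ T)
    (hR : Recorded s 0 0 0 0 0) :
    wp B searchProg s fun s' t => t ≤ (T + 3) * (k + 1 - q₀) + 5 ∧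
      Status v Δ n (fun q i r => (q₀ ≤ q ∧ q ≤ k) ∧ i < 2 * q ^ 2 ∧ r < rows q l)
        (fun q i r => (q₀ ≤ q ∧ q ≤ k) ∧ i < 2 * q ^ 2 ∧ r < rows q l) s' := by
  unfold searchProg
  simp [hk]
  refine ⟨by omega, by omega, wp.call (wp_loop
    (fun s' => s'.var 3 ≤ k + 1 ∧ q₀ ≤ s'.var 3 ∧
      Status v Δ n (fun q i r => (q₀ ≤ q ∧ q ≤ k) ∧ i < 2 * q ^ 2 ∧ r < rows q l)
        (fun q i r => (q₀ ≤ q ∧ q < s'.var 3) ∧ i < 2 * q ^ 2 ∧ r < rows q l) s')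
    (fun s' => k + 1 - s'.var 3) (T + 2) ?_ ?_) ?_⟩
  · refine ⟨by simp; omega, by simp; omega, Or.inl ⟨?_, ?_⟩⟩
    · obtain ⟨r1, r2, r3, r4, r5⟩ := hR
      constructor <;> simp [r1, r2, r3, r4, r5]
    · rintro q i r ⟨⟨h1, h2⟩, -⟩
      simp at h2
      omega
  · rintro s₁ F ⟨g1, g2, g3⟩ hb
    have h81 : s₁.var 81 = k + 1 := by simpa using F.var 81
    have n1 : s₁.var 0 = n := by simpa [hn] using F.var 0
    have l1 : s₁.var 9 = l := by simpa [hl] using F.var 9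
    have v1 : s₁.num 1 = v := by simpa [hv] using F.num 1
    have z1 : s₁.num 6 0 = 0 := by rw [F.num 6]; simpa using h6
    have d1 : s₁.num 7 0 = Δ := by rw [F.num 7]; simpa using h7
    rw [Test.holds_lt, h81] at hb
    rw [wp_seq]
    refine wp.call (sizedProg_spec n1 rfl l1 v1 z1 d1 hn0 (by omega) hl0 hnl
      (hB _ (by omega) (by omega)) (fun i hi r hr => ⟨⟨g2, by omega⟩, hi, hr⟩) g3) ?_
    rintro s₂ t F2 ⟨k1, k2⟩
    have h3 : s₂.var 3 = s₁.var 3 := F2.var 3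
    have hT' := hT (s₁.var 3) (by omega) (by omega)
    simp [h3]
    refine ⟨by omega, by omega, ⟨by omega, by omega, ?_⟩, by omega⟩
    refine (k2.setVar (fun _ _ _ h => h) 99 1).setVar ?_ 3 _
    rintro q i r ⟨⟨h1, h2⟩, h4⟩
    rcases Nat.lt_or_eq_of_le h2 with h | rfl
    · exact Or.inl ⟨⟨h1, h⟩, h4⟩
    · exact Or.inr ⟨rfl, h4⟩
  · rintro s₁ t F ⟨⟨g1, g2, g3⟩, hb, ht⟩
    have h81 : s₁.var 81 = k + 1 := by simpa using F.var 81
    rw [Test.holds_lt, h81] at hb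
    simp only [setVar_var, hq, add_assoc, Nat.reduceAdd] at ht
    simp at ht
    rw [show s₁.var 3 = k + 1 by omega] at g3
    refine ⟨by omega, g3.mono ?_ ⟨rfl, rfl, rfl, rfl, rfl⟩⟩
    rintro q i r ⟨⟨h1, h2⟩, h4⟩
    exact ⟨⟨h1, by omega⟩, h4⟩


/-! ### Bounds for words and steps -/

theorem two_pow_clog_le {n : ℕ} (hn : 2 ≤ n) : 2 ^ Nat.clog 2 n ≤ 2 * n := by
  have h : 0 < Nat.clog 2 n := Nat.clog_pos (by norm_num) hn
  have h1 := Nat.pow_pred_clog_lt_self (b := 2) (by norm_num) (show 1 < n by omega)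
  rw [← Nat.succ_pred_eq_of_pos h, pow_succ]
  omega

/-- With `M = n ^ k` every summand is a small multiple of a power of `M` up to `M ^ 12`; the largest
comes from `2 ^ (12 * l) ≤ (2 * n) ^ 12`. The coefficients add up to less than `64 ≤ M ^ 3`, whence
the exponent `15`. -/
theorem wordBound_pow {n k q : ℕ} (hn : 2 ≤ n) (hk : 2 ≤ k) (hqk : q ≤ k) :
    WordBound (n ^ (15 * k)) n q (Nat.clog 2 n) := by
  have h2l := two_pow_clog_le hn
  obtain ⟨M, hM⟩ : ∃ M, n ^ k = M := ⟨_, rfl⟩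
  generalize Nat.clog 2 n = l at *
  have hsq : n ^ 2 ≤ M := hM ▸ Nat.pow_le_pow_right (by omega) hk
  have hM4 : 4 ≤ M := by nlinarith
  have hnM : 2 * n ≤ M := by nlinarith
  have hlM : l ≤ M := (Nat.lt_two_pow_self).le.trans (h2l.trans hnM)
  have hqM : q ≤ M := by
    rw [← hM]
    exact (hqk.trans Nat.lt_two_pow_self.le).trans (Nat.pow_le_pow_left hn k)
  have h1 : n ^ ((q + 1) / 2) ≤ M := hM ▸ Nat.pow_le_pow_right (by omega) (by omega)
  have h2 : n ^ (q / 2) ≤ M := hM ▸ Nat.pow_le_pow_right (by omega) (by omega)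
  have hp : ∀ a ≤ 12, M ^ a ≤ M ^ 12 := fun a ha => Nat.pow_le_pow_right (by omega) ha
  have h3 : 2 ^ (12 * l) ≤ M ^ 12 := by
    rw [mul_comm, pow_mul]
    exact Nat.pow_le_pow_left (h2l.trans hnM) 12
  have h4 : rows q l ≤ 3 * M ^ 3 := by
    calc 3 * q ^ 2 * l ≤ 3 * M ^ 2 * M := by gcongr
      _ = 3 * M ^ 3 := by ring
  have h5 : rows q l * n ≤ 3 * M ^ 4 := by
    calc rows q l * n ≤ 3 * M ^ 3 * M := by gcongr; omega
      _ = 3 * M ^ 4 := by ring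
  have h6 : q ^ 2 ≤ M ^ 2 := by gcongr
  have p1 := hp 1 (by omega)
  have p2 := hp 2 (by omega)
  have p3 := hp 3 (by omega)
  have p4 := hp 4 (by omega)
  have hB : n ^ (15 * k) = M ^ 12 * M ^ 3 := by rw [mul_comm, pow_mul, hM, ← pow_add]
  have hM3 : 4 ^ 3 ≤ M ^ 3 := Nat.pow_le_pow_left hM4 3
  have hB' : M ^ 12 * 64 ≤ M ^ 12 * M ^ 3 := Nat.mul_le_mul_left _ hM3
  rw [pow_one] at p1
  unfold WordBound
  omega

/-- Every monomial is at most `k * l * N`, and `83` is the sum of the coefficients. The constants of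
the next bounds arise in the same way. -/
theorem codesTime_le {n m k l N : ℕ} (hm : m ≤ k) (hk : 0 < k) (hl : 0 < l) (hN : n ^ m ≤ N)
    (hN0 : 0 < N) : codesTime n m l ≤ 83 * (k * l * N) := by
  have a1 : 1 * 1 * N ≤ k * l * N := by gcongr <;> omega
  have a2 : k * 1 * N ≤ k * l * N := by gcongr; omega
  have a3 : k * l * 1 ≤ k * l * N := by gcongr; omega
  have a4 : k * 1 * 1 ≤ k * l * N := by gcongr <;> omega
  have a5 : 1 * 1 * 1 ≤ k * l * N := by gcongr <;> omega
  calc codesTime n m l ≤ (10 * k + 12) * N + (36 * N + 10) * (k * l) + 4 * k + 11 := by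
        unfold codesTime; gcongr
    _ ≤ 83 * (k * l * N) := by nlinarith

/-- The term `n ^ 2` occurs only for `q ≥ 3`, and then `(k + 1) / 2 ≥ 2`. -/
theorem splitterTime_le {n k q l : ℕ} (hn : 0 < n) (hq : 0 < q) (hqk : q ≤ k) (hl : 0 < l) :
    splitterTime n q l ≤ 158 * (k ^ 4 * l * n ^ ((k + 1) / 2)) := by
  have hk : 0 < k := by omega
  obtain ⟨N, hN⟩ : ∃ N, n ^ ((k + 1) / 2) = N := ⟨_, rfl⟩
  have hN1 : n ^ 1 ≤ N := hN ▸ Nat.pow_le_pow_right hn (by omega)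
  rw [pow_one] at hN1
  rw [hN]
  have hk1 : 1 ≤ k := hk
  have hk2 : k ^ 2 ≤ k ^ 4 := Nat.pow_le_pow_right hk (by omega)
  have hk4 : 1 ≤ k ^ 4 := Nat.one_le_pow _ _ hk
  have a1 : 1 * 1 * 1 ≤ k ^ 4 * l * N := by gcongr <;> omega
  have a2 : k ^ 2 * l * n ≤ k ^ 4 * l * N := by gcongr
  have a3 : k ^ 2 * l * 1 ≤ k ^ 4 * l * N := by gcongr; omega
  have a4 : k ^ 4 * l * n ≤ k ^ 4 * l * N := by gcongr
  have a5 : 1 * 1 * n ≤ k ^ 4 * l * N := by gcongr; omega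
  have hr : rows q l ≤ 3 * k ^ 2 * l := by unfold rows; gcongr
  unfold splitterTime
  split_ifs with h3
  · calc (9 * n + 8) * rows q l + 6 ≤ (9 * n + 8) * (3 * k ^ 2 * l) + 6 := by gcongr
      _ = 27 * (k ^ 2 * l * n) + 24 * (k ^ 2 * l * 1) + 6 := by ring
      _ ≤ 158 * (k ^ 4 * l * N) := by omega
  · have hN2 : n ^ 2 ≤ N := hN ▸ Nat.pow_le_pow_right hn (by omega)
    have b1 : k ^ 2 * l * n ^ 2 ≤ k ^ 4 * l * N := by gcongr
    have b2 : 1 * 1 * n ^ 2 ≤ k ^ 4 * l * N := by gcongr; omega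
    calc ((12 * q ^ 2 + 19 * n + 16) * rows q l + 4 * n + 9) * n + 4
        ≤ ((12 * k ^ 2 + 19 * n + 16) * (3 * k ^ 2 * l) + 4 * n + 9) * n + 4 := by gcongr
      _ = 36 * (k ^ 4 * l * n) + 57 * (k ^ 2 * l * n ^ 2) + 48 * (k ^ 2 * l * n) +
          4 * (1 * 1 * n ^ 2) + 9 * (1 * 1 * n) + 4 := by ring
      _ ≤ 158 * (k ^ 4 * l * N) := by omega

/-- There are `2 * q ^ 2` recolorings and at most `3 * k ^ 2 * l` hash functions, and a pass takes
`O(k * N)` steps. -/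
theorem divisionsTime_le {n k q l N : ℕ} (hq : 0 < q) (hqk : q ≤ k) (hl : 0 < l)
    (h1 : n ^ ((q + 1) / 2) ≤ N) (h2 : n ^ (q / 2) ≤ N) (hN : 0 < N) :
    divisionsTime n q l ≤ 1217 * (k ^ 5 * l * N) := by
  have hk : 0 < k := by omega
  have hk4 : k ^ 4 ≤ k ^ 5 := Nat.pow_le_pow_right hk (by omega)
  have hk2 : k ^ 2 ≤ k ^ 5 := Nat.pow_le_pow_right hk (by omega)
  have hk1 : 1 ≤ k ^ 5 := Nat.one_le_pow _ _ hk
  have hp : passTime n q ≤ 191 * (k * N) := by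
    have a1 : 1 * N ≤ k * N := by gcongr; omega
    have a2 : 1 * 1 ≤ k * N := by gcongr <;> omega
    calc passTime n q ≤ (21 * k + 21 * k + 51) * (N + N) + 5 := by
          unfold passTime; gcongr <;> omega
      _ = 84 * (k * N) + 102 * (1 * N) + 5 := by ring
      _ ≤ 191 * (k * N) := by omega
  have hr : rows q l ≤ 3 * k ^ 2 * l := by unfold rows; gcongr
  have b1 : k ^ 4 * l * 1 ≤ k ^ 5 * l * N := by gcongr; omega
  have b2 : k ^ 2 * 1 * 1 ≤ k ^ 5 * l * N := by gcongr <;> omega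
  have b3 : 1 * 1 * 1 ≤ k ^ 5 * l * N := by gcongr <;> omega
  calc divisionsTime n q l
      ≤ ((191 * (k * N) + 4) * (3 * k ^ 2 * l) + 16) * (2 * k ^ 2) + 6 * k ^ 2 + 9 := by
        unfold divisionsTime; gcongr
    _ = 1146 * (k ^ 5 * l * N) + 24 * (k ^ 4 * l * 1) + 38 * (k ^ 2 * 1 * 1) + 9 := by ring
    _ ≤ 1217 * (k ^ 5 * l * N) := by omega

theorem sizedTime_le {n k q l : ℕ} (hn : 0 < n) (hq : 0 < q) (hqk : q ≤ k) (hl : 0 < l) :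
    sizedTime n q l ≤ 1550 * (k ^ 5 * l * n ^ ((k + 1) / 2)) := by
  have hk : 0 < k := by omega
  have h0 := splitterTime_le hn hq hqk hl
  obtain ⟨N, hN⟩ : ∃ N, n ^ ((k + 1) / 2) = N := ⟨_, rfl⟩
  have hN0 : 0 < N := hN ▸ Nat.pow_pos hn
  have h1 : n ^ ((q + 1) / 2) ≤ N := hN ▸ Nat.pow_le_pow_right hn (by omega)
  have h2 : n ^ (q / 2) ≤ N := hN ▸ Nat.pow_le_pow_right hn (by omega)
  rw [hN] at h0 ⊢
  have h3 := codesTime_le (m := (q + 1) / 2) (k := k) (by omega) hk hl h1 hN0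
  have h4 := codesTime_le (m := q / 2) (k := k) (by omega) hk hl h2 hN0
  have h5 := divisionsTime_le hq hqk hl h1 h2 hN0
  have a1 : k ^ 1 * l * N ≤ k ^ 5 * l * N := by gcongr; omega
  have a2 : k ^ 4 * l * N ≤ k ^ 5 * l * N := by gcongr; omega
  have a3 : 1 * 1 * 1 ≤ k ^ 5 * l * N := by
    gcongr
    · exact Nat.one_le_pow _ _ hk
    · omega
    · omega
  rw [pow_one] at a1
  unfold sizedTime
  omega

/-! ### The program -/

/-- The search that begins with the size that `P` writes into variable `3`. -/
def mainProg (P : Prog) : Prog := prepareProg ;; P ;; searchProg ;; finishProg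

/-- The program `P` writes `q` into variable `3` and changes nothing else that matters. -/
def SetsSize (B : ℕ) (P : Prog) (k q : ℕ) : Prop :=
  ∀ s : State, s.var 1 = k → wp B P s fun s' t => t ≤ 2 ∧ s'.var 3 = q ∧ s'.arr = s.arr ∧
    s'.num = s.num ∧ ∀ x, x ≠ 3 → x ≠ 99 → s'.var x = s.var x

theorem setsSize_mov {B k : ℕ} (hB : k < B) : SetsSize B (mov 3 1) k k := by
  intro s hs
  simp [hs]
  exact ⟨hB, fun x h3 h99 => by simp [h3, h99]⟩

theorem setsSize_const {B k : ℕ} (hB : 1 < B) : SetsSize B (.const 3 1) k 1 := by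
  intro s hs
  simp [hB]
  exact fun x h3 h99 => by simp [h3]

/-- The two sets are disjoint, so each job is flipped at most once, and on `0` and `1` truncated
subtraction from `1` agrees with subtraction in `Fin 2`. -/
theorem swap_union_eq {n m₁ m₂ e₁ e₂ : ℕ} {σ : Schedule n} {a a' : ℕ → ℕ}
    (ha : ∀ j : Fin n, a j = σ j)
    (hd : Disjoint (codeSet n m₁ e₁) (codeSet n m₂ e₂))
    (ha' : ∀ g, a' g = if g ∈ (Finset.range m₂).image (digit n e₂) then
        1 - (if g ∈ (Finset.range m₁).image (digit n e₁) then 1 - a g else a g)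
      else if g ∈ (Finset.range m₁).image (digit n e₁) then 1 - a g else a g) (j : Fin n) :
    a' j = swap σ (codeSet n m₁ e₁ ∪ codeSet n m₂ e₂) j := by
  have h1 : ∀ m e, (j : ℕ) ∈ (Finset.range m).image (digit n e) ↔ j ∈ codeSet n m e :=
    fun m e => by simp only [codeSet, Finset.mem_filter, Finset.mem_univ, true_and]
  have hsub : 1 - (σ j : ℕ) = (1 - σ j : Fin 2) := by
    generalize σ j = x
    fin_cases x <;> rfl
  rw [ha', ha, swap]
  simp only [h1, Finset.mem_union]
  by_cases c1 : j ∈ codeSet n m₁ e₁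
  · have c2 : j ∉ codeSet n m₂ e₂ := Finset.disjoint_left.1 hd c1
    simp [c1, c2, hsub]
  · by_cases c2 : j ∈ codeSet n m₂ e₂ <;> simp [c1, c2, hsub]

theorem mainProg_spec {P : Prog} {n k q₀ : ℕ} (hn : 2 ≤ n) (hk : 2 ≤ k) (hq0 : 0 < q₀)
    (hqk : q₀ ≤ k) (hP : SetsSize (n ^ (15 * k)) P k q₀) (p : Fin n → ℝ) (σ : Schedule n) :
    wp (n ^ (15 * k)) (mainProg P) (input k p σ) fun s' t =>
      t ≤ 1700 * (k ^ 6 * Nat.clog 2 n * n ^ ((k + 1) / 2)) ∧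
      ∃ b σ', Returns s' b σ' ∧
        IsAnswer p σ (Finset.Icc q₀ k) (hashFamily n (Nat.clog 2 n)) b σ' := by
  have hB := fun q (_ : 0 < q) (hq : q ≤ k) => wordBound_pow hn hk hq
  have hT := fun q (h : 0 < q) (hq : q ≤ k) =>
    sizedTime_le (n := n) (by omega) h hq (Nat.clog_pos (b := 2) (by norm_num) hn)
  have hl0 : 0 < Nat.clog 2 n := Nat.clog_pos (by norm_num) hn
  have hnl : n ≤ 2 ^ Nat.clog 2 n := Nat.le_pow_clog (by norm_num) n
  have hBk : n ^ k * 8 ≤ n ^ (15 * k) := by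
    have h1 : 2 ^ 3 ≤ n ^ (14 * k) :=
      (Nat.pow_le_pow_left hn 3).trans (Nat.pow_le_pow_right (by omega) (by omega))
    calc n ^ k * 8 ≤ n ^ k * n ^ (14 * k) := Nat.mul_le_mul_left _ h1
      _ = n ^ (15 * k) := by rw [← pow_add]; ring_nf
  have hkM : k < n ^ k := Nat.lt_two_pow_self.trans_le (Nat.pow_le_pow_left hn k)
  have hnM : n ^ 2 ≤ n ^ k := Nat.pow_le_pow_right (by omega) hk
  have hnM' : 2 * n ≤ n ^ k := by nlinarith
  generalize hl : Nat.clog 2 n = l at *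
  unfold mainProg
  rw [wp_seq]
  refine wp.call (prepareProg_spec hn (by omega)) ?_
  rintro s₁ t₁ F1 ⟨ht1, a1, a2, a3⟩
  rw [hl] at ht1 a1
  rw [wp_seq]
  refine wp.call (hP s₁ (by rw [F1.var 1]; simp [input])) ?_
  rintro s₂ t₂ - ⟨ht2, b1, b2, b3, b4⟩
  have n2 : s₂.var 0 = n := by rw [b4 0 (by omega) (by omega), F1.var 0]; simp [input]
  have k2 : s₂.var 1 = k := by rw [b4 1 (by omega) (by omega), F1.var 1]; simp [input]
  rw [← b3] at a2 a3
  have hR : Recorded s₂ 0 0 0 0 0 := by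
    constructor
    · rw [b4 2 (by omega) (by omega), F1.var 2]; simp [input]
    · rw [b4 12 (by omega) (by omega), F1.var 12]; simp [input]
    · rw [b4 13 (by omega) (by omega), F1.var 13]; simp [input]
    · rw [b4 14 (by omega) (by omega), F1.var 14]; simp [input]
    · rw [b4 15 (by omega) (by omega), F1.var 15]; simp [input]
  rw [wp_seq]
  refine wp.call (searchProg_spec n2 k2 b1 (by rw [b4 9 (by omega) (by omega), a1]) rfl
    (by rw [b3, F1.num 6]; simp [input]) a2 (by omega) hq0 hqk hl0 hnl hB (by omega) hT hR) ?_
  rintro s₃ t₃ F3 ⟨ht3, hS⟩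
  have n3 : s₃.var 0 = n := by rw [F3.var 0, n2]
  have hσ : ∀ j : Fin n, s₃.arr 0 j = σ j := fun j => by
    rw [F3.arr 0, b2, F1.arr 0]
    simp [input]
  have htime : ∀ t₄ ≤ 12 * k + 12,
      t₁ + (t₂ + (t₃ + t₄)) ≤ 1700 * (k ^ 6 * l * n ^ ((k + 1) / 2)) := by
    intro t₄ ht4
    have hN1 : n ^ 1 ≤ n ^ ((k + 1) / 2) := Nat.pow_le_pow_right (by omega) (by omega)
    rw [pow_one] at hN1
    generalize n ^ ((k + 1) / 2) = N at *
    have hk6 : 1 ≤ k ^ 6 := Nat.one_le_pow _ _ (by omega)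
    have hk1 : k ^ 1 ≤ k ^ 6 := Nat.pow_le_pow_right (by omega) (by omega)
    rw [pow_one] at hk1
    have c1 : 1 * 1 * n ≤ k ^ 6 * l * N := by gcongr; omega
    have c2 : 1 * l * 1 ≤ k ^ 6 * l * N := by gcongr; omega
    have c3 : k * 1 * 1 ≤ k ^ 6 * l * N := by gcongr <;> omega
    -- At most `k` sizes are searched, which raises `k ^ 5` to `k ^ 6`.
    have c4 : (1550 * (k ^ 5 * l * N) + 3) * (k + 1 - q₀) ≤ 1550 * (k ^ 6 * l * N) + 3 * k := by
      calc (1550 * (k ^ 5 * l * N) + 3) * (k + 1 - q₀)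
          ≤ (1550 * (k ^ 5 * l * N) + 3) * k := by gcongr; omega
        _ = 1550 * (k ^ 6 * l * N) + 3 * k := by ring
    omega
  rcases hS with ⟨hrec, hno⟩ | ⟨q, i, r, ⟨hqs, hi, hr⟩, e₁, he₁, e₂, he₂, hhit, hrec⟩
  -- The record is all zeros; codes of length `0` are valid for any condition, and flipping them
  -- leaves the schedule as it was.
  · refine wp.call (finishProg_spec (P₁ := fun _ => True) (P₂ := fun _ => True) n3 hrec
      ⟨by omega, by omega⟩ ⟨by omega, by omega⟩ (by omega)) ?_
    rintro s₄ t₄ - ⟨ht4, d1, d2⟩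
    refine ⟨htime _ (by omega), false, σ, ⟨d1, fun j => ?_⟩, Or.inr ⟨rfl, rfl, ?_⟩⟩
    · rw [d2, ← hσ]
      simp
    · intro q hq h hh i hi S₁ S₂ hhit
      rw [Finset.mem_Icc] at hq
      obtain ⟨r, hr, rfl⟩ := (mem_hashFamily (by omega)).1 hh
      obtain ⟨e₁, he₁, e₂, he₂, hc⟩ := hhit.exists_codeHit (by omega) (by omega) a3
      exact hno q i r ⟨hq, hi, hr⟩ e₁ he₁ e₂ he₂ hc
  · have hq : 0 < q := by omega
    have hit := hhit.isHit (by omega) hq a3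
    have hE₁ : n ^ ((q + 1) / 2) ≤ n ^ k := Nat.pow_le_pow_right (by omega) (by omega)
    have hE₂ : n ^ (q / 2) ≤ n ^ k := Nat.pow_le_pow_right (by omega) (by omega)
    refine wp.call (finishProg_spec n3 hrec hhit.valid₁ hhit.valid₂ (by omega)) ?_
    rintro s₄ t₄ - ⟨ht4, d1, d2⟩
    refine ⟨htime _ (by omega), true, _,
      ⟨d1, swap_union_eq hσ (disjoint_compl_right.mono hit.1 hit.2.2.1) d2⟩,
      Or.inl ⟨rfl, q, Finset.mem_Icc.2 hqs, _, (mem_hashFamily hq).2 ⟨r, hr, rfl⟩, i, hi, _, _, hit, rfl⟩⟩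

/-- A hit has a surplus strictly between `0` and the gap, hence improves the makespan. Conversely,
by `exists_isHit` an improving swap of an admissible size would have produced a hit. -/
theorem IsAnswer.correct {n q₀ k l : ℕ} (hl : 0 < l) (hn : n ≤ 2 ^ l) (hq0 : 0 < q₀)
    {p : Fin n → ℝ} {σ σ' : Schedule n} {b : Bool}
    (h : IsAnswer p σ (Finset.Icc q₀ k) (hashFamily n l) b σ') :
    (b = true → makespan p σ' < makespan p σ ∧
      ∃ S : Finset (Fin n), S.card ∈ Finset.Icc q₀ k ∧ σ' = swap σ S) ∧
    (b = false → ∀ S : Finset (Fin n), S.card ∈ Finset.Icc q₀ k →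
      makespan p σ ≤ makespan p (swap σ S)) := by
  rcases h with ⟨rfl, q, hq, h, -, i, -, S₁, S₂, hit, rfl⟩ | ⟨rfl, rfl, hno⟩
  · exact ⟨fun _ => ⟨hit.makespan_lt, _, by rwa [hit.card_union], rfl⟩, by simp⟩
  · refine ⟨by simp, fun _ S hS => ?_⟩
    by_contra hlt
    obtain ⟨h, hh, i, hi, S₁, S₂, hit⟩ := exists_isHit hl hn
      (by rw [Finset.mem_Icc] at hS; omega) rfl (not_le.1 hlt)
    exact hno _ hS h hh i hi S₁ S₂ hit

/-- From `2 ^ clog ≤ 2 * n` one gets `clog ≤ 2 * log n / log 2 ≤ 3 * log n`, and `1 ≤ 2 * log k`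
because `k ≥ 2`. -/
theorem clog_le_log {n k : ℕ} (hn : 2 ≤ n) (hk : 2 ≤ k) :
    (Nat.clog 2 n : ℝ) ≤ 6 * Real.log k * Real.log n := by
  have h2 := Real.log_two_gt_d9
  have hln : Real.log 2 ≤ Real.log n := Real.log_le_log (by norm_num) (by exact_mod_cast hn)
  have hlk : Real.log 2 ≤ Real.log k := Real.log_le_log (by norm_num) (by exact_mod_cast hk)
  have h : (Nat.clog 2 n : ℝ) * Real.log 2 ≤ Real.log 2 + Real.log n := by
    rw [← Real.log_pow, ← Real.log_mul (by norm_num) (by positivity)]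
    exact Real.log_le_log (by positivity) (by exact_mod_cast two_pow_clog_le hn)
  have h0 : (0 : ℝ) ≤ Nat.clog 2 n := Nat.cast_nonneg _
  have h3 : (Nat.clog 2 n : ℝ) ≤ 3 * Real.log n := by nlinarith
  nlinarith

/-- The search over all sizes from `q₀ k` to `k`, with its splitters, time and correctness. -/
theorem exists_search {P : Prog} {q₀ : ℕ → ℕ}
    (hP : ∀ B k, k < B → 1 < B → SetsSize B P k (q₀ k)) (hq0 : ∀ k, 2 ≤ k → 0 < q₀ k ∧ q₀ k ≤ k)
    {n k : ℕ} (hn : 2 ≤ n) (hk : 2 ≤ k) :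
    ∃ H : (q : ℕ) → Finset (Fin n → Fin (q ^ 2)),
      (∀ q ∈ Finset.Icc (q₀ k) k, IsSplitter q (H q) ∧
        ((H q).card : ℝ) ≤ 10200 * (k : ℝ) ^ 6 * Real.log k * Real.log n) ∧
      ∀ p : Fin n → ℝ, (∀ j, 0 ≤ p j) → ∀ σ : Schedule n,
        ∃ (s : State) (t : ℕ) (b : Bool) (σ' : Schedule n),
          Exec (n ^ (15 * k)) (mainProg P) (input k p σ) s t ∧
          Returns s b σ' ∧
          (t : ℝ) ≤ 10200 * (k : ℝ) ^ 9 * (n : ℝ) ^ ((k + 1) / 2) * Real.log n * Real.log k ∧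
          IsAnswer p σ (Finset.Icc (q₀ k) k) H b σ' ∧
          (b = true → makespan p σ' < makespan p σ ∧
            ∃ S : Finset (Fin n), S.card ∈ Finset.Icc (q₀ k) k ∧ σ' = swap σ S) ∧
          (b = false → ∀ S : Finset (Fin n), S.card ∈ Finset.Icc (q₀ k) k →
            makespan p σ ≤ makespan p (swap σ S)) := by
  obtain ⟨h0, h0k⟩ := hq0 k hk
  have hl0 : 0 < Nat.clog 2 n := Nat.clog_pos (by norm_num) hn
  have hnl : n ≤ 2 ^ Nat.clog 2 n := Nat.le_pow_clog (by norm_num) n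
  have hlog := clog_le_log hn hk
  have hk1 : (1 : ℝ) ≤ k := by exact_mod_cast (by omega : 1 ≤ k)
  have hL0 : 0 ≤ Real.log k * Real.log n :=
    mul_nonneg (Real.log_natCast_nonneg k) (Real.log_natCast_nonneg n)
  refine ⟨hashFamily n (Nat.clog 2 n), fun q hq => ?_, fun p _ σ => ?_⟩
  · rw [Finset.mem_Icc] at hq
    refine ⟨isSplitter_hashFamily hl0 hnl (by omega), ?_⟩
    have h1 : ((hashFamily n (Nat.clog 2 n) q).card : ℝ) ≤ 3 * (k : ℝ) ^ 2 * Nat.clog 2 n := by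
      have : (hashFamily n (Nat.clog 2 n) q).card ≤ 3 * k ^ 2 * Nat.clog 2 n :=
        (card_hashFamily_le _ _ _).trans (by unfold rows; gcongr; omega)
      exact_mod_cast this
    have hk6 : (k : ℝ) ^ 2 ≤ (k : ℝ) ^ 6 := pow_le_pow_right₀ hk1 (by norm_num)
    have hk0 : (0 : ℝ) ≤ (k : ℝ) ^ 6 * (Real.log k * Real.log n) := by positivity
    calc _ ≤ _ := h1
      _ ≤ 3 * (k : ℝ) ^ 6 * (6 * Real.log k * Real.log n) := by gcongr
      _ ≤ 10200 * (k : ℝ) ^ 6 * Real.log k * Real.log n := by nlinarith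
  · have hkB : k < n ^ (15 * k) := Nat.lt_two_pow_self.trans_le
      ((Nat.pow_le_pow_left hn k).trans (Nat.pow_le_pow_right (by omega) (by omega)))
    have h := mainProg_spec hn hk h0 h0k (hP _ k hkB (by omega)) p σ
    unfold wp at h
    obtain ⟨s, t, hE, ht, b, σ', hR, hA⟩ := h
    refine ⟨s, t, b, σ', hE, hR, ?_, hA, hA.correct hl0 hnl h0⟩
    have ht' : (t : ℝ) ≤ 1700 * ((k : ℝ) ^ 6 * Nat.clog 2 n * (n : ℝ) ^ ((k + 1) / 2)) := by
      exact_mod_cast ht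
    have hk9 : (k : ℝ) ^ 6 ≤ (k : ℝ) ^ 9 := pow_le_pow_right₀ hk1 (by norm_num)
    -- The constant is `10200 = 6 * 1700`, with the `6` from `clog_le_log`.
    calc (t : ℝ) ≤ _ := ht'
      _ ≤ 1700 * ((k : ℝ) ^ 9 * (6 * Real.log k * Real.log n) * (n : ℝ) ^ ((k + 1) / 2)) := by
        gcongr
      _ = _ := by ring

end KSwap

/-- Swaps of exactly `k` jobs are the range of sizes from `k` to `k`, swaps of at most `k` jobs the
range from `1`; the two programs differ only in how they set the first size. -/
theorem mainTheorem2 (sizes : ℕ → Finset ℕ)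
    (hsizes : (∀ k, sizes k = {k}) ∨ (∀ k, sizes k = Finset.Icc 1 k)) :
    ∃ (P : KSwap.Prog) (C : ℝ) (c : ℕ), ∀ n k : ℕ, 2 ≤ n → 2 ≤ k →
      ∃ H : (q : ℕ) → Finset (Fin n → Fin (q ^ 2)),
        (∀ q ∈ sizes k, KSwap.IsSplitter q (H q) ∧
          ((H q).card : ℝ) ≤ C * (k : ℝ) ^ 6 * Real.log k * Real.log n) ∧
        ∀ p : Fin n → ℝ, (∀ j, 0 ≤ p j) → ∀ σ : KSwap.Schedule n,
          ∃ (s : KSwap.State) (t : ℕ) (b : Bool) (σ' : KSwap.Schedule n),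
            -- `P` halts after `t` steps with answer `(b, σ')`, using words below `n ^ (c * k)`
            KSwap.Exec (n ^ (c * k)) P (KSwap.input k p σ) s t ∧
            KSwap.Returns s b σ' ∧
            (t : ℝ) ≤ C * (k : ℝ) ^ 9 * (n : ℝ) ^ ((k + 1) / 2) * Real.log n * Real.log k ∧
            -- this is an answer of the search over the divisions given by `H`
            KSwap.IsAnswer p σ (sizes k) H b σ' ∧
            -- and the answer is correct
            (b = true → KSwap.makespan p σ' < KSwap.makespan p σ ∧
              ∃ S : Finset (Fin n), S.card ∈ sizes k ∧ σ' = KSwap.swap σ S) ∧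
            (b = false → ∀ S : Finset (Fin n), S.card ∈ sizes k →
              KSwap.makespan p σ ≤ KSwap.makespan p (KSwap.swap σ S)) := by
  rcases hsizes with h | h
  · refine ⟨KSwap.mainProg (KSwap.mov 3 1), 10200, 15, fun n k hn hk => ?_⟩
    rw [h, ← Finset.Icc_self]
    exact KSwap.exists_search (q₀ := fun k => k) (fun _ _ hB _ => KSwap.setsSize_mov hB)
      (fun k hk => ⟨by omega, le_rfl⟩) hn hk
  · refine ⟨KSwap.mainProg (.const 3 1), 10200, 15, fun n k hn hk => ?_⟩
    rw [h]
    exact KSwap.exists_search (q₀ := fun _ => 1) (fun _ _ _ hB => KSwap.setsSize_const hB)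
      (fun k hk => ⟨by omega, by omega⟩) hn hk
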